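/- Let $n\ge 2$ and consider either of the two standard presentations of the braid group $B_n$. * Old (Artin) presentation: generators $\sigma_1,\dots,\sigma_{n-1}$; relations $\sigma_i\sigma_j=\sigma_j\sigma_i$ for $|i-j|>1$ and $\sigma_i\sigma_j\sigma_i=\sigma_j\sigma_i\sigma_j$ for $|i-j|=1$; fundamental braid $\mathbf D=(\sigma_1\cdots\sigma_{n-1})(\sigma_1\cdots\sigma_{n-2})\cdots(\sigma_1\sigma_2)\sigma_1$; $\tau$ is the automorphism of $B_n$ with $\tau(\sigma_i)=\sigma_{n-i}$. * New (Birman–Ko–Lee) presentation: generators $a_{ts}$, $n\ge t>s\ge 1$; relations $a_{ts}a_{rq}=a_{rq}a_{ts}$ if $(t-r)(t-q)(s-r)(s-q)>0$, and $a_{ts}a_{sr}=a_{tr}a_{ts}=a_{sr}a_{tr}$ for $n\ge t>s>r\ge 1$; fundamental braid $\mathbf D=a_{n(n-1)}a_{(n-1)(n-2)}\cdots a_{21}$; $\tau$ is the automorphism of $B_n$ with $\tau(a_{ts})=a_{(t+1)(s+1)}$, where indices are read modulo $n$ and $a_{ij}=a_{ji}$. Write $|\mathbf D|$ for the letter length of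 the positive word $\mathbf D$. A braid is positive if it is represented by a positive word in the generators (possibly empty, representing $e$). Write $V\le W$ if $W=VP$ with $P$ positive. Let $\mathbf Q$ be the set of positive $A$ with $A\le\mathbf D$, and $\mathbf Q^\star=\mathbf Q\setminus\{e,\mathbf D\}$. For $A\in\mathbf Q$ and $P$ positive, the product $AP$ is left-greedy if every $A'\in\mathbf Q$ with $A'\le AP$ satisfies $A'\le A$. Every $W\in B_n$ has a unique normal form $W=\mathbf D^uA_1A_2\cdots A_k$ with $u\in\mathbb Z$, $k\ge 0$, $A_i\in\mathbf Q^\star$ and each product $A_iA_{i+1}$ left-greedy; put $\inf(W)=u$, $\sup(W)=u+k$, and, for $k\ge 1$, $$\mathbf c(W)=\mathbf D^uA_2\cdots A_k\,\tau^{-u}(A_1),\qquad \mathbf d(W)=\mathbf D^u\,\tau^u(A_k)A_1\cdots A_{k-1}$$ (cycling and decycling), with $\mathbf c(W)=\mathbf d(W)=W$ if $k=0$. Theorem. Let $W\in B_n$, with conjugacy class $[W]$. If $\inf(W)<\inf(V)$ for some $V\in[W]$, then $\inf(\mathbf c^{|\mathbf D|-1}(W))>\inf(W)$. If $\sup(V)<\sup(W)$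 for some $V\in[W]$, then $\sup(\mathbf d^{|\mathbf D|-1}(W))<\sup(W)$. Here $|\mathbf D|-1=\frac{n^2-n}{2}-1$ for the old presentation and $|\mathbf D|-1=n-2$ for the new one. -/

import Mathlib

/-- The data of one of the two standard presentations of a braid group: generators, defining
relations, a positive word for the fundamental braid `D`, and the index-shift automorphism `τ`.
It is used only for the two concrete presentations `oldPresentation n`, `newPresentation n`. -/
structure BraidPresentation where
  /-- the generators -/
  Gen : Type
  /-- the defining relators -/
  rels : Set (FreeGroup Gen)
  /-- the positive word defining the fundamental braid -/
  fundWord : List Gen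
  /-- the index-shift automorphism `τ` -/
  shift : MulAut (PresentedGroup rels)

namespace BraidPresentation

/-! ### Notions common to the two presentations -/

variable (X : BraidPresentation)

/-- The group defined by the presentation. -/
abbrev Braid : Type := PresentedGroup X.rels

/-- The braid represented by a positive word. -/
def ofWord (w : List X.Gen) : X.Braid := (w.map fun a => PresentedGroup.of a).prod

/-- The braids represented by positive words. -/
def IsPositive (W : X.Braid) : Prop := ∃ w : List X.Gen, X.ofWord w = W

/-- The fundamental braid `D`. -/
def fund : X.Braid := X.ofWord X.fundWord

/-- The letter length `|D|`. -/
def fundLength : ℕ := X.fundWord.length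

/-- `V ≤ W`: there is a positive `P` with `W = V P`. -/
def LE (V W : X.Braid) : Prop := ∃ P, X.IsPositive P ∧ W = V * P

/-- The set `Q` of initial subwords of `D`: positive `A` with `D = A B` for a positive `B`. -/
def Q : Set X.Braid := {A | X.IsPositive A ∧ X.LE A X.fund}

/-- The set `Q⋆ = Q \ {e, D}` of canonical factors. -/
def QStar : Set X.Braid := X.Q \ {1, X.fund}

/-- The product `A P` is a left-greedy decomposition: `A ∈ Q`, `P` is positive, and every
`A' ∈ Q` with `A P = A' P'`, `P'` positive, satisfies `A' ≤ A`. -/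
def LeftGreedy (A P : X.Braid) : Prop :=
  A ∈ X.Q ∧ X.IsPositive P ∧ ∀ A' ∈ X.Q, X.LE A' (A * P) → X.LE A' A

/-- `(u, [A₁, …, A_k])` is a normal form of `W`: `W = D ^ u A₁ ⋯ A_k`, all `A_i ∈ Q⋆`, and
`A_i A_{i+1}` is a left-greedy decomposition for `1 ≤ i ≤ k - 1`. -/
def IsNormalForm (W : X.Braid) (N : ℤ × List X.Braid) : Prop :=
  W = X.fund ^ N.1 * N.2.prod ∧ (∀ A ∈ N.2, A ∈ X.QStar) ∧ N.2.IsChain X.LeftGreedy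

/-- The normal form of `W` (a normal form exists and is unique for the presentations below). -/
noncomputable def normalForm (W : X.Braid) : ℤ × List X.Braid :=
  Classical.epsilon (X.IsNormalForm W)

/-- `inf W = u` for the normal form `D ^ u A₁ ⋯ A_k` of `W`. -/
noncomputable def inf (W : X.Braid) : ℤ := (X.normalForm W).1

/-- `sup W = u + k` for the normal form `D ^ u A₁ ⋯ A_k` of `W`. -/
noncomputable def sup (W : X.Braid) : ℤ := (X.normalForm W).1 + (X.normalForm W).2.length

/-- Cycling: `D ^ u A₁ ⋯ A_k ↦ D ^ u A₂ ⋯ A_k τ⁻ᵘ(A₁)`; it fixes `D ^ u` (the case `k = 0`). -/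
noncomputable def cycling (W : X.Braid) : X.Braid :=
  match X.normalForm W with
  | (_, []) => W
  | (u, A :: L) => X.fund ^ u * L.prod * (X.shift ^ (-u)) A

/-- Decycling: `D ^ u A₁ ⋯ A_k ↦ D ^ u τᵘ(A_k) A₁ ⋯ A_{k-1}`; it fixes `D ^ u` (the case
`k = 0`). -/
noncomputable def decycling (W : X.Braid) : X.Braid :=
  match X.normalForm W with
  | (_, []) => W
  | (u, A :: L) =>
      X.fund ^ u * (X.shift ^ u) ((A :: L).getLast (List.cons_ne_nil A L)) * (A :: L).dropLast.prod

end BraidPresentation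

/-- A permutation of the generators which, like its inverse, respects the relations
induces an automorphism of the presented group. -/
def PresentedGroup.autOfEquiv {ι : Type} (rels : Set (FreeGroup ι)) (e : ι ≃ ι)
    (h : ∀ r ∈ rels, FreeGroup.lift (fun i => PresentedGroup.of (rels := rels) (e i)) r = 1)
    (h' : ∀ r ∈ rels, FreeGroup.lift (fun i => PresentedGroup.of (rels := rels) (e.symm i)) r = 1) :
    MulAut (PresentedGroup rels) :=
  MonoidHom.toMulEquiv (PresentedGroup.toGroup h) (PresentedGroup.toGroup h')
    (by ext i; simp) (by ext i; simp)

/-! ### The old (Artin) presentation -/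

/-- The relators of the Artin presentation. The index `i : Fin (n - 1)`, counted from `0`, stands
for the generator `σ_{i+1}`. -/
inductive OldRel (n : ℕ) : FreeGroup (Fin (n - 1)) → Prop
  | comm (i j : Fin (n - 1)) (h : 1 < |(i : ℤ) - (j : ℤ)|) :
      OldRel n (.of i * .of j * (.of j * .of i)⁻¹)
  | braid (i j : Fin (n - 1)) (h : |(i : ℤ) - (j : ℤ)| = 1) :
      OldRel n (.of i * .of j * .of i * (.of j * .of i * .of j)⁻¹)

theorem oldRel_rev (n : ℕ) : ∀ r ∈ {r | OldRel n r},
    FreeGroup.lift (fun i => PresentedGroup.of (rels := {r | OldRel n r}) (Fin.revPerm i)) r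
      = 1 := by
  have key : ∀ i j : Fin (n - 1),
      |((Fin.rev i : Fin (n - 1)) : ℤ) - ((Fin.rev j : Fin (n - 1)) : ℤ)| = |(i : ℤ) - (j : ℤ)| := by
    intro i j
    have h1 : ((Fin.rev i : Fin (n - 1)) : ℤ) = ((n - 1 : ℕ) : ℤ) - 1 - i := by
      have := i.2; rw [Fin.val_rev]; omega
    have h2 : ((Fin.rev j : Fin (n - 1)) : ℤ) = ((n - 1 : ℕ) : ℤ) - 1 - j := by
      have := j.2; rw [Fin.val_rev]; omega
    rw [h1, h2, abs_sub_comm (i : ℤ)]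
    congr 1
    ring
  rintro r (⟨i, j, h⟩ | ⟨i, j, h⟩)
  · have := PresentedGroup.one_of_mem (rels := {r | OldRel n r})
      (OldRel.comm (Fin.rev i) (Fin.rev j) (by rwa [key]))
    simpa [PresentedGroup.of] using this
  · have := PresentedGroup.one_of_mem (rels := {r | OldRel n r})
      (OldRel.braid (Fin.rev i) (Fin.rev j) (by rwa [key]))
    simpa [PresentedGroup.of] using this

/-- The old (Artin) presentation of `B_n`, with
`D = Δ = (σ₁ ⋯ σ_{n-1}) (σ₁ ⋯ σ_{n-2}) ⋯ (σ₁ σ₂) σ₁` and `τ(σ_i) = σ_{n-i}`. -/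
def oldPresentation (n : ℕ) : BraidPresentation where
  Gen := Fin (n - 1)
  rels := {r | OldRel n r}
  fundWord := (List.finRange (n - 1)).reverse.flatMap
    fun (k : Fin (n - 1)) => (List.finRange (n - 1)).filter fun (i : Fin (n - 1)) => i ≤ k
  shift := PresentedGroup.autOfEquiv _ Fin.revPerm (oldRel_rev n) (oldRel_rev n)

/-! ### The new (Birman–Ko–Lee) presentation -/

/-- The generators `a_{ts}`, `t > s`, with indices counted from `0`. -/
@[ext] structure BandGen (n : ℕ) where
  /-- the larger index -/
  t : Fin n
  /-- the smaller index -/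
  s : Fin n
  /-- the indices are ordered -/
  lt : s < t

/-- The relators of the Birman–Ko–Lee presentation. -/
inductive NewRel (n : ℕ) : FreeGroup (BandGen n) → Prop
  | comm (a b : BandGen n)
      (h : 0 < ((a.t : ℤ) - b.t) * ((a.t : ℤ) - b.s) * ((a.s : ℤ) - b.t) * ((a.s : ℤ) - b.s)) :
      NewRel n (.of a * .of b * (.of b * .of a)⁻¹)
  | left (t s r : Fin n) (hts : s < t) (hsr : r < s) :
      NewRel n (.of ⟨t, s, hts⟩ * .of ⟨s, r, hsr⟩ *
        (.of ⟨t, r, hsr.trans hts⟩ * .of ⟨t, s, hts⟩)⁻¹)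
  | right (t s r : Fin n) (hts : s < t) (hsr : r < s) :
      NewRel n (.of ⟨t, r, hsr.trans hts⟩ * .of ⟨t, s, hts⟩ *
        (.of ⟨s, r, hsr⟩ * .of ⟨t, r, hsr.trans hts⟩)⁻¹)

/-- The generator `a_{ij} = a_{ji}` for distinct `i`, `j` in either order. -/
def bandOf {n : ℕ} (i j : Fin n) (h : i ≠ j) : BandGen n :=
  if hji : j < i then ⟨i, j, hji⟩ else ⟨j, i, lt_of_le_of_ne (not_lt.mp hji) h⟩

theorem bandOf_comm {n : ℕ} (i j : Fin n) (h : i ≠ j) : bandOf i j h = bandOf j i h.symm := by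
  unfold bandOf
  split_ifs <;> first | rfl | (exfalso; omega)

theorem bandOf_lt {n : ℕ} (i j : Fin n) (h : j < i) : bandOf i j h.ne' = ⟨i, j, h⟩ := by
  simp [bandOf, h]

theorem bandOf_t_s {n : ℕ} (i j : Fin n) (h : i ≠ j) :
    ((bandOf i j h).t = i ∧ (bandOf i j h).s = j) ∨
      ((bandOf i j h).t = j ∧ (bandOf i j h).s = i) := by
  unfold bandOf
  split_ifs <;> simp

/-- The permutation `a_{ts} ↦ a_{π(t) π(s)}` of the generators. -/
def bandPerm {n : ℕ} (π : Equiv.Perm (Fin n)) : BandGen n ≃ BandGen n where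
  toFun g := bandOf (π g.t) (π g.s) (π.injective.ne g.lt.ne')
  invFun g := bandOf (π.symm g.t) (π.symm g.s) (π.symm.injective.ne g.lt.ne')
  left_inv g := by
    obtain ⟨t, s, h⟩ := g
    rcases bandOf_t_s (π t) (π s) (π.injective.ne h.ne') with ⟨h1, h2⟩ | ⟨h1, h2⟩
    · simp only [h1, h2, Equiv.symm_apply_apply]
      exact bandOf_lt t s h
    · simp only [h1, h2, Equiv.symm_apply_apply]
      rw [bandOf_comm]
      exact bandOf_lt t s h
  right_inv g := by
    obtain ⟨t, s, h⟩ := g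
    rcases bandOf_t_s (π.symm t) (π.symm s) (π.symm.injective.ne h.ne') with ⟨h1, h2⟩ | ⟨h1, h2⟩
    · simp only [h1, h2, Equiv.apply_symm_apply]
      exact bandOf_lt t s h
    · simp only [h1, h2, Equiv.apply_symm_apply]
      rw [bandOf_comm]
      exact bandOf_lt t s h

theorem newRel_comm {n : ℕ} (i j k l : Fin n) (hij : i ≠ j) (hkl : k ≠ l)
    (h : 0 < ((i : ℤ) - k) * ((i : ℤ) - l) * ((j : ℤ) - k) * ((j : ℤ) - l)) :
    PresentedGroup.of (rels := {r | NewRel n r}) (bandOf i j hij) *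
        PresentedGroup.of (bandOf k l hkl)
      = PresentedGroup.of (bandOf k l hkl) * PresentedGroup.of (bandOf i j hij) := by
  have := PresentedGroup.one_of_mem (rels := {r | NewRel n r})
    (NewRel.comm (bandOf i j hij) (bandOf k l hkl) (by
      rcases bandOf_t_s i j hij with ⟨h1, h2⟩ | ⟨h1, h2⟩ <;>
        rcases bandOf_t_s k l hkl with ⟨h3, h4⟩ | ⟨h3, h4⟩ <;> rw [h1, h2, h3, h4] <;>
        convert h using 1 <;> ring))
  rw [map_mul, map_inv, mul_inv_eq_one] at this
  simpa [PresentedGroup.of] using this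

theorem newRel_tri {n : ℕ} (x y z : Fin n) (hxy : x ≠ y) (hyz : y ≠ z) (hxz : x ≠ z)
    (h : (z < y ∧ y < x) ∨ (x < z ∧ z < y) ∨ (y < x ∧ x < z)) :
    PresentedGroup.of (rels := {r | NewRel n r}) (bandOf x y hxy) *
        PresentedGroup.of (bandOf y z hyz)
      = PresentedGroup.of (bandOf x z hxz) * PresentedGroup.of (bandOf x y hxy) ∧
    PresentedGroup.of (rels := {r | NewRel n r}) (bandOf x z hxz) *
        PresentedGroup.of (bandOf x y hxy)
      = PresentedGroup.of (bandOf y z hyz) * PresentedGroup.of (bandOf x z hxz) := by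
  have base : ∀ (t s r : Fin n) (hts : s < t) (hsr : r < s),
      PresentedGroup.of (rels := {r | NewRel n r}) (bandOf t s hts.ne') *
          PresentedGroup.of (bandOf s r hsr.ne')
        = PresentedGroup.of (bandOf t r (hsr.trans hts).ne') *
          PresentedGroup.of (bandOf t s hts.ne') ∧
      PresentedGroup.of (rels := {r | NewRel n r}) (bandOf t r (hsr.trans hts).ne') *
          PresentedGroup.of (bandOf t s hts.ne')
        = PresentedGroup.of (bandOf s r hsr.ne') *
          PresentedGroup.of (bandOf t r (hsr.trans hts).ne') := by
    intro t s r hts hsr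
    have h1 := PresentedGroup.one_of_mem (rels := {r | NewRel n r}) (NewRel.left t s r hts hsr)
    have h2 := PresentedGroup.one_of_mem (rels := {r | NewRel n r}) (NewRel.right t s r hts hsr)
    rw [map_mul, map_inv, mul_inv_eq_one, map_mul, map_mul] at h1 h2
    rw [bandOf_lt t s hts, bandOf_lt s r hsr, bandOf_lt t r (hsr.trans hts)]
    exact ⟨h1, h2⟩
  rcases h with ⟨h1, h2⟩ | ⟨h1, h2⟩ | ⟨h1, h2⟩
  · exact base x y z h2 h1
  · obtain ⟨e1, e2⟩ := base y z x h2 h1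
    rw [bandOf_comm y x, bandOf_comm z x] at e1 e2
    exact ⟨e2, (e1.trans e2).symm⟩
  · obtain ⟨e1, e2⟩ := base z x y h2 h1
    rw [bandOf_comm z x, bandOf_comm z y] at e1 e2
    exact ⟨(e1.trans e2).symm, e1⟩

/-- A permutation of the indices preserving cyclic order and the non-crossing condition
respects the relations. -/
theorem newRel_perm {n : ℕ} (π : Equiv.Perm (Fin n)) (e : BandGen n → BandGen n)
    (he : ∀ g, e g = bandOf (π g.t) (π g.s) (π.injective.ne g.lt.ne'))
    (hc : ∀ i j k l : Fin n,
      0 < ((i : ℤ) - k) * ((i : ℤ) - l) * ((j : ℤ) - k) * ((j : ℤ) - l) →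
      0 < ((π i : ℤ) - π k) * ((π i : ℤ) - π l) * ((π j : ℤ) - π k) * ((π j : ℤ) - π l))
    (ht : ∀ x y z : Fin n, (z < y ∧ y < x) → (π z < π y ∧ π y < π x) ∨
      (π x < π z ∧ π z < π y) ∨ (π y < π x ∧ π x < π z)) :
    ∀ r ∈ {r | NewRel n r},
      FreeGroup.lift (fun g => PresentedGroup.of (rels := {r | NewRel n r}) (e g)) r = 1 := by
  rintro r (⟨a, b, h⟩ | ⟨t, s, r, hts, hsr⟩ | ⟨t, s, r, hts, hsr⟩)
  · rw [map_mul, map_inv, mul_inv_eq_one, map_mul, map_mul]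
    simp only [FreeGroup.lift_apply_of, he]
    exact newRel_comm _ _ _ _ _ _ (hc _ _ _ _ h)
  · rw [map_mul, map_inv, mul_inv_eq_one, map_mul, map_mul]
    simp only [FreeGroup.lift_apply_of, he]
    exact (newRel_tri _ _ _ _ _ _ (ht t s r ⟨hsr, hts⟩)).1
  · rw [map_mul, map_inv, mul_inv_eq_one, map_mul, map_mul]
    simp only [FreeGroup.lift_apply_of, he]
    exact (newRel_tri _ _ _ _ _ _ (ht t s r ⟨hsr, hts⟩)).2

theorem finRotate_val {n : ℕ} (i : Fin n) :
    ((finRotate n i : Fin n) : ℕ) = if (i : ℕ) + 1 = n then 0 else (i : ℕ) + 1 := by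
  obtain _ | m := n
  · exact i.elim0
  · rw [finRotate_apply, Fin.val_add_one]
    simp [Fin.ext_iff]

theorem finRotate_comm_iff {n : ℕ} (i j k l : Fin n) :
    0 < ((finRotate n i : ℤ) - finRotate n k) * ((finRotate n i : ℤ) - finRotate n l) *
        ((finRotate n j : ℤ) - finRotate n k) * ((finRotate n j : ℤ) - finRotate n l) ↔
      0 < ((i : ℤ) - k) * ((i : ℤ) - l) * ((j : ℤ) - k) * ((j : ℤ) - l) := by
  let ε : Fin n → ℤ := fun i => if (i : ℕ) + 1 = n then -1 else 1
  have hε : ∀ i, ε i * ε i = 1 := by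
    intro i
    simp only [ε]
    split_ifs <;> norm_num
  have key : ∀ i k : Fin n, Int.sign ((finRotate n i : ℤ) - finRotate n k)
      = ε i * ε k * Int.sign ((i : ℤ) - k) := by
    intro i k
    have := i.2
    have := k.2
    rw [finRotate_val, finRotate_val]
    simp only [ε]
    split_ifs with h1 h2 h2
    · rw [show (i : ℤ) - k = 0 by omega]; simp
    · rw [Int.sign_eq_neg_one_of_neg (by omega), Int.sign_eq_one_of_pos (by omega)]; norm_num
    · rw [Int.sign_eq_one_of_pos (by omega), Int.sign_eq_neg_one_of_neg (by omega)]; norm_num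
    · push_cast
      rw [show (i : ℤ) + 1 - (k + 1) = i - k by ring]; ring
  rw [← Int.sign_eq_one_iff_pos, ← Int.sign_eq_one_iff_pos]
  simp only [Int.sign_mul, key]
  have h : ∀ a b c d p q r s : ℤ, a * a = 1 → b * b = 1 → c * c = 1 → d * d = 1 →
      a * c * p * (a * d * q) * (b * c * r) * (b * d * s) = p * q * r * s := by
    intro a b c d p q r s ha hb hc hd
    calc a * c * p * (a * d * q) * (b * c * r) * (b * d * s)
        = (a * a) * (b * b) * (c * c) * (d * d) * (p * q * r * s) := by ring
      _ = p * q * r * s := by rw [ha, hb, hc, hd]; ring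
  rw [h _ _ _ _ _ _ _ _ (hε i) (hε j) (hε k) (hε l)]

theorem finRotate_tri_iff {n : ℕ} (x y z : Fin n) :
    (finRotate n z < finRotate n y ∧ finRotate n y < finRotate n x) ∨
      (finRotate n x < finRotate n z ∧ finRotate n z < finRotate n y) ∨
      (finRotate n y < finRotate n x ∧ finRotate n x < finRotate n z) ↔
    (z < y ∧ y < x) ∨ (x < z ∧ z < y) ∨ (y < x ∧ x < z) := by
  have hx := finRotate_val x
  have hy := finRotate_val y
  have hz := finRotate_val z
  have := x.2
  have := y.2
  have := z.2
  simp only [Fin.lt_def]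
  split_ifs at hx hy hz <;> omega

/-- The new (Birman–Ko–Lee) presentation of `B_n`, with
`D = δ = a_{n(n-1)} a_{(n-1)(n-2)} ⋯ a_{21}` and `τ(a_{ts}) = a_{(t+1)(s+1)}`, where indices are
taken modulo `n` and `a_{ij} = a_{ji}`. -/
def newPresentation (n : ℕ) : BraidPresentation where
  Gen := BandGen n
  rels := {r | NewRel n r}
  fundWord := (List.finRange (n - 1)).reverse.map fun (k : Fin (n - 1)) =>
    ⟨⟨k + 1, by have := k.2; omega⟩, ⟨k, by have := k.2; omega⟩, Fin.mk_lt_mk.mpr (Nat.lt_succ_self k)⟩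
  shift := PresentedGroup.autOfEquiv _ (bandPerm (finRotate n))
    (newRel_perm (finRotate n) _ (fun _ => rfl)
      (fun i j k l h => (finRotate_comm_iff i j k l).mpr h)
      (fun x y z h => (finRotate_tri_iff x y z).mpr (Or.inl h)))
    (newRel_perm (finRotate n).symm _ (fun _ => rfl)
      (fun i j k l h => (finRotate_comm_iff _ _ _ _).mp (by simpa only [Equiv.apply_symm_apply] using h))
      (fun x y z h => (finRotate_tri_iff _ _ _).mp (Or.inl (by simpa only [Equiv.apply_symm_apply] using h))))

/-! Order the braid group by `V ≤ W` when `V⁻¹ W` is positive. This order is left-invariant, has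
meets, and is also preserved by right multiplication by powers of `D`, because conjugation by `D`
permutes the generators. In terms of it `inf W` is the largest `v` with `D ^ v ≤ W`, and `sup W` is
the smallest `v` with `W ≤ D ^ v` (`zpow_le_iff`, `le_zpow_iff`).

Put `v = inf W + 1` and `θ P = W P D⁻ᵛ`. Then `D ^ v ≤ P⁻¹ W P` exactly when `P ≤ θ P`. Cycling is
conjugation by a meet (`cycling_eq`). As long as `inf` has not risen, the `m`-th cycling conjugates
`W` by `Λ_m D ^ m`, where `Λ_0 = 1` and `Λ_{m+1} = Λ_m ⊓ θ Λ_m`. Since `θ` preserves meets and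
commutes with right multiplication by `D`, a solution of `P ≤ θ P` anywhere in the group can be
moved below `1`, and `Λ_m` descends to the largest solution `L` below `1`.

The number of steps is bounded in `meetIter_le` by watching only `Λ_m ⊓ L D`. This truncation obeys
a recursion of its own, so it falls strictly until it reaches `L`. It starts strictly below `L D`,
which leaves room for at most `|D| - 1` falls. When it reaches `L` so does `Λ_m`, because a
nontrivial positive element has a nontrivial meet with `D`. Decycling is treated in the same way
with `φ P = W⁻¹ P D ^ (sup W - 1)`.

The Garside structure itself is proved for both presentations by one method. The positive monoid is
built from an interval in the symmetric group: the weak order below the reversal, or the absolute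
order below an `n`-cycle. Joins of two atoms give meets in the interval
(`exists_greatest_of_local_joins`). Meets give a head-tail decomposition and left cancellation. The
monoid then acts faithfully by permutations on fractions with powers of `D` as denominators. The
presented group acts through the same permutations, so the monoid embeds in it
(`toBraid_injective`), and local joins yield meets in the whole group (`IntervalModel.exists_meet`).
The combinatorial input is that lengths add exactly when inversion sets are included
(`count_add_eq_iff`), respectively, below the `n`-cycle, when cycles refine
(`prefix_of_invariants_le`). -/

/-! ### Ordered groups with a Garside element -/

/-- A left-invariant meet-semilattice order on a group, with a Garside element `D` and an additive
length which is positive on nontrivial positive elements. -/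
structure GarsideOrder (G : Type*) [Group G] [SemilatticeInf G] where
  /-- the Garside element -/
  D : G
  /-- the length -/
  len : G → ℤ
  len_mul : ∀ a b, len (a * b) = len a + len b
  len_pos : ∀ p, 1 < p → 0 < len p
  mul_le_left : ∀ g a b : G, a ≤ b → g * a ≤ g * b
  mul_D_le : ∀ a b, a ≤ b → a * D ≤ b * D
  mul_inv_D_le : ∀ a b, a ≤ b → a * D⁻¹ ≤ b * D⁻¹
  one_lt_D : 1 < D
  exists_pow_le : ∀ g : G, ∃ k : ℕ, D⁻¹ ^ k ≤ g
  eq_one_of_inf_D : ∀ p, 1 ≤ p → p ⊓ D = 1 → p = 1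

namespace GarsideOrder

variable {G : Type*} [Group G] [SemilatticeInf G] (O : GarsideOrder G)
include O

theorem mul_le_mul_iff_left' (g a b : G) : g * a ≤ g * b ↔ a ≤ b :=
  ⟨fun h => by simpa using O.mul_le_left g⁻¹ _ _ h, O.mul_le_left g a b⟩

theorem le_iff_one_le (a b : G) : a ≤ b ↔ 1 ≤ a⁻¹ * b := by
  rw [← O.mul_le_mul_iff_left' a⁻¹, inv_mul_cancel]

theorem le_mul (a p : G) (hp : 1 ≤ p) : a ≤ a * p := by
  simpa using O.mul_le_left a _ _ hp

theorem one_le_mul (a b : G) (ha : 1 ≤ a) (hb : 1 ≤ b) : 1 ≤ a * b :=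
  ha.trans (O.le_mul a b hb)

theorem one_le_prod (L : List G) (h : ∀ a ∈ L, 1 ≤ a) : 1 ≤ L.prod := by
  induction L with
  | nil => simp
  | cons a L ih =>
    rw [List.prod_cons]
    exact O.one_le_mul _ _ (h a (by simp)) (ih fun b hb => h b (by simp [hb]))

theorem mul_inf' (g a b : G) : g * (a ⊓ b) = g * a ⊓ g * b := by
  apply le_antisymm
  · exact le_inf (O.mul_le_left _ _ _ inf_le_left) (O.mul_le_left _ _ _ inf_le_right)
  · rw [← O.mul_le_mul_iff_left' g⁻¹]
    simp only [inv_mul_cancel_left]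
    refine le_inf ?_ ?_
    · simpa using O.mul_le_left g⁻¹ _ _ (inf_le_left : g * a ⊓ g * b ≤ g * a)
    · simpa using O.mul_le_left g⁻¹ _ _ (inf_le_right : g * a ⊓ g * b ≤ g * b)

theorem mul_D_pow_le (a b : G) (k : ℕ) (h : a ≤ b) : a * O.D ^ k ≤ b * O.D ^ k := by
  induction k with
  | zero => simpa
  | succ k ih => rw [pow_succ, ← mul_assoc, ← mul_assoc]; exact O.mul_D_le _ _ ih

theorem mul_inv_D_pow_le (a b : G) (k : ℕ) (h : a ≤ b) : a * O.D⁻¹ ^ k ≤ b * O.D⁻¹ ^ k := by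
  induction k with
  | zero => simpa
  | succ k ih => rw [pow_succ, ← mul_assoc, ← mul_assoc]; exact O.mul_inv_D_le _ _ ih

theorem mul_D_zpow_le (a b : G) (k : ℤ) (h : a ≤ b) : a * O.D ^ k ≤ b * O.D ^ k := by
  obtain ⟨m, rfl | rfl⟩ := k.eq_nat_or_neg
  · simpa using O.mul_D_pow_le a b m h
  · simpa using O.mul_inv_D_pow_le a b m h

theorem mul_D_zpow_le_iff (a b : G) (k : ℤ) : a * O.D ^ k ≤ b * O.D ^ k ↔ a ≤ b :=
  ⟨fun h => by simpa using O.mul_D_zpow_le _ _ (-k) h, O.mul_D_zpow_le a b k⟩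

theorem inf_mul_D_zpow (a b : G) (k : ℤ) : (a ⊓ b) * O.D ^ k = a * O.D ^ k ⊓ b * O.D ^ k := by
  apply le_antisymm
  · exact le_inf (O.mul_D_zpow_le _ _ _ inf_le_left) (O.mul_D_zpow_le _ _ _ inf_le_right)
  · rw [← O.mul_D_zpow_le_iff _ _ (-k), mul_assoc (a ⊓ b)]
    simp only [zpow_neg, mul_inv_cancel, mul_one]
    rw [← zpow_neg]
    refine le_inf ?_ ?_
    · simpa using O.mul_D_zpow_le _ _ (-k) (inf_le_left : a * O.D ^ k ⊓ b * O.D ^ k ≤ a * O.D ^ k)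
    · simpa using O.mul_D_zpow_le _ _ (-k) (inf_le_right : a * O.D ^ k ⊓ b * O.D ^ k ≤ b * O.D ^ k)

theorem inf_mul_D (a b : G) : (a ⊓ b) * O.D = a * O.D ⊓ b * O.D := by
  simpa using O.inf_mul_D_zpow a b 1

theorem len_one : O.len 1 = 0 := by
  have := O.len_mul 1 1
  simp at this
  exact this

theorem len_lt (a b : G) (h : a < b) : O.len a < O.len b := by
  have h1 : 1 < a⁻¹ * b := by
    refine lt_of_le_of_ne ((O.le_iff_one_le a b).1 h.le) fun h' => h.ne ?_
    rwa [eq_comm, inv_mul_eq_one] at h'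
  have := O.len_pos _ h1
  have h2 := O.len_mul a (a⁻¹ * b)
  rw [mul_inv_cancel_left] at h2
  omega

theorem len_le (a b : G) (h : a ≤ b) : O.len a ≤ O.len b := by
  rcases h.eq_or_lt with rfl | h
  · exact le_rfl
  · exact (O.len_lt a b h).le

/-- The iteration `P ↦ P ⊓ θ P` from `1`. -/
def meetIter (_ : GarsideOrder G) (θ : G → G) : ℕ → G
  | 0 => 1
  | m + 1 => meetIter ‹_› θ m ⊓ θ (meetIter ‹_› θ m)

/-- If `θ` commutes with meets and with right multiplication by `D`, and some `P` satisfies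
`P ≤ θ P`, then the iteration `P ↦ P ⊓ θ P` from `1` reaches such a `P` in `|D| - 1` steps. -/
theorem meetIter_le (θ : G → G) (hinf : ∀ a b, θ (a ⊓ b) = θ a ⊓ θ b)
    (hD : ∀ a, θ (a * O.D) = θ a * O.D) (P : G) (hP : P ≤ θ P) (N : ℕ) (hN : O.len O.D = N) :
    O.meetIter θ (N - 1) ≤ θ (O.meetIter θ (N - 1)) := by
  set Λ := O.meetIter θ with hΛ
  have hN0 : 0 < N := by have := O.len_pos _ O.one_lt_D; omega
  have hmono : ∀ a b, a ≤ b → θ a ≤ θ b := fun a b h => by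
    rw [← inf_eq_left, ← hinf, inf_eq_left.2 h]
  have hsucc : ∀ m, Λ (m + 1) = Λ m ⊓ θ (Λ m) := fun m => rfl
  have hanti : Antitone Λ := antitone_nat_of_succ_le fun m => inf_le_left
  -- Since `Λ` decreases and `θ` is monotone, the meet with `Λ m` can be replaced by the meet with
  -- `1`.
  have hstep : ∀ m, Λ (m + 1) = 1 ⊓ θ (Λ m) := by
    intro m
    induction m with
    | zero => rfl
    | succ m ih =>
      rw [hsucc (m + 1), ih, inf_assoc, ← ih, inf_eq_right.2 (hmono _ _ (hanti (Nat.le_add_right m 1)))]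
  have hbound : ∀ Q, Q ≤ 1 → Q ≤ θ Q → ∀ m, Q ≤ Λ m := by
    intro Q h1 h2 m
    induction m with
    | zero => exact h1
    | succ m ih => exact le_inf ih (h2.trans (hmono _ _ ih))
  have hDinv : ∀ a, θ (a * O.D⁻¹) = θ a * O.D⁻¹ := fun a => by
    rw [eq_mul_inv_iff_mul_eq, ← hD, inv_mul_cancel_right]
  -- `θ` commutes with right multiplication by `D⁻¹`, so a power of `D⁻¹` pushes the given solution
  -- below `1`. There it bounds the whole iteration from below.
  obtain ⟨Q, hQ1, hQ⟩ : ∃ Q : G, Q ≤ 1 ∧ Q ≤ θ Q := by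
    obtain ⟨k, hk⟩ := O.exists_pow_le P⁻¹
    refine ⟨P * O.D⁻¹ ^ k, by simpa using O.mul_le_left P _ _ hk, ?_⟩
    have : θ (P * O.D⁻¹ ^ k) = θ P * O.D⁻¹ ^ k := by
      clear hk
      induction k with
      | zero => simp
      | succ k ih => rw [pow_succ, ← mul_assoc, hDinv, ih, mul_assoc]
    rw [this]
    exact O.mul_inv_D_pow_le _ _ _ hP
  -- Otherwise the length would drop at every step and pass below that of `Q`.
  obtain ⟨M, hM⟩ : ∃ M, Λ (M + 1) = Λ M := by
    by_contra! hne
    have hlt : ∀ m : ℕ, O.len (Λ m) ≤ -m := by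
      intro m
      induction m with
      | zero => simp [hΛ, meetIter, O.len_one]
      | succ m ih =>
        have := O.len_lt _ _ (lt_of_le_of_ne (hanti (Nat.le_add_right m 1)) (hne m))
        push_cast
        omega
    have h1 := O.len_le _ _ (hbound Q hQ1 hQ (1 + (O.len Q).natAbs))
    have h2 := hlt (1 + (O.len Q).natAbs)
    push_cast at h2
    have h3 := neg_abs_le (O.len Q)
    omega
  set L := Λ M with hL
  have hLθ : L ≤ θ L := by
    rw [← inf_eq_left, ← hsucc, hM]
  have hL1 : L ≤ 1 := hanti (Nat.zero_le M)
  have hLle := hbound L hL1 hLθ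
  -- The truncation has its own recursion because `L D ≤ θ L D = θ (L D)`: once `L D` is present,
  -- the term `θ (L D)` can be added to the meet for free.
  let x : ℕ → G := fun m => Λ m ⊓ L * O.D
  have hx : ∀ m, x (m + 1) = 1 ⊓ L * O.D ⊓ θ (x m) := by
    intro m
    simp only [x]
    have h1 : L * O.D ⊓ θ L * O.D = L * O.D := inf_eq_left.2 (O.mul_D_le _ _ hLθ)
    rw [hstep, hinf, hD, inf_comm (θ (Λ m)) (θ L * O.D), ← inf_assoc, inf_assoc 1 (L * O.D), h1,
      inf_assoc, inf_assoc, inf_comm (L * O.D)]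
  have hxanti : Antitone x := fun a b h => inf_le_inf_right _ (hanti h)
  have hLD : L ≤ L * O.D := O.le_mul _ _ O.one_lt_D.le
  -- By the recursion one repetition freezes `x` at its eventual value `L`. Then the positive
  -- element `L⁻¹ Λ m` has trivial meet with `D`, so it is `1`.
  have hstab : ∀ m, x (m + 1) = x m → Λ m = L := by
    intro m hm
    have hconst : ∀ k, x (m + k) = x m := by
      intro k
      induction k with
      | zero => rfl
      | succ k ih => rw [← add_assoc, hx, ih, ← hx, hm]
    have h1 : x m = L := by
      rw [← hconst M]
      have h2 : Λ (m + M) = L := le_antisymm (hanti (Nat.le_add_left M m)) (hLle _)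
      simp only [x]
      rw [h2, inf_eq_left.2 hLD]
    have h3 : L⁻¹ * Λ m = 1 := by
      refine O.eq_one_of_inf_D _ ((O.le_iff_one_le _ _).1 (hLle m)) ?_
      have : L⁻¹ * x m = 1 := by rw [h1, inv_mul_cancel]
      simpa [x, O.mul_inf'] using this
    rw [inv_mul_eq_one] at h3
    exact h3.symm
  by_contra hcon
  have hne : ∀ m ≤ N - 1, x (m + 1) ≠ x m := by
    intro m hm h
    apply hcon
    have h1 : Λ (N - 1) = L := le_antisymm ((hanti hm).trans (hstab m h).le) (hLle _)
    rw [h1]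
    exact hLθ
  -- Equality would give `L D ≤ 1`. Then `L D` would be a solution below `1`, hence below the
  -- largest one `L`. This strict inequality is the `- 1` in `|D| - 1`.
  have hx0 : O.len (x 0) < O.len L + N := by
    rw [← hN, ← O.len_mul]
    refine O.len_lt _ _ (lt_of_le_of_ne inf_le_right fun h => ?_)
    have h1 : L * O.D ≤ 1 := by
      rw [← h]
      exact inf_le_left
    have h2 : L * O.D ≤ L := hbound _ h1 (by rw [hD]; exact O.mul_D_le _ _ hLθ) M
    have h3 : O.D ≤ 1 := by
      rw [← O.mul_le_mul_iff_left' L]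
      simpa using h2
    exact O.one_lt_D.not_ge h3
  -- `N` strict falls would carry `x N` below the length of `L`, although `L ≤ x N`.
  have hdec : ∀ m ≤ N, O.len (x m) < O.len L + N - m := by
    intro m hm
    induction m with
    | zero => simpa using hx0
    | succ m ih =>
      have h1 := ih (by omega)
      have h2 := O.len_lt _ _ (lt_of_le_of_ne (hxanti (Nat.le_add_right m 1)) (hne m (by omega)))
      push_cast
      omega
  have h1 := hdec N le_rfl
  have h2 := O.len_le L (x N) (le_inf (hLle N) hLD)
  omega

end GarsideOrder

/-! ### Normal forms -/

namespace BraidPresentation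

/-- A Garside order on the group of a presentation, whose positive elements are the braids
represented by positive words, whose Garside element is the fundamental braid, and for which
conjugation by the fundamental braid is the index shift. -/
structure GarsideData (X : BraidPresentation) [SemilatticeInf X.Braid] extends
    GarsideOrder X.Braid where
  D_eq : D = X.fund
  isPositive_iff : ∀ A, X.IsPositive A ↔ 1 ≤ A
  shift_eq : ∀ A, X.shift A = X.fund⁻¹ * A * X.fund
  len_fund : len X.fund = X.fundLength

namespace GarsideData

variable {X : BraidPresentation} [SemilatticeInf X.Braid] (O : X.GarsideData)
include O

theorem LE_iff (V W : X.Braid) : X.LE V W ↔ V ≤ W := by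
  rw [O.le_iff_one_le, ← O.isPositive_iff]
  constructor
  · rintro ⟨P, hP, rfl⟩
    simpa using hP
  · intro h
    exact ⟨_, h, by simp⟩

theorem mem_Q (A : X.Braid) : A ∈ X.Q ↔ 1 ≤ A ∧ A ≤ X.fund := by
  rw [Q, Set.mem_ofPred_eq, O.isPositive_iff, O.LE_iff]

theorem mem_QStar (A : X.Braid) :
    A ∈ X.QStar ↔ 1 ≤ A ∧ A ≤ X.fund ∧ A ≠ 1 ∧ A ≠ X.fund := by
  rw [QStar, Set.mem_sdiff, O.mem_Q]
  simp [and_assoc]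

theorem leftGreedy_iff (A P : X.Braid) :
    X.LeftGreedy A P ↔ (1 ≤ A ∧ A ≤ X.fund) ∧ 1 ≤ P ∧ A * P ⊓ X.fund = A := by
  rw [LeftGreedy, O.mem_Q, O.isPositive_iff]
  refine and_congr_right fun hA => and_congr_right fun hP => ?_
  constructor
  · intro h
    refine le_antisymm ?_ (le_inf (O.le_mul _ _ hP) hA.2)
    rw [← O.LE_iff]
    refine h _ ((O.mem_Q _).2 ⟨le_inf (O.one_le_mul _ _ hA.1 hP) (hA.1.trans hA.2),
      inf_le_right⟩) ((O.LE_iff _ _).2 inf_le_left)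
  · intro h A' hA' hle
    rw [O.mem_Q] at hA'
    rw [O.LE_iff] at hle ⊢
    rw [← h]
    exact le_inf hle hA'.2

theorem shift_zpow (k : ℤ) (A : X.Braid) :
    (X.shift ^ k) A = X.fund ^ (-k) * A * X.fund ^ k := by
  have h : X.shift = MulAut.conj X.fund⁻¹ := by
    ext A
    simp [O.shift_eq]
  rw [h, ← map_zpow, MulAut.conj_apply]
  simp

theorem one_le_prod_of_mem_QStar (L : List X.Braid) (hL : ∀ A ∈ L, A ∈ X.QStar) : 1 ≤ L.prod :=
  O.one_le_prod L fun a ha => ((O.mem_QStar a).1 (hL a ha)).1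

theorem fund_ne_one : X.fund ≠ 1 := by
  rw [← O.D_eq]
  exact O.one_lt_D.ne'

theorem one_le_fund : 1 ≤ X.fund := by
  rw [← O.D_eq]
  exact O.one_lt_D.le

/-- In a left-greedy list, the first factor is the meet of the product with the fundamental
braid. -/
theorem prod_inf_fund (A : X.Braid) (L : List X.Braid)
    (hQ : ∀ B ∈ A :: L, 1 ≤ B ∧ B ≤ X.fund) (h : (A :: L).IsChain X.LeftGreedy) :
    A * L.prod ⊓ X.fund = A := by
  induction L generalizing A with
  | nil => simpa using (hQ A (by simp)).2
  | cons B L ih =>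
    rw [List.isChain_cons_cons] at h
    obtain ⟨h1, h2⟩ := h
    have hA := hQ A (by simp)
    have hL : 1 ≤ L.prod := O.one_le_prod L fun C hC => (hQ C (by simp [hC])).1
    obtain ⟨-, hB, hAB⟩ := (leftGreedy_iff O _ _).1 h1
    have hB' := ih B (fun C hC => hQ C (List.mem_cons_of_mem _ hC)) h2
    -- Since `A⁻¹ D ≤ D`, the meet with `D` after `A` sees the remaining product only through its
    -- meet with `D`, which is `B` by induction.
    have hfund : A⁻¹ * X.fund ≤ X.fund := by
      have h3 := O.mul_D_le _ _ hA.1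
      rw [O.D_eq, one_mul] at h3
      simpa using O.mul_le_left A⁻¹ _ _ h3
    rw [List.prod_cons]
    refine le_antisymm ?_ (le_inf (O.le_mul _ _ (O.one_le_mul _ _ hB hL)) hA.2)
    calc A * (B * L.prod) ⊓ X.fund = A * (B * L.prod ⊓ A⁻¹ * X.fund) := by
          rw [O.mul_inf', mul_inv_cancel_left]
      _ = A * (B * L.prod ⊓ X.fund ⊓ A⁻¹ * X.fund) := by
          rw [inf_assoc, inf_eq_right.2 hfund]
      _ = A * B ⊓ X.fund := by rw [hB', O.mul_inf', mul_inv_cancel_left]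
      _ ≤ A := hAB.le

/-- The complement of a left-greedy list begins with the complement of its last factor. -/
theorem prod_inv_inf_fund (L : List X.Braid) (A : X.Braid)
    (hQ : ∀ B ∈ L ++ [A], 1 ≤ B ∧ B ≤ X.fund) (h : (L ++ [A]).IsChain X.LeftGreedy) :
    ((L ++ [A]).prod)⁻¹ * X.fund ^ (L.length + 1) ⊓ X.fund = A⁻¹ * X.fund := by
  induction L using List.reverseRecOn generalizing A with
  | nil =>
    have hA := hQ A (by simp)
    simp only [List.nil_append, List.prod_singleton, List.length_nil, zero_add, pow_one]
    refine inf_eq_left.2 ?_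
    have h3 := O.mul_D_le _ _ hA.1
    rw [O.D_eq, one_mul] at h3
    simpa using O.mul_le_left A⁻¹ _ _ h3
  | append_singleton L B ih =>
    have hA := hQ A (by simp)
    rw [List.append_assoc, List.singleton_append, List.isChain_split] at h
    obtain ⟨h1, h2⟩ := h
    rw [List.isChain_pair] at h2
    obtain ⟨hB, -, hBA⟩ := (leftGreedy_iff O _ _).1 h2
    have hZ := ih B (fun C hC => hQ C (by simp at hC ⊢; tauto)) h1
    set Z := ((L ++ [B]).prod)⁻¹ * X.fund ^ (L.length + 1) with hZdef
    -- Left-greediness of `B A` says that `A` has no common prefix with the complement `B⁻¹ D`. By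
    -- induction this complement is `Z ⊓ D`, and `A ≤ D`.
    have hAZ : A ⊓ Z = 1 := by
      have h3 : A ⊓ Z = A ⊓ B⁻¹ * X.fund := by
        rw [← hZ, inf_comm Z, ← inf_assoc, inf_eq_left.2 hA.2]
      rw [h3, ← mul_right_inj B, O.mul_inf', mul_inv_cancel_left, hBA, mul_one]
    have key : ((L ++ [B] ++ [A]).prod)⁻¹ * X.fund ^ ((L ++ [B]).length + 1)
        = A⁻¹ * Z * X.fund := by
      rw [List.prod_append, hZdef]
      simp only [List.prod_singleton, List.length_append, List.length_singleton, pow_succ,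
        mul_inv_rev, mul_assoc]
    rw [key]
    have h4 : X.fund = A⁻¹ * A * X.fund := by group
    have h5 : (A⁻¹ * Z ⊓ A⁻¹ * A) * X.fund = A⁻¹ * Z * X.fund ⊓ A⁻¹ * A * X.fund := by
      have := O.inf_mul_D (A⁻¹ * Z) (A⁻¹ * A)
      rwa [O.D_eq] at this
    calc A⁻¹ * Z * X.fund ⊓ X.fund = A⁻¹ * Z * X.fund ⊓ A⁻¹ * A * X.fund := by rw [← h4]
      _ = A⁻¹ * (Z ⊓ A) * X.fund := by rw [← h5, ← O.mul_inf']
      _ = A⁻¹ * X.fund := by rw [inf_comm, hAZ, mul_one]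

theorem prod_le_fund_pow (L : List X.Braid) (hQ : ∀ B ∈ L, 1 ≤ B ∧ B ≤ X.fund) :
    L.prod ≤ X.fund ^ L.length := by
  induction L with
  | nil => simp
  | cons A L ih =>
    rw [List.prod_cons, List.length_cons, pow_succ']
    refine (O.mul_le_left A _ _ (ih fun B hB => hQ B (by simp [hB]))).trans ?_
    have := O.mul_D_pow_le _ _ L.length (hQ A (by simp)).2
    rwa [O.D_eq] at this

/-- The factorization of a positive braid into a left-greedy list. -/
theorem exists_leftGreedy (P : X.Braid) (hP : 1 ≤ P) :
    ∃ L : List X.Braid, P = L.prod ∧ (∀ A ∈ L, 1 < A ∧ A ≤ X.fund) ∧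
      L.IsChain X.LeftGreedy := by
  induction hn : (O.len P).toNat using Nat.strong_induction_on generalizing P with
  | _ n ih =>
  by_cases h1 : P = 1
  · exact ⟨[], by simp [h1], by simp, List.isChain_nil⟩
  have hA : 1 < P ⊓ X.fund := by
    refine lt_of_le_of_ne (le_inf hP O.one_le_fund) fun h => h1 ?_
    refine O.eq_one_of_inf_D P hP ?_
    rw [O.D_eq, ← h]
  set A := P ⊓ X.fund with hAdef
  have hP' : 1 ≤ A⁻¹ * P := (O.le_iff_one_le _ _).1 inf_le_left
  have hlen : O.len P = O.len A + O.len (A⁻¹ * P) := by rw [← O.len_mul, mul_inv_cancel_left]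
  have h2 := O.len_pos A hA
  have h3 := O.len_le _ _ hP'
  rw [O.len_one] at h3
  obtain ⟨L, hL, hQ, hc⟩ := ih _ (by omega) (A⁻¹ * P) hP' rfl
  refine ⟨A :: L, by rw [List.prod_cons, ← hL, mul_inv_cancel_left], ?_, ?_⟩
  · intro B hB
    rw [List.mem_cons] at hB
    rcases hB with rfl | hB
    · exact ⟨hA, inf_le_right⟩
    · exact hQ B hB
  · cases L with
    | nil => exact List.isChain_singleton _
    | cons B L =>
      refine List.isChain_cons_cons.2 ⟨?_, hc⟩
      rw [leftGreedy_iff O]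
      have hB := (hQ B (by simp)).1.le
      refine ⟨⟨hA.le, inf_le_right⟩, hB, le_antisymm ?_ (le_inf (O.le_mul _ _ hB) inf_le_right)⟩
      refine le_inf (inf_le_left.trans ?_) inf_le_right
      have h4 : P = A * B * L.prod := by
        rw [mul_assoc, ← List.prod_cons, ← hL, mul_inv_cancel_left]
      rw [h4]
      exact O.le_mul _ _ (O.one_le_prod _ fun C hC => (hQ C (by simp [hC])).1.le)

theorem zpow_mono {a b : ℤ} (hab : a ≤ b) : X.fund ^ a ≤ X.fund ^ b := by
  obtain ⟨k, rfl⟩ := Int.le.dest hab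
  rw [zpow_add, zpow_natCast]
  refine O.le_mul _ _ ?_
  have := O.one_le_prod (List.replicate k X.fund) fun a ha => by
    rw [List.eq_of_mem_replicate ha]; exact O.one_le_fund
  simpa using this

theorem le_of_isNormalForm {W : X.Braid} {N : ℤ × List X.Braid} (h : X.IsNormalForm W N) :
    X.fund ^ N.1 ≤ W := by
  rw [h.1]
  exact O.le_mul _ _ (O.one_le_prod_of_mem_QStar _ h.2.1)

/-- If `D` were a prefix of the product of the factors, the first factor would be `D` by
`prod_inf_fund`, which `Q⋆` excludes; an empty product would give `D ≤ 1`. -/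
theorem zpow_le_iff {W : X.Braid} {N : ℤ × List X.Braid} (h : X.IsNormalForm W N) (v : ℤ) :
    X.fund ^ v ≤ W ↔ v ≤ N.1 := by
  constructor
  · intro hv
    by_contra! hlt
    have h1 : X.fund ^ (N.1 + 1) ≤ W := (O.zpow_mono (by omega)).trans hv
    obtain ⟨hW, hQ, hc⟩ := h
    rw [hW, zpow_add, zpow_one, O.mul_le_mul_iff_left'] at h1
    obtain ⟨u, L⟩ := N
    cases L with
    | nil => exact O.fund_ne_one (le_antisymm (by simpa using h1) O.one_le_fund)
    | cons A L =>
      have h2 := O.prod_inf_fund A L (fun B hB => by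
        have := (O.mem_QStar B).1 (hQ B hB); exact ⟨this.1, this.2.1⟩) hc
      rw [inf_eq_right.2 (by simpa using h1)] at h2
      exact ((O.mem_QStar A).1 (hQ A (by simp))).2.2.2 h2.symm
  · intro hv
    exact (O.zpow_mono hv).trans (O.le_of_isNormalForm h)

/-- If `k ≥ 1` factors had a product below `D ^ (k - 1)`, its complement in `D ^ k` would have `D`
as a prefix. By `prod_inv_inf_fund` the last factor would then be `1`, which `Q⋆` excludes. -/
theorem le_zpow_iff {W : X.Braid} {N : ℤ × List X.Braid} (h : X.IsNormalForm W N) (v : ℤ) :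
    W ≤ X.fund ^ v ↔ N.1 + N.2.length ≤ v := by
  obtain ⟨u, L⟩ := N
  obtain ⟨hW, hQ, hc⟩ := h
  have hQ' : ∀ B ∈ L, 1 ≤ B ∧ B ≤ X.fund := fun B hB => by
    have := (O.mem_QStar B).1 (hQ B hB); exact ⟨this.1, this.2.1⟩
  simp only at hW hc hQ ⊢
  constructor
  · intro hv
    by_contra! hlt
    have h1 : W ≤ X.fund ^ (u + L.length - 1) := hv.trans (O.zpow_mono (by omega))
    rcases List.eq_nil_or_concat' L with rfl | ⟨L', A, rfl⟩
    · have h2 : X.fund ^ u ≤ X.fund ^ (u + (-1)) := by simpa [hW, sub_eq_add_neg] using h1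
      rw [zpow_add, ← O.mul_le_mul_iff_left' (X.fund ^ (-u)), ← zpow_add,
        ← mul_assoc, ← zpow_add, neg_add_cancel, zpow_zero, one_mul] at h2
      have h3 := O.mul_le_left X.fund _ _ h2
      rw [zpow_neg_one, mul_inv_cancel, mul_one] at h3
      exact O.fund_ne_one (le_antisymm h3 O.one_le_fund)
    · have h2 := O.prod_inv_inf_fund L' A hQ' hc
      have h3 : X.fund ≤ ((L' ++ [A]).prod)⁻¹ * X.fund ^ (L'.length + 1) := by
        have h4 : (L' ++ [A]).prod ≤ X.fund ^ L'.length := by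
          rw [← O.mul_le_mul_iff_left' (X.fund ^ u), ← hW]
          convert h1 using 1
          rw [← zpow_natCast, ← zpow_add]
          congr 1
          simp only [List.length_append, List.length_singleton]
          push_cast
          ring
        rw [← O.mul_le_mul_iff_left' (L' ++ [A]).prod, mul_inv_cancel_left, pow_succ]
        have := O.mul_D_le _ _ h4
        rwa [O.D_eq] at this
      rw [inf_eq_right.2 h3, eq_comm, mul_eq_right, inv_eq_one] at h2
      exact ((O.mem_QStar A).1 (hQ A (by simp))).2.2.1 h2
  · intro hv
    refine le_trans ?_ (O.zpow_mono hv)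
    rw [hW, zpow_add, zpow_natCast]
    exact O.mul_le_left _ _ _ (O.prod_le_fund_pow L hQ')

theorem exists_isNormalForm (W : X.Braid) : ∃ N, X.IsNormalForm W N := by
  have hex : ∃ k : ℤ, X.fund ^ k ≤ W := by
    obtain ⟨k, hk⟩ := O.exists_pow_le W
    rw [O.D_eq] at hk
    exact ⟨-k, by simpa using hk⟩
  have hlen : ∀ k : ℤ, O.len (X.fund ^ k) = k * O.len X.fund := by
    have hnat : ∀ k : ℕ, O.len (X.fund ^ k) = k * O.len X.fund := by
      intro k
      induction k with
      | zero => simp [O.len_one]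
      | succ k ih => rw [pow_succ, O.len_mul, ih]; push_cast; ring
    intro k
    obtain ⟨m, rfl | rfl⟩ := k.eq_nat_or_neg
    · exact_mod_cast hnat m
    · have := O.len_mul (X.fund ^ m) (X.fund ^ (-(m : ℤ)))
      rw [zpow_neg, zpow_natCast, mul_inv_cancel, O.len_one, hnat] at this
      rw [zpow_neg, zpow_natCast]
      linarith
  have hpos : 0 < O.len X.fund := by rw [← O.D_eq]; exact O.len_pos _ O.one_lt_D
  -- Additivity of the length bounds the exponents of the powers of `D` below `W`.
  obtain ⟨u, hu, hmax⟩ := Int.exists_greatest_of_bdd (P := fun k => X.fund ^ k ≤ W)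
    ⟨|O.len W|, fun k hk => by
      have := O.len_le _ _ hk
      rw [hlen] at this
      by_contra! hlt
      have h1 := le_abs_self (O.len W)
      have h2 := abs_nonneg (O.len W)
      nlinarith⟩ hex
  obtain ⟨L, hL, hQ, hc⟩ := O.exists_leftGreedy ((X.fund ^ u)⁻¹ * W)
    ((O.le_iff_one_le _ _).1 hu)
  refine ⟨(u, L), by rw [← hL, mul_inv_cancel_left], fun A hA => ?_, hc⟩
  rw [O.mem_QStar]
  refine ⟨(hQ A hA).1.le, (hQ A hA).2, (hQ A hA).1.ne', ?_⟩
  -- A factor `D` anywhere in the list would make `D` a prefix of the product, since `D ≤ B D` for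
  -- positive `B`. That contradicts the maximality of `u`.
  have hD : ¬ X.fund ≤ L.prod := by
    intro h
    have : X.fund ^ (u + 1) ≤ W := by
      rw [← O.mul_le_mul_iff_left' (X.fund ^ u), ← hL, mul_inv_cancel_left] at h
      rwa [zpow_add, zpow_one]
    have := hmax _ this
    omega
  clear hL
  induction L generalizing A with
  | nil => simp at hA
  | cons B L ih =>
    have hL1 : 1 ≤ L.prod := O.one_le_prod L fun C hC => (hQ C (by simp [hC])).1.le
    rw [List.mem_cons] at hA
    rcases hA with rfl | hA
    · rintro rfl
      apply hD
      rw [List.prod_cons]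
      exact O.le_mul _ _ hL1
    · refine ih (fun C hC => hQ C (by simp [hC])) hc.tail A hA fun h => hD ?_
      rw [List.prod_cons]
      have h1 : B * X.fund ≤ B * L.prod := O.mul_le_left _ _ _ h
      refine le_trans ?_ h1
      have := O.mul_D_le _ _ (hQ B (by simp)).1.le
      rwa [one_mul, O.D_eq] at this

theorem existsUnique_isNormalForm (W : X.Braid) : ∃! N, X.IsNormalForm W N := by
  obtain ⟨N, hN⟩ := O.exists_isNormalForm W
  refine ⟨N, hN, fun N' hN' => ?_⟩
  have hu : N'.1 = N.1 := le_antisymm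
    ((O.zpow_le_iff hN _).1 (O.le_of_isNormalForm hN'))
    ((O.zpow_le_iff hN' _).1 (O.le_of_isNormalForm hN))
  have hp : N'.2.prod = N.2.prod := by
    have := hN'.1.symm.trans hN.1
    rwa [hu, mul_right_inj] at this
  refine Prod.ext hu ?_
  obtain ⟨-, h1, h2⟩ := hN
  obtain ⟨-, h3, h4⟩ := hN'
  have h1' : ∀ A ∈ N.2, 1 ≤ A ∧ A ≤ X.fund ∧ A ≠ 1 := fun A hA => by
    have := (O.mem_QStar A).1 (h1 A hA); tauto
  have h3' : ∀ A ∈ N'.2, 1 ≤ A ∧ A ≤ X.fund ∧ A ≠ 1 := fun A hA => by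
    have := (O.mem_QStar A).1 (h3 A hA); tauto
  clear h1 h3
  generalize N.2 = L at *
  generalize N'.2 = L' at *
  have hnil : ∀ (A : X.Braid) (L : List X.Braid),
      (∀ B ∈ A :: L, 1 ≤ B ∧ B ≤ X.fund ∧ B ≠ 1) → (A :: L).prod ≠ 1 := by
    intro A L hQ h
    have hL1 : 1 ≤ L.prod := O.one_le_prod L fun C hC => (hQ C (by simp [hC])).1
    have hA := hQ A (by simp)
    refine hA.2.2 (le_antisymm ?_ hA.1)
    rw [← h, List.prod_cons]
    exact O.le_mul _ _ hL1
  induction L generalizing L' with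
  | nil =>
    cases L' with
    | nil => rfl
    | cons A L' => exact absurd hp (hnil A L' h3')
  | cons A L ih =>
    cases L' with
    | nil => exact absurd hp.symm (hnil A L h1')
    | cons A' L' =>
      have e1 := O.prod_inf_fund A L (fun B hB => ⟨(h1' B hB).1, (h1' B hB).2.1⟩) h2
      have e2 := O.prod_inf_fund A' L' (fun B hB => ⟨(h3' B hB).1, (h3' B hB).2.1⟩) h4
      rw [List.prod_cons, List.prod_cons] at hp
      rw [hp] at e2
      have hA : A' = A := e2.symm.trans e1
      subst hA
      rw [mul_right_inj] at hp
      rw [ih h2.tail (fun B hB => h1' B (List.mem_cons_of_mem _ hB)) L' h4.tail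
        (fun B hB => h3' B (List.mem_cons_of_mem _ hB)) hp]

theorem isNormalForm_normalForm (W : X.Braid) : X.IsNormalForm W (X.normalForm W) :=
  Classical.epsilon_spec (O.exists_isNormalForm W)

theorem zpow_le_iff_le_inf (W : X.Braid) (v : ℤ) : X.fund ^ v ≤ W ↔ v ≤ X.inf W :=
  O.zpow_le_iff (O.isNormalForm_normalForm W) v

theorem le_zpow_iff_sup_le (W : X.Braid) (v : ℤ) : W ≤ X.fund ^ v ↔ X.sup W ≤ v :=
  O.le_zpow_iff (O.isNormalForm_normalForm W) v

end GarsideData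


theorem decycling_of_append {X : BraidPresentation} {W : X.Braid} {u : ℤ} {L : List X.Braid}
    {A : X.Braid} (h : X.normalForm W = (u, L ++ [A])) :
    X.decycling W = X.fund ^ u * (X.shift ^ u) A * L.prod := by
  rw [decycling]
  generalize X.normalForm W = N at h
  obtain ⟨u', L'⟩ := N
  cases L' with
  | nil => simp at h
  | cons B L' =>
    obtain ⟨rfl, h'⟩ := Prod.mk.inj h
    have h1 : (B :: L').getLast (List.cons_ne_nil B L') = A := by simp [h']
    have h2 : (B :: L').dropLast = L := by simp [h']
    simp only [h1, h2]

/-! ### Cycling and decycling as conjugations by meets -/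

namespace GarsideData

variable {X : BraidPresentation} [SemilatticeInf X.Braid] (O : X.GarsideData)
include O

theorem fund_zpow_inf (a b : X.Braid) (k : ℤ) :
    (a ⊓ b) * X.fund ^ k = a * X.fund ^ k ⊓ b * X.fund ^ k := by
  rw [← O.D_eq]
  exact O.inf_mul_D_zpow a b k

theorem mul_fund_zpow_le_iff (a b : X.Braid) (k : ℤ) :
    a * X.fund ^ k ≤ b * X.fund ^ k ↔ a ≤ b := by
  rw [← O.D_eq]
  exact O.mul_D_zpow_le_iff a b k

theorem mem_normalForm (W : X.Braid) :
    ∀ B ∈ (X.normalForm W).2, 1 ≤ B ∧ B ≤ X.fund := fun B hB => by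
  have := (O.mem_QStar B).1 ((O.isNormalForm_normalForm W).2.1 B hB)
  exact ⟨this.1, this.2.1⟩

/-- Cycling is conjugation by the meet of `W D⁻ᵘ` with `D`, where `u = inf W`. -/
theorem cycling_eq (W : X.Braid) {P : X.Braid}
    (hP : P = (W * X.fund ^ (-(X.inf W + 1)) ⊓ 1) * X.fund) :
    X.cycling W = P⁻¹ * W * P := by
  obtain ⟨hW, hQ, hc⟩ := O.isNormalForm_normalForm W
  have hQ' := O.mem_normalForm W
  have hP' : P = W * X.fund ^ (-X.inf W) ⊓ X.fund := by
    have := O.fund_zpow_inf (W * X.fund ^ (-(X.inf W + 1))) 1 1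
    rw [zpow_one, one_mul] at this
    rw [hP, this, mul_assoc, ← zpow_add_one]
    congr 3
    ring
  rw [cycling]
  rw [inf] at hP'
  generalize X.normalForm W = N at *
  obtain ⟨u, L⟩ := N
  cases L with
  | nil =>
    have h1 : P = X.fund ^ (0 : ℤ) ⊓ X.fund ^ (1 : ℤ) := by rw [hP', hW]; simp
    rw [inf_eq_left.2 (O.zpow_mono (by norm_num)), zpow_zero] at h1
    simp [h1]
  | cons A L =>
    have h1 := O.prod_inf_fund A L hQ' hc
    -- This element is `τ⁻ᵘ(A)`; it stands at the left of `W`, and conjugating by it moves it to the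
    -- right end.
    have h2 : P = X.fund ^ u * A * X.fund ^ (-u) := by
      conv_rhs => rw [← h1]
      rw [hP', hW, O.mul_inf', O.fund_zpow_inf]
      simp only [List.prod_cons]
      congr 1
      group
    simp only at hW ⊢
    rw [O.shift_zpow, h2]
    conv_rhs => rw [hW, List.prod_cons]
    group

/-- Decycling is conjugation by the meet of `W` with `D ^ (s - 1)`, where `s = sup W`. -/
theorem decycling_eq (W : X.Braid) {P : X.Braid} (hP : P = W ⊓ X.fund ^ (X.sup W - 1)) :
    X.decycling W = P⁻¹ * W * P := by
  obtain ⟨hW, hQ, hc⟩ := O.isNormalForm_normalForm W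
  have hQ' := O.mem_normalForm W
  rw [sup] at hP
  generalize hN : X.normalForm W = N at *
  obtain ⟨u, L⟩ := N
  rcases List.eq_nil_or_concat' L with rfl | ⟨L, A, rfl⟩
  -- Without canonical factors the meet is a power of `D`, which commutes with `W = D ^ u`.
  · have h1 : P = X.fund ^ (u - 1) := by
      rw [hP, hW]
      simp only [List.prod_nil, mul_one, List.length_nil, Nat.cast_zero, add_zero]
      exact inf_eq_right.2 (O.zpow_mono (by omega))
    have h2 : W = X.fund ^ u := by simpa using hW
    rw [decycling, hN]
    simp only
    rw [h1, h2]
    group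
  · have h1 := O.prod_inv_inf_fund L A hQ' hc
    -- Multiply `h1` by `W` on the left and by `D⁻¹` on the right. Conjugation by `W A⁻¹` is
    -- conjugation by `A⁻¹`, as `W` commutes with itself.
    have h2 : P = W * A⁻¹ := by
      have h3 : W * ((L ++ [A]).prod⁻¹ * X.fund ^ (L.length + 1) ⊓ X.fund) * X.fund ^ (-1 : ℤ)
          = P := by
        rw [O.mul_inf', O.fund_zpow_inf, hP]
        simp only at hW
        rw [inf_comm]
        refine congrArg₂ _ (by group) ?_
        · rw [hW]
          simp only [List.length_append, List.length_singleton, ← zpow_natCast, mul_assoc,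
            mul_inv_cancel_left, ← zpow_add]
          congr 1
      rw [← h3, h1]
      group
    rw [decycling_of_append hN, O.shift_zpow, h2]
    conv_rhs => rw [hW, List.prod_append, List.prod_singleton]
    group

theorem inf_le_inf_cycling (W : X.Braid) : X.inf W ≤ X.inf (X.cycling W) := by
  rw [← O.zpow_le_iff_le_inf]
  have hQ' := O.mem_normalForm W
  have hle := (O.zpow_le_iff_le_inf W _).2 le_rfl
  rw [cycling]
  rw [inf] at hle ⊢
  generalize X.normalForm W = N at *
  obtain ⟨u, L⟩ := N
  cases L with
  | nil => exact hle
  | cons A L =>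
    simp only
    rw [mul_assoc]
    refine O.le_mul _ _ (O.one_le_mul _ _ (O.one_le_prod L fun B hB =>
      (hQ' B (List.mem_cons_of_mem _ hB)).1) ?_)
    rw [O.shift_zpow, neg_neg]
    have h1 := O.mul_le_left (X.fund ^ u) _ _ (hQ' A (by simp)).1
    have h2 := (O.mul_fund_zpow_le_iff _ _ (-u)).2 h1
    rwa [mul_one, ← zpow_add, add_neg_cancel, zpow_zero] at h2

/-- With `s = sup W`, the inequality is `W P ≤ P D ^ s = W D ^ s ⊓ D ^ (2 s - 1)`. Both bounds
follow from `P ≤ D ^ (s - 1)` and `W ≤ D ^ s`. -/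
theorem sup_decycling_le_sup (W : X.Braid) : X.sup (X.decycling W) ≤ X.sup W := by
  rw [← O.le_zpow_iff_sup_le, O.decycling_eq W rfl]
  set P := W ⊓ X.fund ^ (X.sup W - 1)
  have hW : W ≤ X.fund ^ X.sup W := (O.le_zpow_iff_sup_le W _).2 le_rfl
  rw [← O.mul_le_mul_iff_left' P, ← mul_assoc, ← mul_assoc, mul_inv_cancel, one_mul]
  have h1 : P * X.fund ^ X.sup W
      = W * X.fund ^ X.sup W ⊓ X.fund ^ (X.sup W - 1) * X.fund ^ X.sup W := O.fund_zpow_inf _ _ _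
  rw [h1]
  refine le_inf (O.mul_le_left _ _ _ (inf_le_right.trans (O.zpow_mono (by omega)))) ?_
  refine (O.mul_le_left W _ _ inf_le_right).trans ?_
  rw [← zpow_add, add_comm, zpow_add]
  exact (O.mul_fund_zpow_le_iff _ _ _).2 hW

/-- If `inf` is not maximal in the conjugacy class, it is raised by `|D| - 1` cyclings. -/
theorem inf_lt_inf_iterate_cycling (W : X.Braid) (h : ∃ V, IsConj W V ∧ X.inf W < X.inf V) :
    X.inf W < X.inf (X.cycling^[X.fundLength - 1] W) := by
  obtain ⟨V, hV, hlt⟩ := h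
  obtain ⟨g, rfl⟩ := isConj_iff.1 hV
  set v := X.inf W + 1 with hv
  -- `P ≤ θ P` is the condition `D ^ v ≤ P⁻¹ W P`, that is, conjugation by `P` raises `inf`.
  let θ : X.Braid → X.Braid := fun P => W * P * X.fund ^ (-v)
  have hθD : ∀ (P : X.Braid) (k : ℤ), θ (P * X.fund ^ k) = θ P * X.fund ^ k := fun P k => by
    simp only [θ, mul_assoc, ← zpow_add, add_comm]
  -- Once `inf` has risen it stays so. Until then a conjugator `R` is replaced by `(R ⊓ θ R) D`,
  -- which is one step of the iteration and one more power of `D`.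
  have hiter : ∀ m, X.inf W < X.inf (X.cycling^[m] W) ∨
      X.cycling^[m] W = (O.meetIter θ m * X.fund ^ (m : ℤ))⁻¹ * W *
        (O.meetIter θ m * X.fund ^ (m : ℤ)) := by
    intro m
    induction m with
    | zero => right; simp [GarsideOrder.meetIter]
    | succ m ih =>
      rw [Function.iterate_succ_apply']
      rcases ih with ih | ih
      · exact Or.inl (ih.trans_le (O.inf_le_inf_cycling _))
      · by_cases hlt' : X.inf W < X.inf (X.cycling^[m] W)
        · exact Or.inl (hlt'.trans_le (O.inf_le_inf_cycling _))
        · right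
          have hge : X.inf W ≤ X.inf (X.cycling^[m] W) := by
            clear ih hlt'
            induction m with
            | zero => exact le_rfl
            | succ m ih =>
              rw [Function.iterate_succ_apply']
              exact ih.trans (O.inf_le_inf_cycling _)
          have heq : X.inf (X.cycling^[m] W) = X.inf W := by omega
          rw [O.cycling_eq _ rfl, heq, ← hv, ih]
          set R := O.meetIter θ m * X.fund ^ (m : ℤ) with hR
          have h1 : O.meetIter θ (m + 1) * X.fund ^ ((m + 1 : ℕ) : ℤ)
              = R * ((R⁻¹ * W * R * X.fund ^ (-v) ⊓ 1) * X.fund) := by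
            have h2 : R * (R⁻¹ * W * R * X.fund ^ (-v) ⊓ 1) = θ R ⊓ R := by
              rw [O.mul_inf', mul_one]
              simp [θ, mul_assoc]
            rw [← mul_assoc, h2, hR, hθD, ← O.fund_zpow_inf, inf_comm]
            rw [mul_assoc, ← zpow_add_one]
            rfl
          rw [h1]
          group
  rcases hiter (X.fundLength - 1) with h1 | h1
  · exact h1
  · set R := O.meetIter θ (X.fundLength - 1)
    have hR : R ≤ θ R := by
      -- Since `V = g W g⁻¹` and `D ^ v ≤ V`, the element `g⁻¹` solves `P ≤ θ P`.
      refine O.meetIter_le θ (fun a b => ?_) (fun a => ?_) g⁻¹ ?_ _ (by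
        rw [O.D_eq]; exact O.len_fund)
      · simp only [θ]
        rw [O.mul_inf', O.fund_zpow_inf]
      · have := hθD a 1
        rw [zpow_one] at this
        rw [O.D_eq, this]
      · simp only [θ]
        have h2 : X.fund ^ v ≤ g * W * g⁻¹ := by
          rw [O.zpow_le_iff_le_inf]
          exact hlt
        have h3 := O.mul_le_left g⁻¹ _ _ h2
        have h4 := (O.mul_fund_zpow_le_iff _ _ (-v)).2 h3
        rw [mul_assoc, ← zpow_add, add_neg_cancel, zpow_zero, mul_one] at h4
        simpa [mul_assoc] using h4
    rw [h1]
    suffices h2 : X.fund ^ v ≤ (R * X.fund ^ ((X.fundLength - 1 : ℕ) : ℤ))⁻¹ * W *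
        (R * X.fund ^ ((X.fundLength - 1 : ℕ) : ℤ)) by
      have := (O.zpow_le_iff_le_inf _ _).1 h2
      omega
    set S := R * X.fund ^ ((X.fundLength - 1 : ℕ) : ℤ) with hS
    have h5 : S ≤ θ S := by
      rw [hS, hθD, O.mul_fund_zpow_le_iff]
      exact hR
    rw [← O.mul_le_mul_iff_left' S, ← O.mul_fund_zpow_le_iff _ _ (-v)]
    simpa [θ, mul_assoc] using h5

/-- If `sup` is not minimal in the conjugacy class, it is lowered by `|D| - 1` decyclings. -/
theorem sup_iterate_decycling_lt_sup (W : X.Braid) (h : ∃ V, IsConj W V ∧ X.sup V < X.sup W) :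
    X.sup (X.decycling^[X.fundLength - 1] W) < X.sup W := by
  obtain ⟨V, hV, hlt⟩ := h
  obtain ⟨g, rfl⟩ := isConj_iff.1 hV
  set v := X.sup W - 1 with hv
  -- `P ≤ φ P` is the condition `P⁻¹ W P ≤ D ^ v`, that is, conjugation by `P` lowers `sup`.
  let φ : X.Braid → X.Braid := fun P => W⁻¹ * P * X.fund ^ v
  have hiter : ∀ m, X.sup (X.decycling^[m] W) < X.sup W ∨
      X.decycling^[m] W = (O.meetIter φ m)⁻¹ * W * O.meetIter φ m := by
    intro m
    induction m with
    | zero => right; simp [GarsideOrder.meetIter]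
    | succ m ih =>
      rw [Function.iterate_succ_apply']
      rcases ih with ih | ih
      · exact Or.inl ((O.sup_decycling_le_sup _).trans_lt ih)
      · by_cases hlt' : X.sup (X.decycling^[m] W) < X.sup W
        · exact Or.inl ((O.sup_decycling_le_sup _).trans_lt hlt')
        · right
          have hge : X.sup (X.decycling^[m] W) ≤ X.sup W := by
            clear ih hlt'
            induction m with
            | zero => exact le_rfl
            | succ m ih =>
              rw [Function.iterate_succ_apply']
              exact (O.sup_decycling_le_sup _).trans ih
          have heq : X.sup (X.decycling^[m] W) = X.sup W := by omega
          rw [O.decycling_eq _ rfl, heq, ← hv, ih]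
          set R := O.meetIter φ m with hR
          -- The accumulated conjugator becomes `W` times the next iterate; the factor `W` commutes
          -- with `W` and drops out.
          have h1 : R⁻¹ * W * R ⊓ X.fund ^ v = R⁻¹ * W * O.meetIter φ (m + 1) := by
            have h2 : O.meetIter φ (m + 1) = R ⊓ φ R := rfl
            rw [h2, O.mul_inf']
            simp [φ, mul_assoc]
          rw [h1]
          group
  rcases hiter (X.fundLength - 1) with h1 | h1
  · exact h1
  · set R := O.meetIter φ (X.fundLength - 1)
    have hR : R ≤ φ R := by
      refine O.meetIter_le φ (fun a b => ?_) (fun a => ?_) g⁻¹ ?_ _ (by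
        rw [O.D_eq]; exact O.len_fund)
      · simp only [φ]
        rw [O.mul_inf', O.fund_zpow_inf]
      · simp only [φ]
        rw [O.D_eq, mul_assoc, mul_assoc, ← zpow_one_add, mul_assoc, mul_assoc, ← zpow_add_one,
          add_comm]
      · simp only [φ]
        have h2 : g * W * g⁻¹ ≤ X.fund ^ v := by
          rw [O.le_zpow_iff_sup_le]
          omega
        have h3 := O.mul_le_left (W⁻¹ * g⁻¹) _ _ h2
        simpa [mul_assoc] using h3
    rw [h1]
    suffices h2 : R⁻¹ * W * R ≤ X.fund ^ v by
      have := (O.le_zpow_iff_sup_le _ _).1 h2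
      omega
    have h3 := O.mul_le_left (R⁻¹ * W) _ _ hR
    simpa [φ, mul_assoc] using h3

end GarsideData

end BraidPresentation

/-! ### Greatest elements from local joins -/

/-- In a bounded down-closed set of a graded order in which any two elementary steps from a common
element have an upper bound in the set, the elements above a given one have a greatest element. -/
theorem exists_greatest_of_local_joins {α : Type*} [PartialOrder α] (r : α → ℤ)
    (hr : ∀ x y, x < y → r x < r y) (I : α → Prop) (B : ℤ) (hB : ∀ x, I x → r x ≤ B)
    (hdown : ∀ x y, x ≤ y → I y → I x) (step : α → α → Prop) (hstep : ∀ x y, step x y → x < y)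
    (hex : ∀ x y, x < y → ∃ z, step x z ∧ z ≤ y)
    (hjoin : ∀ x y z, step x y → step x z → I y → I z → ∃ t, I t ∧ y ≤ t ∧ z ≤ t)
    (x : α) (hx : I x) : ∃ m, I m ∧ x ≤ m ∧ ∀ y, I y → x ≤ y → y ≤ m := by
  induction hn : (B - r x).toNat using Nat.strong_induction_on generalizing x with
  | _ n ih =>
  have ih' : ∀ z, x < z → I z → ∃ m, I m ∧ z ≤ m ∧ ∀ y, I y → z ≤ y → y ≤ m := fun z hz hIz =>
    ih _ (by have := hr _ _ hz; have := hB _ hIz; omega) z hIz rfl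
  by_cases h : ∃ z, step x z ∧ I z
  · obtain ⟨z, hz, hIz⟩ := h
    obtain ⟨m, hm, hzm, hmax⟩ := ih' z (hstep _ _ hz) hIz
    refine ⟨m, hm, (hstep _ _ hz).le.trans hzm, fun y hy hxy => ?_⟩
    rcases hxy.eq_or_lt with rfl | hxy
    · exact (hstep _ _ hz).le.trans hzm
    -- As in Newman's lemma: `m` and `m'` are the greatest elements above the steps `z` and `z'`. A
    -- common bound `t` of the two steps lies below `m'`, so `m'` is above `z` and hence `m' ≤ m`.
    · obtain ⟨z', hz', hzy⟩ := hex _ _ hxy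
      have hIz' := hdown _ _ hzy hy
      obtain ⟨m', hm', hzm', hmax'⟩ := ih' z' (hstep _ _ hz') hIz'
      obtain ⟨t, ht, hzt, hzt'⟩ := hjoin x z z' hz hz' hIz hIz'
      obtain ⟨m'', hm'', htm, -⟩ := ih' t ((hstep _ _ hz).trans_le hzt) ht
      have h1 : y ≤ m' := hmax' y hy hzy
      have h2 : t ≤ m' := hmax' t ht hzt'
      exact h1.trans (hmax m' hm' (hzt.trans h2))
  · refine ⟨x, hx, le_rfl, fun y hy hxy => ?_⟩
    rcases hxy.eq_or_lt with rfl | hxy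
    · exact le_rfl
    · obtain ⟨z, hz, hzy⟩ := hex _ _ hxy
      exact absurd ⟨z, hz, hdown _ _ hzy hy⟩ h

/-! ### Intervals in groups with a length -/

/-- A group with a subadditive length and an element `top`, such that, for the prefix order
attached to the length, the interval below `top` is atomic and has local joins. -/
structure IntervalGerm (H : Type*) [Group H] where
  /-- the length -/
  len : H → ℕ
  /-- the greatest element of the interval -/
  top : H
  len_one : len 1 = 0
  eq_one_of_len : ∀ a, len a = 0 → a = 1
  len_mul_le : ∀ a b, len (a * b) ≤ len a + len b
  len_conj : ∀ a, len (top⁻¹ * a * top) = len a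
  exists_atom : ∀ w, len w + len (w⁻¹ * top) = len top → w ≠ 1 →
    ∃ a, len a = 1 ∧ len a + len (a⁻¹ * w) = len w
  -- The join is chosen before the bound `w`, so that a single join lies below several given bounds
  -- at once.
  exists_join : ∀ a b, len a = 1 → len b = 1 → ∃ j,
    ∀ w, len w + len (w⁻¹ * top) = len top → len a + len (a⁻¹ * w) = len w →
      len b + len (b⁻¹ * w) = len w → len a + len (a⁻¹ * j) = len j ∧
        len b + len (b⁻¹ * j) = len j ∧ len j + len (j⁻¹ * w) = len w

namespace IntervalGerm

variable {H : Type*} [Group H] (E : IntervalGerm H)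

/-- The prefix order. -/
def Le (u w : H) : Prop := E.len u + E.len (u⁻¹ * w) = E.len w

variable {E}

theorem Le.refl (u : H) : E.Le u u := by simp [Le, E.len_one]

theorem one_le (u : H) : E.Le 1 u := by simp [Le, E.len_one]

theorem len_le_add (u w : H) : E.len w ≤ E.len u + E.len (u⁻¹ * w) := by
  simpa using E.len_mul_le u (u⁻¹ * w)

theorem Le.trans {u v w : H} (h1 : E.Le u v) (h2 : E.Le v w) : E.Le u w := by
  unfold Le at *
  have h3 := len_le_add (E := E) u w
  have h4 := E.len_mul_le (u⁻¹ * v) (v⁻¹ * w)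
  rw [mul_assoc, mul_inv_cancel_left] at h4
  omega

theorem Le.antisymm {u v : H} (h1 : E.Le u v) (h2 : E.Le v u) : u = v := by
  unfold Le at *
  have h3 := E.eq_one_of_len (u⁻¹ * v) (by omega)
  rwa [inv_mul_eq_one] at h3

theorem Le.len_le {u v : H} (h : E.Le u v) : E.len u ≤ E.len v := by
  unfold Le at h; omega

theorem Le.inv_mul {u v w : H} (h1 : E.Le u v) (h2 : E.Le v w) : E.Le (u⁻¹ * v) (u⁻¹ * w) := by
  have h3 := h1.trans h2
  unfold Le at *
  simp only [mul_inv_rev, inv_inv, mul_assoc, mul_inv_cancel_left]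
  omega

/-- The lengths of `u`, `x` and the rest of `w` already add up to that of `w`, so subadditivity has
no slack. -/
theorem le_mul {u x w : H} (h1 : E.Le u w) (h2 : E.Le x (u⁻¹ * w)) : E.Le u (u * x) := by
  unfold Le at *
  have h3 := E.len_mul_le u x
  have h4 := len_le_add (E := E) (u * x) w
  simp only [mul_inv_rev, mul_assoc, inv_mul_cancel_left] at *
  omega

theorem mul_le {u x w : H} (h1 : E.Le u w) (h2 : E.Le x (u⁻¹ * w)) : E.Le (u * x) w := by
  have h5 := le_mul h1 h2
  unfold Le at *
  simp only [mul_inv_rev, mul_assoc, inv_mul_cancel_left] at *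
  omega

/-- The complement of `u⁻¹ top` is `top⁻¹ u top`, which has the length of `u`. Prefixes and suffixes
of `top` therefore coincide. -/
theorem Le.compl {u : H} (h : E.Le u E.top) : E.Le (u⁻¹ * E.top) E.top := by
  unfold Le at *
  have := E.len_conj u
  simp only [mul_inv_rev, inv_inv] at *
  omega

theorem Le.suffix {u w : H} (h1 : E.Le u w) (h2 : E.Le w E.top) : E.Le (u⁻¹ * w) E.top :=
  (h1.inv_mul h2).trans (h1.trans h2).compl

variable (E) in
/-- The elements of the interval below `top`. -/
abbrev Simple : Type _ := {w : H // E.Le w E.top}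

instance : PartialOrder E.Simple where
  le u v := E.Le u.1 v.1
  le_refl u := Le.refl u.1
  le_trans _ _ _ h1 h2 := h1.trans h2
  le_antisymm _ _ h1 h2 := Subtype.ext (h1.antisymm h2)

/-- The common prefixes of `u` and `v` are bounded and closed under prefixes. Two atomic steps from
`x` have a join that depends on the atoms alone, so it is below both `u` and `v`. -/
theorem exists_meet {u v : H} (hu : E.Le u E.top) (hv : E.Le v E.top) :
    ∃ m, E.Le m u ∧ E.Le m v ∧ ∀ x, E.Le x u → E.Le x v → E.Le x m := by
  obtain ⟨m, hm, -, hmax⟩ := exists_greatest_of_local_joins (α := E.Simple)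
    (fun x => (E.len x.1 : ℤ)) (fun x y hxy => by
      have h1 : E.Le x.1 y.1 := hxy.le
      rcases h1.len_le.eq_or_lt with h2 | h2
      · refine absurd ?_ hxy.ne
        unfold Le at h1
        have h3 := E.eq_one_of_len (x.1⁻¹ * y.1) (by omega)
        rw [inv_mul_eq_one] at h3
        exact Subtype.ext h3
      · exact_mod_cast h2)
    (fun x => E.Le x.1 u ∧ E.Le x.1 v) (E.len u) (fun x hx => by exact_mod_cast hx.1.len_le)
    (fun x y hxy hy => ⟨Le.trans hxy hy.1, Le.trans hxy hy.2⟩)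
    (fun x y => E.Le x.1 y.1 ∧ E.len (x.1⁻¹ * y.1) = 1)
    (fun x y hxy => lt_of_le_of_ne hxy.1 fun h => by
      have := hxy.2
      rw [h, inv_mul_cancel, E.len_one] at this
      omega)
    (fun x y hxy => by
      have h1 : E.Le x.1 y.1 := hxy.le
      obtain ⟨a, ha, hay⟩ := E.exists_atom (x.1⁻¹ * y.1) (h1.suffix y.2) fun h => hxy.ne (by
        rw [inv_mul_eq_one] at h; exact Subtype.ext h)
      exact ⟨⟨x.1 * a, (mul_le h1 hay).trans y.2⟩, ⟨le_mul h1 hay, by simpa using ha⟩,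
        mul_le h1 hay⟩)
    (fun x y z hy hz hIy hIz => by
      obtain ⟨j, hj⟩ := E.exists_join (x.1⁻¹ * y.1) (x.1⁻¹ * z.1) hy.2 hz.2
      have key : ∀ w, E.Le w E.top → E.Le y.1 w → E.Le z.1 w →
          E.Le (x.1 * j) w ∧ E.Le y.1 (x.1 * j) ∧ E.Le z.1 (x.1 * j) := by
        intro w hw hyw hzw
        have hxw := hy.1.trans hyw
        obtain ⟨h1, h2, h3⟩ := hj (x.1⁻¹ * w) (hxw.suffix hw) (hy.1.inv_mul hyw)
          (hz.1.inv_mul hzw)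
        have h4 : E.Le x.1 (x.1 * j) := le_mul hxw h3
        refine ⟨mul_le hxw h3, ?_, ?_⟩
        · have := mul_le h4 (x := x.1⁻¹ * y.1) (by rw [inv_mul_cancel_left]; exact h1)
          simpa using this
        · have := mul_le h4 (x := x.1⁻¹ * z.1) (by rw [inv_mul_cancel_left]; exact h2)
          simpa using this
      obtain ⟨h1, h2, h3⟩ := key u hu hIy.1 hIz.1
      obtain ⟨h4, -, -⟩ := key v hv hIy.2 hIz.2
      exact ⟨⟨x.1 * j, h1.trans hu⟩, ⟨h1, h4⟩, h2, h3⟩)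
    ⟨1, one_le _⟩ ⟨one_le _, one_le _⟩
  exact ⟨m.1, hm.1, hm.2, fun x hxu hxv => hmax ⟨x, hxu.trans hu⟩ ⟨hxu, hxv⟩ (one_le _)⟩

variable (E) in
open Classical in
/-- The meet for the prefix order (`1` if there is none). -/
noncomputable def meet (u v : H) : H :=
  if h : ∃ m, E.Le m u ∧ E.Le m v ∧ ∀ x, E.Le x u → E.Le x v → E.Le x m then h.choose else 1

theorem meet_spec {u v : H} (hu : E.Le u E.top) (hv : E.Le v E.top) :
    E.Le (E.meet u v) u ∧ E.Le (E.meet u v) v ∧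
      ∀ x, E.Le x u → E.Le x v → E.Le x (E.meet u v) := by
  rw [meet, dif_pos (exists_meet hu hv)]
  exact (exists_meet hu hv).choose_spec

theorem eq_meet {u v m : H} (hu : E.Le u E.top) (hv : E.Le v E.top) (h1 : E.Le m u)
    (h2 : E.Le m v) (h3 : ∀ x, E.Le x u → E.Le x v → E.Le x m) : E.meet u v = m := by
  obtain ⟨h4, h5, h6⟩ := meet_spec hu hv
  exact (h3 _ h4 h5).antisymm (h6 _ h1 h2)

/-- The meet of `top`-complement of `u` with `v`: the largest prefix of `v` by which `u` can be
multiplied. -/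
theorem meet_mul {u u' v : H} (hw : E.Le (u * u') E.top) (hu : E.Le u (u * u'))
    (hv : E.Le v E.top) :
    E.meet (u⁻¹ * E.top) (u' * E.meet (u'⁻¹ * E.top) v)
      = u' * E.meet ((u * u')⁻¹ * E.top) v := by
  have hu0 : E.Le u E.top := hu.trans hw
  have hu' : E.Le u' E.top := by simpa using hu.suffix hw
  obtain ⟨h1, h2, h3⟩ := meet_spec hu'.compl hv
  obtain ⟨h4, h5, h6⟩ := meet_spec hw.compl hv
  have hu'u : E.Le u' (u⁻¹ * E.top) := by simpa using hu.inv_mul hw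
  -- The quotient of the two complements is `top⁻¹ u top`, whose length is that of `u`.
  have hle : E.Le ((u * u')⁻¹ * E.top) (u'⁻¹ * E.top) := by
    have := E.len_conj u
    have h7 := hu'
    unfold Le at *
    have h8 : ((u * u')⁻¹ * E.top)⁻¹ * (u'⁻¹ * E.top) = E.top⁻¹ * u * E.top := by group
    rw [h8]
    simp only [inv_mul_cancel_left] at hu
    omega
  have h7 : E.Le (E.meet ((u * u')⁻¹ * E.top) v) (E.meet (u'⁻¹ * E.top) v) :=
    h3 _ (h4.trans hle) h5
  have h8 : E.Le (u' * E.meet (u'⁻¹ * E.top) v) E.top := mul_le hu' h1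
  have h9 : E.Le u' (u' * E.meet (u'⁻¹ * E.top) v) := le_mul hu' h1
  refine eq_meet hu0.compl h8 ?_ ?_ ?_
  · refine mul_le hu'u ?_
    convert h4 using 1
    group
  · refine mul_le h9 ?_
    simpa using h7
  · intro x hx1 hx2
    obtain ⟨g1, g2, g3⟩ := meet_spec hu0.compl h8
    have hxm := g3 x hx1 hx2
    have hum := g3 u' hu'u h9
    refine hxm.trans ?_
    have hm1 := hum.inv_mul g1
    have hm2 := hum.inv_mul g2
    rw [inv_mul_cancel_left] at hm2
    have hm3 : E.Le (u'⁻¹ * E.meet (u⁻¹ * E.top) (u' * E.meet (u'⁻¹ * E.top) v))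
        (E.meet ((u * u')⁻¹ * E.top) v) := by
      refine h6 _ ?_ (hm2.trans h2)
      convert hm1 using 1
      group
    have h10 : E.Le u' (u' * E.meet ((u * u')⁻¹ * E.top) v) := le_mul hu' (h4.trans hle)
    have := mul_le (E := E) h10 (x := u'⁻¹ * E.meet (u⁻¹ * E.top)
      (u' * E.meet (u'⁻¹ * E.top) v)) (by simpa using hm3)
    simpa using this

end IntervalGerm

namespace IntervalGerm

variable {H : Type*} [Group H] {E : IntervalGerm H}

/-! ### The monoid of an interval -/

variable (E) in
/-- The relations of the monoid of an interval: `[u] [v] = [u v]` when lengths add. -/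
inductive GermRel : FreeMonoid E.Simple → FreeMonoid E.Simple → Prop
  | one (h : E.Le 1 E.top) : GermRel (.of ⟨1, h⟩) 1
  | mul (u v w : E.Simple) (h : u.1 * v.1 = w.1) (hl : E.Le u.1 w.1) :
      GermRel (.of u * .of v) (.of w)

variable (E) in
/-- The monoid of an interval. -/
abbrev Mon : Type _ := PresentedMonoid E.GermRel

/-- The generator of the monoid of an interval attached to an element of the interval. -/
def of (u : H) (hu : E.Le u E.top) : E.Mon := PresentedMonoid.of E.GermRel ⟨u, hu⟩

theorem of_one : of (1 : H) (one_le E.top) = (1 : E.Mon) :=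
  PresentedMonoid.mk_eq_mk_of_rel (GermRel.one _)

theorem of_mul (u v w : H) (hu : E.Le u E.top) (hv : E.Le v E.top) (hw : E.Le w E.top)
    (h : u * v = w) (hl : E.Le u w) : of u hu * of v hv = of w hw :=
  PresentedMonoid.mk_eq_mk_of_rel (GermRel.mul ⟨u, hu⟩ ⟨v, hv⟩ ⟨w, hw⟩ h hl)

theorem of_inv_mul (u w : H) (hw : E.Le w E.top) (hl : E.Le u w) :
    of u (hl.trans hw) * of (u⁻¹ * w) (hl.suffix hw) = of w hw :=
  of_mul _ _ _ _ _ _ (mul_inv_cancel_left u w) hl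

theorem of_congr {u v : H} (h : u = v) (hu : E.Le u E.top) (hv : E.Le v E.top) :
    of u hu = of v hv := by
  subst h; rfl

theorem mon_induction {p : E.Mon → Prop} (x : E.Mon) (one : p 1)
    (of_mul : ∀ u hu x, p x → p (of u hu * x)) : p x := by
  refine PresentedMonoid.inductionOn x fun a => ?_
  induction a using FreeMonoid.inductionOn' with
  | one => exact one
  | of_mul u a ih => exact of_mul u.1 u.2 _ ih

theorem le_mul_meet {u v : H} (hu : E.Le u E.top) (hv : E.Le v E.top) :
    E.Le u (u * E.meet (u⁻¹ * E.top) v) := le_mul hu (meet_spec hu.compl hv).1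

theorem mul_meet_le {u v : H} (hu : E.Le u E.top) (hv : E.Le v E.top) :
    E.Le (u * E.meet (u⁻¹ * E.top) v) E.top := mul_le hu (meet_spec hu.compl hv).1

/-- Left multiplication by an element of the interval on pairs (head, tail). -/
noncomputable def normAct (u : E.Simple) : Function.End (E.Simple × E.Mon) := fun p =>
  (⟨u.1 * E.meet (u.1⁻¹ * E.top) p.1.1, mul_meet_le u.2 p.1.2⟩,
    of ((E.meet (u.1⁻¹ * E.top) p.1.1)⁻¹ * p.1.1)
      ((meet_spec u.2.compl p.1.2).2.1.suffix p.1.2) * p.2)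

theorem normAct_one (h : E.Le 1 E.top) : normAct (E := E) ⟨1, h⟩ = 1 := by
  funext ⟨⟨v, hv⟩, m⟩
  have h1 : E.meet ((1 : H)⁻¹ * E.top) v = v := by
    simp only [inv_one, one_mul]
    exact eq_meet (Le.refl _) hv hv (Le.refl _) fun x _ h => h
  refine Prod.ext (Subtype.ext ?_) ?_
  · change 1 * E.meet (1⁻¹ * E.top) v = v
    rw [h1, one_mul]
  · have h2 : (E.meet ((1 : H)⁻¹ * E.top) v)⁻¹ * v = 1 := by rw [h1, inv_mul_cancel]
    change of _ _ * m = m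
    rw [of_congr h2 _ (one_le _), of_one, one_mul]

/-- The heads agree by `meet_mul`. The part of `x` left over by `v` and the part of the new head
left over by `u` multiply, inside the interval, to the part of `x` left over by `u v`. -/
theorem normAct_mul (u v w : E.Simple) (h : u.1 * v.1 = w.1) (hl : E.Le u.1 w.1) :
    normAct u * normAct v = normAct w := by
  funext ⟨⟨x, hx⟩, m⟩
  obtain ⟨u, hu⟩ := u
  obtain ⟨v, hv⟩ := v
  obtain ⟨w, hw⟩ := w
  simp only at h hl
  subst h
  have key := meet_mul hw hl hx
  obtain ⟨h1, h2, h3⟩ := meet_spec hv.compl hx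
  obtain ⟨h4, h5, h6⟩ := meet_spec hw.compl hx
  have hle : E.Le (E.meet ((u * v)⁻¹ * E.top) x) (E.meet (v⁻¹ * E.top) x) := by
    have h7 := meet_spec hu.compl (mul_meet_le hv hx)
    rw [key] at h7
    have h8 : E.Le v (v * E.meet ((u * v)⁻¹ * E.top) x) := by
      refine le_mul (w := E.top) hv (h4.trans ?_)
      have := E.len_conj u
      have h9 : E.Le v E.top := hv
      unfold Le at *
      have h10 : ((u * v)⁻¹ * E.top)⁻¹ * (v⁻¹ * E.top) = E.top⁻¹ * u * E.top := by group
      rw [h10]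
      simp only [inv_mul_cancel_left] at hl
      omega
    simpa using h8.inv_mul h7.2.1
  refine Prod.ext (Subtype.ext ?_) ?_
  · change u * E.meet (u⁻¹ * E.top) (v * E.meet (v⁻¹ * E.top) x) = _
    rw [key, ← mul_assoc]
    rfl
  · change of _ _ * (of _ _ * m) = of _ _ * m
    rw [← mul_assoc]
    congr 1
    have e1 : (E.meet (u⁻¹ * E.top) (v * E.meet (v⁻¹ * E.top) x))⁻¹ *
        (v * E.meet (v⁻¹ * E.top) x)
        = (E.meet ((u * v)⁻¹ * E.top) x)⁻¹ * E.meet (v⁻¹ * E.top) x := by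
      rw [key]; group
    have hs := hle.suffix (h2.trans hx)
    refine (congrArg (· * _) (of_congr e1 _ hs)).trans ?_
    refine of_mul _ _ _ _ _ _ ?_ (hle.inv_mul h2)
    group

variable (E) in
/-- The action of the monoid of an interval on pairs (head, tail). -/
noncomputable def normHom : E.Mon →* Function.End (E.Simple × E.Mon) :=
  PresentedMonoid.lift normAct (by
    rintro _ _ (h | ⟨u, v, w, h, hl⟩)
    · exact normAct_one _
    · simpa using normAct_mul u v w h hl)

/-- The action only regroups factors, so the product of head and tail is multiplied by `x`. -/
theorem eval_normHom (x : E.Mon) (p : E.Simple × E.Mon) :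
    of (E.normHom x p).1.1 (E.normHom x p).1.2 * (E.normHom x p).2 = x * (of p.1.1 p.1.2 * p.2) := by
  induction x using mon_induction with
  | one =>
    rw [map_one, one_mul]
    rfl
  | of_mul u hu x ih =>
    rw [mul_assoc, ← ih, map_mul]
    have key : ∀ q : E.Simple × E.Mon, of (normAct ⟨u, hu⟩ q).1.1 (normAct ⟨u, hu⟩ q).1.2 *
        (normAct ⟨u, hu⟩ q).2 = of u hu * (of q.1.1 q.1.2 * q.2) := ?_
    · exact key _
    rintro ⟨⟨v, hv⟩, m⟩
    obtain ⟨h1, h2, h3⟩ := meet_spec hu.compl hv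
    simp only [normAct]
    rw [← of_inv_mul _ _ hv h2, ← mul_assoc, ← mul_assoc, ← mul_assoc]
    congr 2
    exact (of_mul _ _ _ hu _ _ rfl (le_mul_meet hu hv)).symm

/-- The greatest element of the interval which is a prefix of an element of the monoid. -/
noncomputable def head (x : E.Mon) : H := (E.normHom x (⟨1, one_le _⟩, 1)).1.1

/-- The complement of the head. -/
noncomputable def tail (x : E.Mon) : E.Mon := (E.normHom x (⟨1, one_le _⟩, 1)).2

theorem head_le (x : E.Mon) : E.Le (head x) E.top := (E.normHom x (⟨1, one_le _⟩, 1)).1.2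

theorem head_mul_tail (x : E.Mon) : of (head x) (head_le x) * tail x = x := by
  have := eval_normHom x (⟨1, one_le _⟩, 1)
  simp only [of_one, mul_one] at this
  exact this

theorem head_of_mul (u : H) (hu : E.Le u E.top) (x : E.Mon) :
    head (of u hu * x) = u * E.meet (u⁻¹ * E.top) (head x) := by
  unfold head
  rw [map_mul]
  rfl

theorem tail_of_mul (u : H) (hu : E.Le u E.top) (x : E.Mon) :
    tail (of u hu * x) = of ((E.meet (u⁻¹ * E.top) (head x))⁻¹ * head x)
      ((meet_spec hu.compl (head_le x)).2.1.suffix (head_le x)) * tail x := by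
  unfold tail
  rw [map_mul]
  rfl

theorem le_head_of_mul (u : H) (hu : E.Le u E.top) (x : E.Mon) : E.Le u (head (of u hu * x)) := by
  rw [head_of_mul]
  exact le_mul_meet hu (head_le x)

/-- The factor `x` is recovered from `u` and the product alone, which gives left cancellation. -/
theorem eq_of_head_tail (u : H) (hu : E.Le u E.top) (x : E.Mon) :
    of (u⁻¹ * head (of u hu * x)) ((le_head_of_mul u hu x).suffix (head_le _)) *
      tail (of u hu * x) = x := by
  have h1 : u⁻¹ * head (of u hu * x) = E.meet (u⁻¹ * E.top) (head x) := by
    rw [head_of_mul, inv_mul_cancel_left]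
  obtain ⟨h2, h3, -⟩ := meet_spec hu.compl (head_le x)
  rw [of_congr h1 _ (h3.trans (head_le x)), tail_of_mul, ← mul_assoc,
    of_inv_mul _ _ (head_le x) h3, head_mul_tail]

theorem of_mul_left_cancel (u : H) (hu : E.Le u E.top) (x y : E.Mon)
    (h : of u hu * x = of u hu * y) : x = y := by
  rw [← eq_of_head_tail u hu x, ← eq_of_head_tail u hu y]
  simp only [h]

theorem mon_mul_left_cancel (x y z : E.Mon) (h : x * y = x * z) : y = z := by
  induction x using mon_induction with
  | one => simpa using h
  | of_mul u hu x ih =>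
    rw [mul_assoc, mul_assoc] at h
    exact ih (of_mul_left_cancel u hu _ _ h)

variable (E) in
/-- The Garside element of the monoid of an interval. -/
def delta : E.Mon := of E.top (Le.refl _)

theorem conj_le {u : H} (hu : E.Le u E.top) : E.Le (E.top⁻¹ * u * E.top) E.top := by
  simpa using hu.compl.compl

theorem conj_inv_le {u : H} (hu : E.Le u E.top) : E.Le (E.top * u * E.top⁻¹) E.top := by
  have h1 := E.len_conj (E.top * u * E.top⁻¹)
  have h2 := E.len_conj (E.top * u⁻¹)
  unfold Le at *
  simp only [mul_inv_rev, inv_inv, mul_assoc, inv_mul_cancel_left, inv_mul_cancel, mul_one] at *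
  omega

variable (E) in
/-- Conjugation by the Garside element. -/
def twist : E.Mon →* E.Mon :=
  PresentedMonoid.lift (fun u => of (E.top⁻¹ * u.1 * E.top) (conj_le u.2)) (by
    rintro _ _ (h | ⟨u, v, w, h, hl⟩)
    · rw [map_one, FreeMonoid.lift_eval_of, of_congr (v := 1) (by simp) _ (one_le _), of_one]
    · simp only [FreeMonoid.lift_eval_of, map_mul]
      refine of_mul _ _ _ _ _ _ (by rw [← h]; group) ?_
      have h1 : (E.top⁻¹ * u.1 * E.top)⁻¹ * (E.top⁻¹ * w.1 * E.top)
          = E.top⁻¹ * (u.1⁻¹ * w.1) * E.top := by group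
      unfold Le at *
      rw [h1, E.len_conj, E.len_conj, E.len_conj]
      exact hl)

variable (E) in
/-- The inverse of conjugation by the Garside element. -/
def untwist : E.Mon →* E.Mon :=
  PresentedMonoid.lift (fun u => of (E.top * u.1 * E.top⁻¹) (conj_inv_le u.2)) (by
    have hc : ∀ u, E.len (E.top * u * E.top⁻¹) = E.len u := fun u => by
      rw [← E.len_conj (E.top * u * E.top⁻¹)]
      congr 1
      group
    rintro _ _ (h | ⟨u, v, w, h, hl⟩)
    · rw [map_one, FreeMonoid.lift_eval_of, of_congr (v := 1) (by simp) _ (one_le _), of_one]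
    · simp only [FreeMonoid.lift_eval_of, map_mul]
      refine of_mul _ _ _ _ _ _ (by rw [← h]; group) ?_
      have h1 : (E.top * u.1 * E.top⁻¹)⁻¹ * (E.top * w.1 * E.top⁻¹)
          = E.top * (u.1⁻¹ * w.1) * E.top⁻¹ := by group
      unfold Le at *
      rw [h1, hc, hc, hc]
      exact hl)

theorem twist_of (u : H) (hu : E.Le u E.top) :
    E.twist (of u hu) = of (E.top⁻¹ * u * E.top) (conj_le hu) := rfl

theorem untwist_twist (x : E.Mon) : E.untwist (E.twist x) = x := by
  have : E.untwist.comp E.twist = MonoidHom.id _ := by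
    refine PresentedMonoid.ext _ fun u => ?_
    change of _ _ = of u.1 u.2
    exact of_congr (by group) _ _
  exact DFunLike.congr_fun this x

/-- With `u'` the complement of `u`, the Garside element is both `u u'` and `u' (top⁻¹ u top)`;
hence `u Δ = u u' (top⁻¹ u top) = Δ (top⁻¹ u top)`. -/
theorem mul_delta (x : E.Mon) : x * E.delta = E.delta * E.twist x := by
  induction x using mon_induction with
  | one => simp
  | of_mul u hu x ih =>
    rw [mul_assoc, ih, map_mul, ← mul_assoc, ← mul_assoc]
    congr 1
    have h1 : of u hu * of (u⁻¹ * E.top) hu.compl = E.delta := of_inv_mul _ _ _ hu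
    have h2 : of (u⁻¹ * E.top) hu.compl * E.twist (of u hu) = E.delta := by
      rw [twist_of]
      exact of_mul _ _ _ _ _ _ (by group) hu.compl
    nth_rewrite 1 [← h2]
    rw [← h1, mul_assoc]

theorem mul_delta_pow (x : E.Mon) (k : ℕ) :
    x * E.delta ^ k = E.delta ^ k * (E.twist^[k] x) := by
  induction k generalizing x with
  | zero => simp
  | succ k ih =>
    rw [pow_succ', ← mul_assoc, mul_delta, mul_assoc, ih, Function.iterate_succ_apply, mul_assoc]

/-- Right cancellation of powers of `Δ` reduces to left cancellation and injectivity of the twist.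
It makes equality of fractions transitive. -/
theorem mul_delta_pow_cancel (x y : E.Mon) (k : ℕ) (h : x * E.delta ^ k = y * E.delta ^ k) :
    x = y := by
  rw [mul_delta_pow, mul_delta_pow] at h
  have h1 := mon_mul_left_cancel _ _ _ h
  have hinj : Function.Injective E.twist := Function.LeftInverse.injective untwist_twist
  exact hinj.iterate k h1

/-! ### Fractions -/

variable (E) in
/-- Fractions `x D⁻ᵏ` over the monoid of an interval. -/
def fracSetoid : Setoid (E.Mon × ℕ) where
  r p q := p.1 * E.delta ^ q.2 = q.1 * E.delta ^ p.2
  iseqv := by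
    refine ⟨fun _ => rfl, fun h => h.symm, fun {p q r} h1 h2 => ?_⟩
    apply mul_delta_pow_cancel _ _ q.2
    rw [mul_assoc, ← pow_add, add_comm, pow_add, ← mul_assoc, h1, mul_assoc, ← pow_add, add_comm,
      pow_add, ← mul_assoc, h2, mul_assoc, ← pow_add, add_comm, pow_add, ← mul_assoc]

variable (E) in
/-- Fractions `x D⁻ᵏ` over the monoid of an interval. -/
abbrev Frac : Type _ := Quotient E.fracSetoid

variable (E) in
/-- The left multiplication of the monoid on its fractions. -/
def fracHom : E.Mon →* Function.End E.Frac where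
  toFun x := Quotient.map' (fun p => (x * p.1, p.2)) fun p q (h : p.1 * _ = q.1 * _) => by
    change x * p.1 * _ = x * q.1 * _
    rw [mul_assoc, h, mul_assoc]
  map_one' := by
    funext a
    induction a using Quotient.inductionOn'
    simp [Quotient.map'_mk'']
    rfl
  map_mul' x y := by
    funext a
    induction a using Quotient.inductionOn' with | _ p
    exact congrArg (fun m => (Quotient.mk'' (m, p.2) : E.Frac)) (mul_assoc x y p.1)

theorem fracHom_mk (x : E.Mon) (p : E.Mon × ℕ) :
    E.fracHom x (Quotient.mk E.fracSetoid p) = Quotient.mk E.fracSetoid (x * p.1, p.2) := rfl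

/-- Injectivity is left cancellation. `Δ` is surjective because `x Δ⁻ᵏ = Δ twist(x) Δ⁻ᵏ⁻¹`, and each
generator is surjective because it is a left factor of `Δ`. -/
theorem fracHom_bijective (x : E.Mon) : Function.Bijective (E.fracHom x) := by
  constructor
  · intro a b h
    induction a using Quotient.inductionOn with | _ p
    induction b using Quotient.inductionOn with | _ q
    rw [fracHom_mk, fracHom_mk, Quotient.eq] at h
    refine Quotient.sound ?_
    change x * p.1 * _ = x * q.1 * _ at h
    rw [mul_assoc, mul_assoc] at h
    exact mon_mul_left_cancel _ _ _ h
  · have hdelta : Function.Surjective (E.fracHom E.delta) := by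
      intro a
      induction a using Quotient.inductionOn with | _ p
      refine ⟨Quotient.mk _ (E.twist p.1, p.2 + 1), Quotient.sound ?_⟩
      change E.delta * E.twist p.1 * _ = p.1 * _
      rw [← mul_delta, mul_assoc, ← pow_succ']
    induction x using mon_induction with
    | one => rw [map_one]; exact Function.surjective_id
    | of_mul u hu x ih =>
      rw [map_mul]
      refine Function.Surjective.comp ?_ ih
      rw [delta, ← of_inv_mul _ _ _ hu, map_mul] at hdelta
      exact Function.Surjective.of_comp hdelta

variable (E) in
/-- The monoid of an interval acts by permutations on its fractions. -/
noncomputable def fracPerm : E.Mon →* Equiv.Perm E.Frac where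
  toFun x := Equiv.ofBijective _ (fracHom_bijective x)
  map_one' := by
    ext a
    change E.fracHom 1 a = a
    rw [map_one]
    rfl
  map_mul' x y := by
    ext a
    change E.fracHom (x * y) a = E.fracHom x (E.fracHom y a)
    rw [map_mul]
    rfl

theorem fracPerm_injective : Function.Injective E.fracPerm := by
  intro x y h
  have h1 : E.fracHom x (Quotient.mk _ (1, 0)) = E.fracHom y (Quotient.mk _ (1, 0)) :=
    DFunLike.congr_fun h (Quotient.mk _ (1, 0))
  rw [fracHom_mk, fracHom_mk, Quotient.eq] at h1
  change x * 1 * _ = y * 1 * _ at h1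
  simpa using h1

end IntervalGerm

/-! ### Interval models of a presentation and the embedding of the monoid -/

namespace BraidPresentation

open IntervalGerm

/-- A model of a presentation by an interval in a group with a length: the generators are the
atoms of the interval, the relations hold in the interval, and joins of atoms are computed by
relations. -/
structure IntervalModel (X : BraidPresentation) {H : Type*} [Group H] (E : IntervalGerm H) where
  /-- the atom attached to a generator -/
  gen : X.Gen → H
  len_gen : ∀ a, E.len (gen a) = 1
  gen_le : ∀ a, E.Le (gen a) E.top
  exists_gen : ∀ h, E.len h = 1 → E.Le h E.top → ∃ a, gen a = h
  rel : ∀ r ∈ X.rels, ∃ l₁ l₂ : List X.Gen,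
    r = (l₁.map FreeGroup.of).prod * ((l₂.map FreeGroup.of).prod)⁻¹ ∧
      (l₁.map gen).prod = (l₂.map gen).prod ∧ E.len (l₁.map gen).prod = l₁.length ∧
      l₂.length = l₁.length ∧ E.Le (l₁.map gen).prod E.top
  -- Both words spell the join of the two atoms. Their equality as braids is what allows any two
  -- reduced words to be compared.
  join : ∀ a b, ∃ l₁ l₂ : List X.Gen, X.ofWord (a :: l₁) = X.ofWord (b :: l₂) ∧
    ((a :: l₁).map gen).prod = ((b :: l₂).map gen).prod ∧ l₂.length = l₁.length ∧
    ∀ w, E.Le w E.top → E.Le (gen a) w → E.Le (gen b) w →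
      E.len ((a :: l₁).map gen).prod = (a :: l₁).length ∧ E.Le ((a :: l₁).map gen).prod w
  prod_fundWord : (X.fundWord.map gen).prod = E.top
  len_top : E.len E.top = X.fundWord.length
  fundWord_ne_nil : X.fundWord ≠ []
  shift : ∀ a, ∃ b, X.shift (PresentedGroup.of a) = PresentedGroup.of b ∧
    gen b = E.top⁻¹ * gen a * E.top

theorem ofWord_cons (X : BraidPresentation) (a : X.Gen) (l : List X.Gen) :
    X.ofWord (a :: l) = PresentedGroup.of a * X.ofWord l := by simp [ofWord]

theorem ofWord_append (X : BraidPresentation) (l l' : List X.Gen) :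
    X.ofWord (l ++ l') = X.ofWord l * X.ofWord l' := by simp [ofWord]

theorem ofWord_singleton (X : BraidPresentation) (a : X.Gen) :
    X.ofWord [a] = PresentedGroup.of a := by simp [ofWord]

theorem ofWord_congr (X : BraidPresentation) (k m : List X.Gen) {l l' : List X.Gen}
    (h : X.ofWord l = X.ofWord l') : X.ofWord (k ++ l ++ m) = X.ofWord (k ++ l' ++ m) := by
  rw [ofWord_append, ofWord_append, ofWord_append, ofWord_append, h]

theorem ofWord_eq_of_mem_rels (X : BraidPresentation) {l₁ l₂ : List X.Gen}
    (h : (l₁.map FreeGroup.of).prod * ((l₂.map FreeGroup.of).prod)⁻¹ ∈ X.rels) :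
    X.ofWord l₁ = X.ofWord l₂ := by
  have key : ∀ l : List X.Gen, PresentedGroup.mk X.rels (l.map FreeGroup.of).prod = X.ofWord l := by
    intro l
    rw [map_list_prod, List.map_map]
    rfl
  have h1 := PresentedGroup.one_of_mem h
  rwa [map_mul, map_inv, mul_inv_eq_one, key, key] at h1

namespace IntervalModel

variable {X : BraidPresentation} {H : Type*} [Group H] {E : IntervalGerm H}
  (M : X.IntervalModel E)

/-- `l` is a reduced word of `w`. -/
def Reduced (l : List X.Gen) (w : H) : Prop := (l.map M.gen).prod = w ∧ E.len w = l.length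

variable {M}

theorem len_prod_le (l : List X.Gen) : E.len (l.map M.gen).prod ≤ l.length := by
  induction l with
  | nil => simp [E.len_one]
  | cons a l ih =>
    rw [List.map_cons, List.prod_cons, List.length_cons]
    have := E.len_mul_le (M.gen a) (l.map M.gen).prod
    have := M.len_gen a
    omega

theorem Reduced.tail {a : X.Gen} {l : List X.Gen} {w : H} (h : M.Reduced (a :: l) w) :
    E.Le (M.gen a) w ∧ M.Reduced l ((M.gen a)⁻¹ * w) := by
  obtain ⟨rfl, h2⟩ := h
  rw [List.map_cons, List.prod_cons, List.length_cons] at *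
  have h3 := E.len_mul_le (M.gen a) (l.map M.gen).prod
  have h4 := M.len_gen a
  have h5 := len_prod_le (M := M) l
  refine ⟨?_, ?_, ?_⟩
  · unfold Le
    rw [inv_mul_cancel_left]
    omega
  · rw [inv_mul_cancel_left]
  · rw [inv_mul_cancel_left]
    omega

theorem Reduced.append {u w : H} {l l' : List X.Gen} (hu : E.Le u w) (h : M.Reduced l u)
    (h' : M.Reduced l' (u⁻¹ * w)) : M.Reduced (l ++ l') w := by
  obtain ⟨h1, h2⟩ := h
  obtain ⟨h3, h4⟩ := h'
  refine ⟨by rw [List.map_append, List.prod_append, h1, h3, mul_inv_cancel_left], ?_⟩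
  unfold Le at hu
  rw [List.length_append]
  omega

theorem reduced_singleton (a : X.Gen) : M.Reduced [a] (M.gen a) := ⟨by simp, M.len_gen a⟩

theorem exists_reduced (w : H) (hw : E.Le w E.top) : ∃ l, M.Reduced l w := by
  induction hn : E.len w generalizing w with
  | zero => exact ⟨[], by simp [E.eq_one_of_len w hn], by simp [hn]⟩
  | succ n ih =>
    obtain ⟨h, h1, h2⟩ := E.exists_atom w hw fun h => by simp [h, E.len_one] at hn
    have h2 : E.Le h w := h2
    obtain ⟨a, rfl⟩ := M.exists_gen h h1 (h2.trans hw)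
    obtain ⟨l, hl⟩ := ih ((M.gen a)⁻¹ * w) (h2.suffix hw) (by unfold Le at h2; omega)
    exact ⟨_, Reduced.append h2 (reduced_singleton a) hl⟩

/-- Reduced words of an element of the interval represent the same braid. -/
theorem ofWord_eq_of_reduced (w : H) (hw : E.Le w E.top) (l l' : List X.Gen)
    (h : M.Reduced l w) (h' : M.Reduced l' w) : X.ofWord l = X.ofWord l' := by
  induction hn : E.len w generalizing w l l' with
  | zero =>
    have h1 := h.2
    have h2 := h'.2
    rw [hn, eq_comm, List.length_eq_zero_iff] at h1 h2
    rw [h1, h2]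
  | succ n ih =>
    have hlen := h.2
    have hlen' := h'.2
    cases l with
    | nil => simp at hlen; omega
    | cons a l =>
    cases l' with
    | nil => simp at hlen'; omega
    | cons b l' =>
    obtain ⟨ha, hl⟩ := h.tail
    obtain ⟨hb, hl'⟩ := h'.tail
    obtain ⟨l₁, l₂, h1, h2, h3, h4⟩ := M.join a b
    obtain ⟨h5, h6⟩ := h4 w hw ha hb
    have hr₁ : M.Reduced (a :: l₁) ((a :: l₁).map M.gen).prod := ⟨rfl, h5⟩
    have hr₂ : M.Reduced (b :: l₂) ((a :: l₁).map M.gen).prod := ⟨h2.symm, by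
      rw [h5, List.length_cons, List.length_cons, h3]⟩
    -- Both words of the join, followed by `t`, are reduced words of `w`. Each shares its first
    -- letter with one of the given words, so the induction applies after that letter.
    obtain ⟨t, ht⟩ := exists_reduced (M := M) _ (h6.suffix hw)
    have hq₁ := (Reduced.append h6 hr₁ ht).tail
    have hq₂ := (Reduced.append h6 hr₂ ht).tail
    have hna : E.len ((M.gen a)⁻¹ * w) = n := by
      have := M.len_gen a
      unfold Le at ha
      omega
    have hnb : E.len ((M.gen b)⁻¹ * w) = n := by
      have := M.len_gen b
      unfold Le at hb
      omega
    have e1 := ih _ (ha.suffix hw) _ _ hl hq₁.2 hna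
    have e2 := ih _ (hb.suffix hw) _ _ hl' hq₂.2 hnb
    change _ = X.ofWord (l₁ ++ t) at e1
    change _ = X.ofWord (l₂ ++ t) at e2
    rw [ofWord_cons, ofWord_cons, e1, e2, ← ofWord_cons, ← ofWord_cons, ← List.cons_append,
      ← List.cons_append, ofWord_append, ofWord_append, h1]

variable (M) in
/-- The braid attached to an element of the interval. -/
noncomputable def lift (u : E.Simple) : X.Braid := X.ofWord (exists_reduced (M := M) u.1 u.2).choose

theorem lift_eq {l : List X.Gen} {u : H} (hu : E.Le u E.top) (h : M.Reduced l u) :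
    M.lift ⟨u, hu⟩ = X.ofWord l :=
  ofWord_eq_of_reduced u hu _ _ (exists_reduced (M := M) u hu).choose_spec h

theorem lift_gen (a : X.Gen) : M.lift ⟨M.gen a, M.gen_le a⟩ = PresentedGroup.of a := by
  rw [lift_eq _ (reduced_singleton a), ofWord_singleton]

theorem lift_mul (u v w : E.Simple) (h : u.1 * v.1 = w.1) (hl : E.Le u.1 w.1) :
    M.lift u * M.lift v = M.lift w := by
  obtain ⟨l, hl1⟩ := exists_reduced (M := M) u.1 u.2
  obtain ⟨l', hl2⟩ := exists_reduced (M := M) v.1 v.2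
  have hv : v.1 = u.1⁻¹ * w.1 := by rw [← h, inv_mul_cancel_left]
  have e := lift_eq (M := M) w.2 (Reduced.append hl hl1 (hv ▸ hl2))
  have e1 := lift_eq (M := M) u.2 hl1
  have e2 := lift_eq (M := M) v.2 hl2
  change M.lift w = _ at e
  change M.lift u = _ at e1
  change M.lift v = _ at e2
  rw [e, e1, e2, ofWord_append]

variable (M) in
/-- The monoid of the interval maps to the braid group. -/
noncomputable def toBraid : E.Mon →* X.Braid :=
  PresentedMonoid.lift M.lift (by
    rintro _ _ (h | ⟨u, v, w, h, hl⟩)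
    · rw [FreeMonoid.lift_eval_of, map_one,
        lift_eq (l := []) _ ⟨by simp, by simp [E.len_one]⟩]
      simp [ofWord]
    · rw [map_mul, FreeMonoid.lift_eval_of, FreeMonoid.lift_eval_of, FreeMonoid.lift_eval_of]
      exact lift_mul u v w h hl)

theorem toBraid_of (u : H) (hu : E.Le u E.top) : M.toBraid (of u hu) = M.lift ⟨u, hu⟩ := rfl

theorem prod_of_reduced (l : List X.Gen) (w : H) (hw : E.Le w E.top) (h : M.Reduced l w) :
    (l.map fun a => of (M.gen a) (M.gen_le a)).prod = of w hw := by
  induction l generalizing w with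
  | nil =>
    have h1 : w = 1 := by simpa using h.1.symm
    subst h1
    rw [of_one]
    simp
  | cons a l ih =>
    obtain ⟨h1, h2⟩ := h.tail
    rw [List.map_cons, List.prod_cons, ih _ (h1.suffix hw) h2]
    exact of_inv_mul _ _ hw h1

variable (M) in
/-- The braid group acts by permutations on the fractions over the monoid of the interval. -/
noncomputable def toPerm : X.Braid →* Equiv.Perm E.Frac :=
  PresentedGroup.toGroup (f := fun a => E.fracPerm (of (M.gen a) (M.gen_le a))) (by
    intro r hr
    obtain ⟨l₁, l₂, rfl, h1, h2, h3, h4⟩ := M.rel r hr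
    have key : ∀ l : List X.Gen,
        FreeGroup.lift (fun a => E.fracPerm (of (M.gen a) (M.gen_le a)))
          (l.map FreeGroup.of).prod
          = E.fracPerm (l.map fun a => of (M.gen a) (M.gen_le a)).prod := by
      intro l
      induction l with
      | nil => simp
      | cons a l ih => simp [ih]
    rw [map_mul, map_inv, mul_inv_eq_one, key, key, prod_of_reduced l₁ _ h4 ⟨rfl, h2⟩,
      prod_of_reduced l₂ _ h4 ⟨h1.symm, by rw [h2, h3]⟩])

theorem toPerm_ofWord (l : List X.Gen) :
    M.toPerm (X.ofWord l) = E.fracPerm (l.map fun a => of (M.gen a) (M.gen_le a)).prod := by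
  induction l with
  | nil => simp [ofWord]
  | cons a l ih =>
    rw [ofWord_cons, map_mul, ih, List.map_cons, List.prod_cons, map_mul]
    congr 1

/-- Followed by the action on fractions, the map becomes `fracPerm`, which is injective. -/
theorem toBraid_injective : Function.Injective M.toBraid := by
  have h : M.toPerm.comp M.toBraid = E.fracPerm := by
    refine PresentedMonoid.ext _ fun u => ?_
    obtain ⟨l, hl⟩ := exists_reduced (M := M) u.1 u.2
    change M.toPerm (M.lift ⟨u.1, u.2⟩) = E.fracPerm (of u.1 u.2)
    rw [lift_eq _ hl, toPerm_ofWord, prod_of_reduced _ _ u.2 hl]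
  refine Function.Injective.of_comp (f := M.toPerm) ?_
  rw [← MonoidHom.coe_comp, h]
  exact fracPerm_injective

theorem isPositive_iff (A : X.Braid) : X.IsPositive A ↔ ∃ x, M.toBraid x = A := by
  constructor
  · rintro ⟨l, rfl⟩
    refine ⟨(l.map fun a => of (M.gen a) (M.gen_le a)).prod, ?_⟩
    induction l with
    | nil => simp [ofWord]
    | cons a l ih =>
      rw [List.map_cons, List.prod_cons, map_mul, ih, toBraid_of, lift_gen, ofWord_cons]
  · rintro ⟨x, rfl⟩
    induction x using mon_induction with
    | one => exact ⟨[], by simp [ofWord]⟩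
    | of_mul u hu x ih =>
      obtain ⟨l', hl'⟩ := ih
      obtain ⟨l, hl⟩ := exists_reduced (M := M) u hu
      exact ⟨l ++ l', by rw [ofWord_append, map_mul, toBraid_of, lift_eq hu hl, hl']⟩

theorem reduced_fundWord : M.Reduced X.fundWord E.top := ⟨M.prod_fundWord, M.len_top⟩

theorem toBraid_delta : M.toBraid E.delta = X.fund := by
  rw [delta, toBraid_of, lift_eq _ M.reduced_fundWord, fund]

/-- Two automorphisms are compared on generators, where the relation `mul_delta` of the monoid is
carried to the group. -/
theorem shift_eq (M : X.IntervalModel E) (A : X.Braid) : X.shift A = X.fund⁻¹ * A * X.fund := by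
  have h : (X.shift : X.Braid →* X.Braid) = ((MulAut.conj X.fund⁻¹ : MulAut X.Braid) :
      X.Braid →* X.Braid) := by
    refine PresentedGroup.ext fun a => ?_
    obtain ⟨b, hb, hb'⟩ := M.shift a
    change X.shift (PresentedGroup.of a) = MulAut.conj X.fund⁻¹ (PresentedGroup.of a)
    rw [hb, MulAut.conj_apply, inv_inv, mul_assoc, eq_inv_mul_iff_mul_eq, ← toBraid_delta (M := M),
      ← lift_gen (M := M), ← lift_gen (M := M), ← toBraid_of, ← toBraid_of, ← map_mul,
      ← map_mul, mul_delta, twist_of]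
    congr 2
    exact of_congr hb' _ _
  have h1 := DFunLike.congr_fun h A
  change X.shift A = MulAut.conj X.fund⁻¹ A at h1
  rw [h1, MulAut.conj_apply, inv_inv]

variable (M) in
/-- The letter length as a homomorphism. -/
def lenHom : X.Braid →* Multiplicative ℤ :=
  PresentedGroup.toGroup (f := fun _ => Multiplicative.ofAdd 1) (by
    intro r hr
    obtain ⟨l₁, l₂, rfl, h1, h2, h3, h4⟩ := M.rel r hr
    have key : ∀ l : List X.Gen,
        FreeGroup.lift (fun _ => Multiplicative.ofAdd (1 : ℤ)) (l.map FreeGroup.of).prod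
          = Multiplicative.ofAdd (l.length : ℤ) := by
      intro l
      induction l with
      | nil => simp
      | cons a l ih =>
        rw [List.map_cons, List.prod_cons, map_mul, ih, FreeGroup.lift_apply_of, ← ofAdd_add,
          List.length_cons]
        congr 1
        push_cast
        ring
    rw [map_mul, map_inv, mul_inv_eq_one, key, key, h3])

theorem lenHom_ofWord (l : List X.Gen) :
    M.lenHom (X.ofWord l) = Multiplicative.ofAdd (l.length : ℤ) := by
  induction l with
  | nil => simp [ofWord]
  | cons a l ih =>
    rw [ofWord_cons, map_mul, ih]
    have : M.lenHom (PresentedGroup.of a) = Multiplicative.ofAdd 1 := PresentedGroup.toGroup.of _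
    rw [this, ← ofAdd_add, List.length_cons]
    congr 1
    push_cast
    ring

end IntervalModel

end BraidPresentation

theorem IntervalGerm.twist_untwist {H : Type*} [Group H] {E : IntervalGerm H} (x : E.Mon) :
    E.twist (E.untwist x) = x := by
  have : E.twist.comp E.untwist = MonoidHom.id _ := by
    refine PresentedMonoid.ext _ fun u => ?_
    change IntervalGerm.of _ _ = IntervalGerm.of u.1 u.2
    exact IntervalGerm.of_congr (by group) _ _
  exact DFunLike.congr_fun this x

/-! ### The Garside order on the presented group -/

namespace BraidPresentation

open IntervalGerm

theorem isPositive_one (X : BraidPresentation) : X.IsPositive 1 := ⟨[], by simp [ofWord]⟩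

theorem isPositive_of (X : BraidPresentation) (a : X.Gen) :
    X.IsPositive (PresentedGroup.of a) := ⟨[a], X.ofWord_singleton a⟩

theorem IsPositive.mul {X : BraidPresentation} {A B : X.Braid} (hA : X.IsPositive A)
    (hB : X.IsPositive B) : X.IsPositive (A * B) := by
  obtain ⟨l, rfl⟩ := hA
  obtain ⟨l', rfl⟩ := hB
  exact ⟨l ++ l', X.ofWord_append l l'⟩

theorem IsPositive.exists_eq_of_mul {X : BraidPresentation} {A : X.Braid} (hA : X.IsPositive A)
    (h : A ≠ 1) : ∃ a B, X.IsPositive B ∧ A = PresentedGroup.of a * B := by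
  obtain ⟨l, rfl⟩ := hA
  cases l with
  | nil => exact absurd (by simp [ofWord]) h
  | cons a l => exact ⟨a, _, ⟨l, rfl⟩, X.ofWord_cons a l⟩

theorem isPositive_fund_pow (X : BraidPresentation) (k : ℕ) : X.IsPositive (X.fund ^ k) := by
  induction k with
  | zero => simpa using X.isPositive_one
  | succ k ih => rw [pow_succ]; exact ih.mul ⟨_, rfl⟩

namespace IntervalModel

variable {X : BraidPresentation} {H : Type*} [Group H] {E : IntervalGerm H}
  (M : X.IntervalModel E)

/-- The letter length of a braid. -/
def length (A : X.Braid) : ℤ := (M.lenHom A).toAdd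

theorem length_mul (A B : X.Braid) : M.length (A * B) = M.length A + M.length B := by
  simp [length]

theorem length_one : M.length 1 = 0 := by simp [length]

theorem length_ofWord (l : List X.Gen) : M.length (X.ofWord l) = l.length := by
  simp [length, lenHom_ofWord]

theorem length_of (a : X.Gen) : M.length (PresentedGroup.of a) = 1 := by
  simpa [ofWord_singleton] using M.length_ofWord [a]

theorem length_pos {A : X.Braid} (hA : X.IsPositive A) (h : A ≠ 1) : 0 < M.length A := by
  obtain ⟨a, _, ⟨l, rfl⟩, rfl⟩ := hA.exists_eq_of_mul h
  rw [length_mul, length_of, length_ofWord]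
  omega

include M in
theorem eq_one_of_isPositive_inv {A : X.Braid} (h : X.IsPositive A) (h' : X.IsPositive A⁻¹) :
    A = 1 := by
  by_contra hA
  have h1 := M.length_pos h hA
  have h2 := M.length_pos h' (inv_ne_one.2 hA)
  have h3 := M.length_mul A A⁻¹
  rw [mul_inv_cancel, length_one] at h3
  omega

include M in
theorem isPositive_conj {A : X.Braid} (h : X.IsPositive A) :
    X.IsPositive (X.fund⁻¹ * A * X.fund) := by
  rw [M.isPositive_iff] at *
  obtain ⟨x, rfl⟩ := h
  refine ⟨E.twist x, ?_⟩
  rw [mul_assoc, eq_inv_mul_iff_mul_eq, ← M.toBraid_delta, ← map_mul, ← map_mul, mul_delta]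

include M in
theorem isPositive_conj_inv {A : X.Braid} (h : X.IsPositive A) :
    X.IsPositive (X.fund * A * X.fund⁻¹) := by
  rw [M.isPositive_iff] at *
  obtain ⟨x, rfl⟩ := h
  refine ⟨E.untwist x, ?_⟩
  rw [eq_mul_inv_iff_mul_eq, ← M.toBraid_delta, ← map_mul, ← map_mul, mul_delta, twist_untwist]

include M in
theorem isPositive_conj_inv_pow {A : X.Braid} (h : X.IsPositive A) (k : ℕ) :
    X.IsPositive (X.fund ^ k * A * (X.fund ^ k)⁻¹) := by
  induction k with
  | zero => simpa
  | succ k ih =>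
    have := M.isPositive_conj_inv ih
    rw [pow_succ']
    convert this using 1
    group

theorem lift_mul_inv_mul {u w : H} (hw : E.Le w E.top) (h : E.Le u w) :
    M.lift ⟨u, h.trans hw⟩ * M.lift ⟨u⁻¹ * w, h.suffix hw⟩ = M.lift ⟨w, hw⟩ :=
  lift_mul _ _ _ (mul_inv_cancel_left u w) h

theorem isPositive_lift (u : E.Simple) : X.IsPositive (M.lift u) := ⟨_, rfl⟩

include M in
theorem isPositive_of_inv_mul_fund (a : X.Gen) :
    X.IsPositive ((PresentedGroup.of a)⁻¹ * X.fund) := by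
  have h := M.lift_mul_inv_mul (Le.refl _) (M.gen_le a)
  rw [lift_gen, ← toBraid_of _ (Le.refl E.top)] at h
  change _ = M.toBraid E.delta at h
  rw [toBraid_delta] at h
  rw [← h, inv_mul_cancel_left]
  exact M.isPositive_lift _

theorem isPositive_fund (X : BraidPresentation) : X.IsPositive X.fund := ⟨_, rfl⟩

-- An inverse generator is cleared by one `D`, as `D a⁻¹ = D (a⁻¹ D) D⁻¹`. For a product, `D ^ (l +
-- k) A B = (D ^ l (D ^ k A) D⁻ˡ) (D ^ l B)`.
include M in
theorem exists_fund_pow_mul_isPositive (A : X.Braid) :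
    ∃ k : ℕ, X.IsPositive (X.fund ^ k * A) := by
  obtain ⟨A, rfl⟩ := PresentedGroup.mk_surjective _ A
  induction A using FreeGroup.induction_on with
  | C1 => exact ⟨0, by simpa using X.isPositive_one⟩
  | of a => exact ⟨0, by rw [pow_zero, one_mul]; exact X.isPositive_of a⟩
  | inv_of a _ =>
    refine ⟨1, ?_⟩
    have := M.isPositive_conj_inv (M.isPositive_of_inv_mul_fund a)
    rw [pow_one, map_inv]
    convert this using 1
    group
    rfl
  | mul A B hA hB =>
    obtain ⟨k, hk⟩ := hA
    obtain ⟨l, hl⟩ := hB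
    refine ⟨l + k, ?_⟩
    have := (M.isPositive_conj_inv_pow hk l).mul hl
    convert this using 1
    rw [map_mul, pow_add]
    group

include M in
/-- Two generators have a common multiple which is a prefix of all their common multiples. -/
theorem exists_common_multiple (a b : X.Gen) : ∃ j,
    X.IsPositive ((PresentedGroup.of a)⁻¹ * j) ∧ X.IsPositive ((PresentedGroup.of b)⁻¹ * j) ∧
    ∀ A, X.IsPositive ((PresentedGroup.of a)⁻¹ * A) → X.IsPositive ((PresentedGroup.of b)⁻¹ * A) →
      X.IsPositive (j⁻¹ * A) := by
  obtain ⟨l₁, l₂, h1, h2, -, h3⟩ := M.join a b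
  refine ⟨X.ofWord (a :: l₁), ⟨l₁, ?_⟩, ⟨l₂, ?_⟩, fun A hA hB => ?_⟩
  · rw [ofWord_cons, inv_mul_cancel_left]
  · rw [h1, ofWord_cons, inv_mul_cancel_left]
  · obtain ⟨x, hx⟩ := M.isPositive_iff _ |>.1 hA
    obtain ⟨y, hy⟩ := M.isPositive_iff _ |>.1 hB
    rw [eq_inv_mul_iff_mul_eq, ← lift_gen (M := M), ← toBraid_of, ← map_mul] at hx hy
    have hxy := M.toBraid_injective (hx.trans hy.symm)
    -- Both generators are prefixes of the head of `A`, so the join of atoms inside the interval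
    -- already divides this head.
    have ha := le_head_of_mul _ (M.gen_le a) x
    have hb := le_head_of_mul _ (M.gen_le b) y
    rw [← hxy] at hb
    obtain ⟨h4, h5⟩ := h3 _ (head_le _) ha hb
    have h6 : M.lift ⟨_, h5.trans (head_le _)⟩ = X.ofWord (a :: l₁) := lift_eq _ ⟨rfl, h4⟩
    have h7 := congrArg M.toBraid (head_mul_tail (of (M.gen a) (M.gen_le a) * x))
    rw [map_mul, toBraid_of, ← M.lift_mul_inv_mul (head_le _) h5] at h7
    rw [← h6, ← hx, ← h7, mul_assoc, inv_mul_cancel_left]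
    exact (M.isPositive_lift _).mul ((M.isPositive_iff _).2 ⟨_, rfl⟩)

/-- The prefix order on the braid group. -/
@[reducible] def partialOrder : PartialOrder X.Braid where
  le V W := X.IsPositive (V⁻¹ * W)
  le_refl V := by simpa using X.isPositive_one
  le_trans U V W h1 h2 := by simpa [mul_assoc] using h1.mul h2
  le_antisymm V W h1 h2 := by
    have := M.eq_one_of_isPositive_inv h1 (by simpa using h2)
    rwa [inv_mul_eq_one] at this

-- Local joins give a greatest common lower bound among those above a negative power of `D`, and
-- such powers lie below any given braids.
include M in
theorem exists_meet (g h : X.Braid) : ∃ m, X.IsPositive (m⁻¹ * g) ∧ X.IsPositive (m⁻¹ * h) ∧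
    ∀ x, X.IsPositive (x⁻¹ * g) → X.IsPositive (x⁻¹ * h) → X.IsPositive (x⁻¹ * m) := by
  let := M.partialOrder
  have hlt : ∀ x y : X.Braid, x < y → M.length x < M.length y := fun x y hxy => by
    have h1 := M.length_pos (A := x⁻¹ * y) hxy.le fun h => hxy.ne (inv_mul_eq_one.1 h)
    have h2 := M.length_mul x (x⁻¹ * y)
    rw [mul_inv_cancel_left] at h2
    omega
  have key := exists_greatest_of_local_joins (α := X.Braid) M.length hlt
    (fun z => z ≤ g ∧ z ≤ h) (M.length g)
    (fun x hx => hx.1.eq_or_lt.elim (fun h => h ▸ le_rfl) fun h => (hlt _ _ h).le)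
    (fun x y hxy hy => ⟨hxy.trans hy.1, hxy.trans hy.2⟩)
    (fun x y => ∃ a, y = x * PresentedGroup.of a)
    (by
      rintro x _ ⟨a, rfl⟩
      refine lt_of_le_of_ne (by
        change X.IsPositive _
        rw [inv_mul_cancel_left]
        exact X.isPositive_of a) fun h => ?_
      have := congrArg M.length h
      rw [length_mul, length_of] at this
      omega)
    (fun x y hxy => by
      obtain ⟨a, B, hB, h⟩ := IsPositive.exists_eq_of_mul (A := x⁻¹ * y) hxy.le
        fun h => hxy.ne (inv_mul_eq_one.1 h)
      refine ⟨_, ⟨a, rfl⟩, ?_⟩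
      change X.IsPositive _
      rw [mul_inv_rev, mul_assoc, h, inv_mul_cancel_left]
      exact hB)
    (by
      rintro x _ _ ⟨a, rfl⟩ ⟨b, rfl⟩ ⟨h1, h2⟩ ⟨h3, h4⟩
      obtain ⟨j, hj1, hj2, hj3⟩ := M.exists_common_multiple a b
      change X.IsPositive _ at h1 h2 h3 h4
      rw [mul_inv_rev, mul_assoc] at h1 h2 h3 h4
      refine ⟨x * j, ⟨?_, ?_⟩, ?_, ?_⟩
      · change X.IsPositive _
        rw [mul_inv_rev, mul_assoc]
        exact hj3 _ h1 h3
      · change X.IsPositive _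
        rw [mul_inv_rev, mul_assoc]
        exact hj3 _ h2 h4
      · change X.IsPositive _
        rwa [mul_inv_rev, mul_assoc, inv_mul_cancel_left]
      · change X.IsPositive _
        rwa [mul_inv_rev, mul_assoc, inv_mul_cancel_left])
  have hlow : ∀ x : X.Braid, ∀ k l : ℕ, X.IsPositive (X.fund ^ l * x) →
      (X.fund ^ (k + l))⁻¹ ≤ x := fun x k l hx => by
    change X.IsPositive _
    rw [inv_inv, pow_add, mul_assoc]
    exact (X.isPositive_fund_pow k).mul hx
  obtain ⟨k, hk⟩ := M.exists_fund_pow_mul_isPositive g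
  obtain ⟨l, hl⟩ := M.exists_fund_pow_mul_isPositive h
  have h1 : (X.fund ^ (k + l))⁻¹ ≤ g := by rw [add_comm]; exact hlow g l k hk
  obtain ⟨m, hm, hkm, hmax⟩ := key _ ⟨h1, hlow h k l hl⟩
  -- A lower bound `x` need not lie above the chosen power of `D`. A lower power also lies below
  -- `x`; its greatest element `m'` is above `m`, hence above the first power, so `m' ≤ m`.
  refine ⟨m, hm.1, hm.2, fun x hx1 hx2 => ?_⟩
  obtain ⟨p, hp⟩ := M.exists_fund_pow_mul_isPositive x
  have h2 : (X.fund ^ (p + (k + l)))⁻¹ ≤ (X.fund ^ (k + l))⁻¹ := hlow _ _ _ (by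
    rw [mul_inv_cancel]; exact X.isPositive_one)
  obtain ⟨m', hm', hkm', hmax'⟩ := key _ ⟨h2.trans h1, h2.trans (hlow h k l hl)⟩
  have h3 := hmax' m hm (h2.trans hkm)
  have h4 : x ≤ m' := hmax' x ⟨hx1, hx2⟩ (by rw [add_comm]; exact hlow _ _ _ hp)
  exact h4.trans (hmax m' hm' (hkm.trans h3))

/-- The prefix order on the braid group has meets. -/
@[reducible] noncomputable def semilatticeInf : SemilatticeInf X.Braid where
  __ := M.partialOrder
  inf g h := (M.exists_meet g h).choose
  inf_le_left g h := (M.exists_meet g h).choose_spec.1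
  inf_le_right g h := (M.exists_meet g h).choose_spec.2.1
  le_inf x g h h1 h2 := (M.exists_meet g h).choose_spec.2.2 x h1 h2

/-- A presentation with an interval model defines a Garside group. -/
noncomputable def garsideData : letI := M.semilatticeInf; X.GarsideData :=
  letI := M.semilatticeInf
  have le_iff : ∀ V W : X.Braid, V ≤ W ↔ X.IsPositive (V⁻¹ * W) := fun _ _ => Iff.rfl
  { D := X.fund
    len := M.length
    len_mul := M.length_mul
    len_pos := fun p hp => M.length_pos (by
      have := (le_iff _ _).1 hp.le
      rwa [inv_one, one_mul] at this) hp.ne'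
    mul_le_left := fun g a b h => by
      rw [le_iff] at *
      convert h using 1
      group
    mul_D_le := fun a b h => by
      rw [le_iff] at *
      convert M.isPositive_conj h using 1
      group
    mul_inv_D_le := fun a b h => by
      rw [le_iff] at *
      convert M.isPositive_conj_inv h using 1
      group
    one_lt_D := by
      refine lt_of_le_of_ne ?_ fun h => M.fundWord_ne_nil ?_
      · rw [le_iff, inv_one, one_mul]
        exact isPositive_fund X
      · have := M.length_ofWord X.fundWord
        change M.length X.fund = _ at this
        rw [← h, length_one] at this
        exact List.length_eq_zero_iff.1 (by omega)
    exists_pow_le := fun g => by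
      obtain ⟨k, hk⟩ := M.exists_fund_pow_mul_isPositive g
      refine ⟨k, ?_⟩
      rw [le_iff, inv_pow, inv_inv]
      exact hk
    eq_one_of_inf_D := fun p hp h => by
      by_contra hne
      rw [le_iff, inv_one, one_mul] at hp
      obtain ⟨a, B, hB, rfl⟩ := hp.exists_eq_of_mul hne
      have h1 : (PresentedGroup.of a : X.Braid) ≤ PresentedGroup.of a * B ⊓ X.fund := by
        refine le_inf ?_ ?_
        · rw [le_iff, inv_mul_cancel_left]
          exact hB
        · rw [le_iff]
          exact M.isPositive_of_inv_mul_fund a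
      rw [h, le_iff, mul_one] at h1
      have h2 := M.eq_one_of_isPositive_inv (X.isPositive_of a) h1
      have h3 := M.length_of a
      rw [h2, length_one] at h3
      omega
    D_eq := rfl
    isPositive_iff := fun A => by rw [le_iff, inv_one, one_mul]
    shift_eq := M.shift_eq
    len_fund := M.length_ofWord _ }

include M in
theorem normalForm_cycling_decycling (W : X.Braid) :
    (∃! N : ℤ × List X.Braid, X.IsNormalForm W N) ∧
      ((∃ V : X.Braid, IsConj W V ∧ X.inf W < X.inf V) →
        X.inf W < X.inf (X.cycling^[X.fundLength - 1] W)) ∧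
      ((∃ V : X.Braid, IsConj W V ∧ X.sup V < X.sup W) →
        X.sup (X.decycling^[X.fundLength - 1] W) < X.sup W) :=
  let := M.semilatticeInf
  ⟨M.garsideData.existsUnique_isNormalForm W, M.garsideData.inf_lt_inf_iterate_cycling W,
    M.garsideData.sup_iterate_decycling_lt_sup W⟩

end IntervalModel

end BraidPresentation

/-! ### Words in the atoms of an interval -/

section AtomWords

variable {H : Type*} [Group H] {len : H → ℕ} (hsub : ∀ a b, len (a * b) ≤ len a + len b)
include hsub

/-- The product of a prefix of `w` and a prefix of the complement is a prefix of `w`. -/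
theorem prefix_mul {s p w : H} (h1 : len s + len (s⁻¹ * w) = len w)
    (h2 : len p + len (p⁻¹ * (s⁻¹ * w)) = len (s⁻¹ * w)) :
    len (s * p) = len s + len p ∧ len (s * p) + len ((s * p)⁻¹ * w) = len w := by
  have h3 := hsub s p
  have h4 := hsub (s * p) ((s * p)⁻¹ * w)
  rw [mul_inv_cancel_left] at h4
  rw [mul_inv_rev, mul_assoc] at *
  omega

/-- Joins of generators which are given by words are joins of atoms. -/
theorem exists_join_of_words (hone : len 1 = 0) {A : Type*} (gen : A → H)
    (hgen : ∀ a, len (gen a) = 1) (hex : ∀ h, len h = 1 → ∃ a, gen a = h) (P : H → Prop)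
    (hjoin : ∀ a b, ∃ l₁ l₂ : List A,
      ((a :: l₁).map gen).prod = ((b :: l₂).map gen).prod ∧ l₂.length = l₁.length ∧
      ∀ w, P w → len (gen a) + len ((gen a)⁻¹ * w) = len w →
        len (gen b) + len ((gen b)⁻¹ * w) = len w →
        len ((a :: l₁).map gen).prod = (a :: l₁).length ∧
          len ((a :: l₁).map gen).prod + len (((a :: l₁).map gen).prod⁻¹ * w) = len w)
    (a b : H) (ha : len a = 1) (hb : len b = 1) :
    ∃ j, ∀ w, P w → len a + len (a⁻¹ * w) = len w → len b + len (b⁻¹ * w) = len w →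
      len a + len (a⁻¹ * j) = len j ∧ len b + len (b⁻¹ * j) = len j ∧
        len j + len (j⁻¹ * w) = len w := by
  have hword : ∀ l : List A, len (l.map gen).prod ≤ l.length := by
    intro l
    induction l with
    | nil => simp [hone]
    | cons a l ih =>
      rw [List.map_cons, List.prod_cons, List.length_cons]
      have := hsub (gen a) (l.map gen).prod
      have := hgen a
      omega
  have hcons : ∀ (a : A) (l : List A) (j : H), ((a :: l).map gen).prod = j →
      len j = l.length + 1 → len (gen a) + len ((gen a)⁻¹ * j) = len j := by
    rintro a l _ rfl h
    rw [List.map_cons, List.prod_cons, inv_mul_cancel_left] at *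
    have := hsub (gen a) (l.map gen).prod
    have := hgen a
    have := hword l
    omega
  obtain ⟨a, rfl⟩ := hex a ha
  obtain ⟨b, rfl⟩ := hex b hb
  obtain ⟨l₁, l₂, h1, h2, h3⟩ := hjoin a b
  refine ⟨((a :: l₁).map gen).prod, fun w hw haw hbw => ?_⟩
  obtain ⟨h4, h5⟩ := h3 w hw haw hbw
  rw [List.length_cons] at h4
  exact ⟨hcons a l₁ _ rfl h4, hcons b l₂ _ h1.symm (by omega), h5⟩

theorem prefix_trans {a u w : H} (h1 : len a + len (a⁻¹ * u) = len u)
    (h2 : len u + len (u⁻¹ * w) = len w) :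
    len a + len (a⁻¹ * w) = len w ∧
      len (a⁻¹ * u) + len ((a⁻¹ * u)⁻¹ * (a⁻¹ * w)) = len (a⁻¹ * w) := by
  have h3 := hsub a (a⁻¹ * w)
  have h4 := hsub (a⁻¹ * u) (u⁻¹ * w)
  have h5 : (a⁻¹ * u)⁻¹ * (a⁻¹ * w) = u⁻¹ * w := by group
  rw [mul_inv_cancel_left] at h3
  rw [mul_assoc, mul_inv_cancel_left] at h4
  rw [h5]
  omega

end AtomWords

theorem PresentedGroup.autOfEquiv_of {ι : Type} {rels : Set (FreeGroup ι)} (e : ι ≃ ι)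
    (h : ∀ r ∈ rels, FreeGroup.lift (fun i => PresentedGroup.of (rels := rels) (e i)) r = 1)
    (h' : ∀ r ∈ rels, FreeGroup.lift (fun i => PresentedGroup.of (rels := rels) (e.symm i)) r = 1)
    (i : ι) : PresentedGroup.autOfEquiv rels e h h' (PresentedGroup.of i)
      = PresentedGroup.of (e i) := PresentedGroup.toGroup.of h

theorem swap_braid {α : Type*} [DecidableEq α] (x y z : α) (hxy : x ≠ y) (hyz : y ≠ z)
    (hxz : x ≠ z) : Equiv.swap x y * (Equiv.swap y z * Equiv.swap x y)
      = Equiv.swap y z * (Equiv.swap x y * Equiv.swap y z) := by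
  have h1 := Equiv.swap_mul_swap_mul_swap hyz.symm hxz.symm
  have h2 := Equiv.swap_mul_swap_mul_swap hxy hxz
  rw [Equiv.swap_comm y x, Equiv.swap_comm z y] at h1
  rw [← mul_assoc, ← mul_assoc, h1, h2, Equiv.swap_comm]

/-! ### Permutations and inversions -/

open Equiv in
/-- The pairs of values of a permutation which occur in the wrong order. -/
def inversionPairs {n : ℕ} (w : Perm (Fin n)) : Finset (Fin n × Fin n) :=
  {p | ¬(p.1 < p.2 ↔ w⁻¹ p.1 < w⁻¹ p.2)}

namespace inversionPairs

open Equiv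

variable {n : ℕ}

theorem mem (w : Perm (Fin n)) (p : Fin n × Fin n) :
    p ∈ inversionPairs w ↔ ¬(p.1 < p.2 ↔ w⁻¹ p.1 < w⁻¹ p.2) := by simp [inversionPairs]

/-- The number of inversions. -/
def count (w : Perm (Fin n)) : ℕ := ((inversionPairs w).filter fun p => p.1 < p.2).card

theorem ne_of_mem {w : Perm (Fin n)} {p : Fin n × Fin n} (h : p ∈ inversionPairs w) :
    p.1 ≠ p.2 := fun e => by
  rw [mem, e] at h
  simp at h

theorem swap_mem {w : Perm (Fin n)} {p : Fin n × Fin n} (h : p ∈ inversionPairs w) :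
    p.swap ∈ inversionPairs w := by
  have h1 := ne_of_mem h
  have h2 : w⁻¹ p.1 ≠ w⁻¹ p.2 := w⁻¹.injective.ne h1
  rw [mem] at *
  simp only [Prod.fst_swap, Prod.snd_swap]
  grind

theorem card_eq (w : Perm (Fin n)) : (inversionPairs w).card = 2 * count w := by
  rw [count, two_mul, ← Finset.card_filter_add_card_filter_not (fun p : Fin n × Fin n => p.1 < p.2)]
  congr 1
  refine Finset.card_nbij' Prod.swap Prod.swap ?_ ?_ (fun p _ => p.swap_swap) (fun p _ => p.swap_swap)
  · intro p hp
    simp only [Finset.coe_filter, Set.mem_ofPred_eq] at *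
    exact ⟨swap_mem hp.1, lt_of_le_of_ne (not_lt.1 hp.2) (ne_of_mem hp.1).symm⟩
  · intro p hp
    simp only [Finset.coe_filter, Set.mem_ofPred_eq] at *
    exact ⟨swap_mem hp.1, not_lt.2 hp.2.le⟩

/-- After relabelling by `u`, a pair is inverted by `u⁻¹ w` exactly when one of `u` and `w`, but not
both, inverts it. -/
theorem card_inv_mul (u w : Perm (Fin n)) : (inversionPairs (u⁻¹ * w)).card
    = (symmDiff (inversionPairs u) (inversionPairs w)).card := by
  refine Finset.card_nbij' (fun p => (u p.1, u p.2)) (fun p => (u⁻¹ p.1, u⁻¹ p.2)) ?_ ?_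
    (fun p _ => by simp) (fun p _ => by simp)
  · intro p hp
    rw [SetLike.mem_coe, mem] at hp
    rw [SetLike.mem_coe, Finset.mem_symmDiff, mem, mem]
    have hu : ∀ x, u⁻¹ (u x) = x := fun x => by simp
    simp only [mul_inv_rev, inv_inv, Perm.mul_apply, hu] at *
    tauto
  · intro p hp
    rw [SetLike.mem_coe, Finset.mem_symmDiff, mem, mem] at hp
    rw [SetLike.mem_coe, mem]
    have hu : ∀ x, u (u⁻¹ x) = x := fun x => by simp
    simp only [mul_inv_rev, inv_inv, Perm.mul_apply, hu]
    tauto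

/-- The defect in additivity is measured by the pairs inverted by `u` but not by `w`. The factors
`2` appear because `inversionPairs` lists each pair in both orders. -/
theorem count_add_count_inv_mul (u w : Perm (Fin n)) :
    2 * (count u + count (u⁻¹ * w)) = 2 * count w +
      2 * (inversionPairs u \ inversionPairs w).card := by
  have h1 := Finset.card_sdiff_add_card_inter (inversionPairs u) (inversionPairs w)
  have h2 := Finset.card_sdiff_add_card_inter (inversionPairs w) (inversionPairs u)
  have h3 := card_inv_mul u w
  rw [symmDiff_def, Finset.sup_eq_union, Finset.card_union_of_disjoint disjoint_sdiff_sdiff] at h3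
  rw [Finset.inter_comm] at h2
  rw [card_eq] at h1 h2 h3
  have h4 := card_eq w
  have h5 := card_eq u
  omega

theorem count_add_eq_iff (u w : Perm (Fin n)) : count u + count (u⁻¹ * w) = count w ↔
    inversionPairs u ⊆ inversionPairs w := by
  have := count_add_count_inv_mul u w
  rw [← Finset.sdiff_eq_empty_iff_subset, ← Finset.card_eq_zero]
  omega

theorem eq_one_of_forall_lt (w : Perm (Fin n)) (h : ∀ i j : Fin n, (j : ℕ) = i + 1 → w⁻¹ i < w⁻¹ j) :
    w = 1 := by
  cases n with
  | zero => exact Subsingleton.elim _ _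
  | succ n =>
    have hmono : StrictMono (w⁻¹ : Perm (Fin (n + 1))) :=
      Fin.strictMono_iff_lt_succ.2 fun i => h _ _ (by simp)
    rw [← inv_eq_one]
    ext x
    have := congrArg (fun f : Fin (n + 1) ≃o Fin (n + 1) => (f x : ℕ))
      (Subsingleton.elim (hmono.orderIsoOfSurjective _ w⁻¹.surjective) (OrderIso.refl _))
    simpa using this

theorem swap_of_succ {i j : Fin n} (h : (j : ℕ) = i + 1) :
    inversionPairs (swap i j) = {(i, j), (j, i)} := by
  ext ⟨x, y⟩
  rw [mem]
  simp only [swap_inv, Finset.mem_insert, Finset.mem_singleton, Prod.mk.injEq, swap_apply_def]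
  split_ifs <;> grind

theorem count_swap {i j : Fin n} (h : (j : ℕ) = i + 1) : count (swap i j) = 1 := by
  have h1 := card_eq (swap i j)
  have h2 : i ≠ j := fun e => by rw [e] at h; omega
  rw [swap_of_succ h, Finset.card_pair (by simp [h2])] at h1
  omega

theorem swap_subset_iff {i j : Fin n} (h : (j : ℕ) = i + 1) (w : Perm (Fin n)) :
    inversionPairs (swap i j) ⊆ inversionPairs w ↔ w⁻¹ j < w⁻¹ i := by
  have hij : i < j := by rw [Fin.lt_def]; omega
  rw [swap_of_succ h, Finset.insert_subset_iff, Finset.singleton_subset_iff]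
  have h1 : w⁻¹ i ≠ w⁻¹ j := w⁻¹.injective.ne hij.ne
  constructor
  · rintro ⟨h2, -⟩
    rw [mem] at h2
    grind
  · intro h2
    have : (i, j) ∈ inversionPairs w := by rw [mem]; grind
    exact ⟨this, swap_mem this⟩

theorem revPerm_eq : inversionPairs (Fin.revPerm : Perm (Fin n)) = Finset.univ.offDiag := by
  ext ⟨x, y⟩
  rw [mem]
  have : (Fin.revPerm : Perm (Fin n))⁻¹ = Fin.revPerm := rfl
  simp only [this, Fin.revPerm_apply, Fin.rev_lt_rev, Finset.mem_offDiag]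
  grind

/-- The reversal inverts every pair, so the interval below it is the whole symmetric group. -/
theorem subset_revPerm (w : Perm (Fin n)) : inversionPairs w ⊆ inversionPairs Fin.revPerm := by
  intro p hp
  rw [revPerm_eq, Finset.mem_offDiag]
  exact ⟨Finset.mem_univ _, Finset.mem_univ _, ne_of_mem hp⟩

theorem two_mul_count_revPerm : 2 * count (Fin.revPerm : Perm (Fin n)) = n * n - n := by
  rw [← card_eq, revPerm_eq, Finset.offDiag_card, Finset.card_univ, Fintype.card_fin]

theorem count_conj_revPerm (w : Perm (Fin n)) :
    count (Fin.revPerm⁻¹ * w * Fin.revPerm) = count w := by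
  have h : (inversionPairs (Fin.revPerm⁻¹ * w * Fin.revPerm)).card = (inversionPairs w).card := by
    have hrev : (Fin.revPerm : Perm (Fin n))⁻¹ = Fin.revPerm := rfl
    refine Finset.card_nbij' (fun p => (p.2.rev, p.1.rev)) (fun p => (p.2.rev, p.1.rev)) ?_ ?_
      (fun p _ => by simp) (fun p _ => by simp)
    · intro p hp
      rw [SetLike.mem_coe, mem] at *
      simpa [hrev, Fin.rev_lt_rev] using hp
    · intro p hp
      rw [SetLike.mem_coe, mem] at *
      simpa [hrev, Fin.rev_lt_rev] using hp
  rw [card_eq, card_eq] at h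
  omega

end inversionPairs

/-! ### The Artin presentation -/

namespace OldPresentation

open Equiv inversionPairs

variable {n : ℕ}

/-- The transposition attached to an Artin generator. -/
def gen (i : Fin (n - 1)) : Perm (Fin n) := swap ⟨i, by omega⟩ ⟨i + 1, by omega⟩

theorem count_mul_le (a b : Perm (Fin n)) : count (a * b) ≤ count a + count b := by
  have := count_add_count_inv_mul a (a * b)
  rw [inv_mul_cancel_left] at this
  omega

theorem count_gen (i : Fin (n - 1)) : count (gen i) = 1 := count_swap rfl

theorem gen_le_iff (i : Fin (n - 1)) (w : Perm (Fin n)) :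
    count (gen i) + count ((gen i)⁻¹ * w) = count w ↔
      w⁻¹ ⟨i + 1, by omega⟩ < w⁻¹ ⟨i, by omega⟩ := by
  rw [count_add_eq_iff, gen, swap_subset_iff rfl]

theorem exists_gen_le (w : Perm (Fin n)) (hw : w ≠ 1) :
    ∃ i, count (gen i) + count ((gen i)⁻¹ * w) = count w := by
  by_contra! h
  refine hw (eq_one_of_forall_lt w fun i j hij => ?_)
  have h1 := h ⟨i, by omega⟩
  rw [ne_eq, gen_le_iff, not_lt] at h1
  have h2 : (⟨i + 1, by omega⟩ : Fin n) = j := Fin.ext hij.symm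
  simp only [h2] at h1
  exact lt_of_le_of_ne h1 (w⁻¹.injective.ne fun e => by rw [Fin.ext_iff] at e; omega)

theorem eq_one_of_count (w : Perm (Fin n)) (hw : count w = 0) : w = 1 := by
  by_contra h
  obtain ⟨i, hi⟩ := exists_gen_le w h
  have := count_gen i
  omega

theorem exists_gen_eq (w : Perm (Fin n)) (hw : count w = 1) : ∃ i, gen i = w := by
  obtain ⟨i, hi⟩ := exists_gen_le w fun h => by
    have := count_add_count_inv_mul (1 : Perm (Fin n)) 1
    simp [h] at this hw
    omega
  refine ⟨i, inv_mul_eq_one.1 (eq_one_of_count _ ?_)⟩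
  have := count_gen i
  omega

theorem count_one : count (1 : Perm (Fin n)) = 0 := by
  simp [count, inversionPairs]

theorem le_revPerm (w : Perm (Fin n)) :
    count w + count (w⁻¹ * Fin.revPerm) = count (Fin.revPerm : Perm (Fin n)) := by
  rw [count_add_eq_iff]
  exact subset_revPerm w

theorem comm_relator (i j : Fin (n - 1)) :
    FreeGroup.of i * FreeGroup.of j * (FreeGroup.of j * FreeGroup.of i)⁻¹
      = ([i, j].map FreeGroup.of).prod * (([j, i].map FreeGroup.of).prod)⁻¹ := by simp

theorem braid_relator (i j : Fin (n - 1)) :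
    FreeGroup.of i * FreeGroup.of j * FreeGroup.of i *
      (FreeGroup.of j * FreeGroup.of i * FreeGroup.of j)⁻¹
      = ([i, j, i].map FreeGroup.of).prod * (([j, i, j].map FreeGroup.of).prod)⁻¹ := by
  simp [mul_assoc]

theorem of_comm (i j : Fin (n - 1)) (h : 1 < |(i : ℤ) - (j : ℤ)|) :
    (oldPresentation n).ofWord [i, j] = (oldPresentation n).ofWord [j, i] :=
  (oldPresentation n).ofWord_eq_of_mem_rels
    (Eq.subst (motive := OldRel n) (comm_relator i j) (OldRel.comm i j h))

theorem of_braid (i j : Fin (n - 1)) (h : |(i : ℤ) - (j : ℤ)| = 1) :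
    (oldPresentation n).ofWord [i, j, i] = (oldPresentation n).ofWord [j, i, j] :=
  (oldPresentation n).ofWord_eq_of_mem_rels
    (Eq.subst (motive := OldRel n) (braid_relator i j) (OldRel.braid i j h))

theorem gen_comm (i j : Fin (n - 1)) (h : 1 < |(i : ℤ) - (j : ℤ)|) :
    gen i * gen j = gen j * gen i := by
  have h1 : (i : ℕ) ≠ j ∧ (i : ℕ) + 1 ≠ j ∧ (i : ℕ) ≠ j + 1 := by
    refine ⟨?_, ?_, ?_⟩ <;> intro e <;> rw [lt_abs] at h <;> omega
  refine Equiv.Perm.Disjoint.commute ?_ |>.eq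
  intro x
  simp only [gen, swap_apply_def, Fin.ext_iff]
  grind

theorem comm_le (i j : Fin (n - 1)) (h : 1 < |(i : ℤ) - (j : ℤ)|) (w : Perm (Fin n))
    (hi : count (gen i) + count ((gen i)⁻¹ * w) = count w)
    (hj : count (gen j) + count ((gen j)⁻¹ * w) = count w) :
    count (gen i * gen j) = 2 ∧
      count (gen i * gen j) + count ((gen i * gen j)⁻¹ * w) = count w := by
  have h1 : (i : ℕ) ≠ j ∧ (i : ℕ) + 1 ≠ j ∧ (i : ℕ) ≠ j + 1 := by
    refine ⟨?_, ?_, ?_⟩ <;> intro e <;> rw [lt_abs] at h <;> omega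
  have h2 := prefix_mul count_mul_le (s := gen i) (p := gen j) hi (by
    rw [gen_le_iff] at hj ⊢
    simp only [mul_inv_rev, inv_inv, Perm.mul_apply]
    have e1 : gen i ⟨j + 1, by omega⟩ = ⟨j + 1, by omega⟩ :=
      swap_apply_of_ne_of_ne (by simp; omega) (by simp; omega)
    have e2 : gen i ⟨j, by omega⟩ = ⟨j, by omega⟩ :=
      swap_apply_of_ne_of_ne (by simp; omega) (by simp; omega)
    rwa [e1, e2])
  rw [count_gen, count_gen] at h2
  exact h2

/-- The two hypotheses say that `w⁻¹` reverses the order of three consecutive points. All three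
letters can thus be stripped from `w` in turn. -/
theorem braid_le (i j : Fin (n - 1)) (h : (j : ℕ) = i + 1) (w : Perm (Fin n))
    (hi : count (gen i) + count ((gen i)⁻¹ * w) = count w)
    (hj : count (gen j) + count ((gen j)⁻¹ * w) = count w) :
    (count (gen i * (gen j * gen i)) = 3 ∧
      count (gen i * (gen j * gen i)) + count ((gen i * (gen j * gen i))⁻¹ * w) = count w) ∧
    gen i * (gen j * gen i) = gen j * (gen i * gen j) := by
  have hi' := hi
  have hj' := hj
  rw [gen_le_iff] at hi' hj'
  obtain ⟨i, hin⟩ := i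
  obtain ⟨j, hjn⟩ := j
  obtain rfl : j = i + 1 := h
  have e1 : gen ⟨i, hin⟩ ⟨i, by omega⟩ = ⟨i + 1, by omega⟩ := swap_apply_left _ _
  have e2 : gen ⟨i, hin⟩ ⟨i + 1, by omega⟩ = ⟨i, by omega⟩ := swap_apply_right _ _
  have e3 : gen ⟨i, hin⟩ ⟨i + 1 + 1, by omega⟩ = ⟨i + 1 + 1, by omega⟩ :=
    swap_apply_of_ne_of_ne (by simp; omega) (by simp)
  have e4 : gen ⟨i + 1, hjn⟩ ⟨i + 1, by omega⟩ = ⟨i + 1 + 1, by omega⟩ := swap_apply_left _ _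
  have e5 : gen ⟨i + 1, hjn⟩ ⟨i + 1 + 1, by omega⟩ = ⟨i + 1, by omega⟩ := swap_apply_right _ _
  have e6 : gen ⟨i + 1, hjn⟩ ⟨i, by omega⟩ = ⟨i, by omega⟩ :=
    swap_apply_of_ne_of_ne (by simp) (by simp; omega)
  simp only at hi' hj'
  constructor
  · have h1 := prefix_mul count_mul_le (s := gen ⟨i + 1, hjn⟩) (p := gen ⟨i, hin⟩)
      (w := (gen ⟨i, hin⟩)⁻¹ * w) (by
        rw [gen_le_iff]
        simp only [mul_inv_rev, inv_inv, Perm.mul_apply, e2, e3]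
        exact hj'.trans hi') (by
        rw [gen_le_iff]
        simp only [mul_inv_rev, inv_inv, Perm.mul_apply, e1, e3, e4, e6]
        exact hj')
    have h2 := prefix_mul count_mul_le hi h1.2
    rw [h1.1, count_gen, count_gen] at h2
    exact h2
  · exact swap_braid _ _ _ (by simp) (by simp) (by simp; omega)

theorem join (i j : Fin (n - 1)) : ∃ l₁ l₂ : List (Fin (n - 1)),
    (oldPresentation n).ofWord (i :: l₁) = (oldPresentation n).ofWord (j :: l₂) ∧
    ((i :: l₁).map gen).prod = ((j :: l₂).map gen).prod ∧ l₂.length = l₁.length ∧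
    ∀ w, count (gen i) + count ((gen i)⁻¹ * w) = count w →
      count (gen j) + count ((gen j)⁻¹ * w) = count w →
      count ((i :: l₁).map gen).prod = (i :: l₁).length ∧
        count ((i :: l₁).map gen).prod + count (((i :: l₁).map gen).prod⁻¹ * w) = count w := by
  rcases lt_trichotomy |(i : ℤ) - (j : ℤ)| 1 with h | h | h
  · obtain rfl : i = j := by
      rw [Int.abs_lt_one_iff] at h
      exact Fin.ext (by omega)
    exact ⟨[], [], rfl, rfl, rfl, fun w hw _ => by
      simpa only [List.map_cons, List.map_nil, List.prod_cons, List.prod_nil, mul_one] using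
        ⟨count_gen i, hw⟩⟩
  · refine ⟨[j, i], [i, j], of_braid i j h, ?_, rfl, ?_⟩
    all_goals simp only [List.map_cons, List.map_nil, List.prod_cons, List.prod_nil, mul_one]
    · rcases (abs_eq one_pos.le).1 h with h | h
      · exact (braid_le j i (by omega) _ (le_revPerm _) (le_revPerm _)).2.symm
      · exact (braid_le i j (by omega) _ (le_revPerm _) (le_revPerm _)).2
    · intro w hi hj
      rcases (abs_eq one_pos.le).1 h with h | h
      · have := braid_le j i (by omega) w hj hi
        rw [this.2] at this
        exact this.1
      · exact (braid_le i j (by omega) w hi hj).1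
  · refine ⟨[j], [i], of_comm i j h, ?_, rfl, ?_⟩
    all_goals simp only [List.map_cons, List.map_nil, List.prod_cons, List.prod_nil, mul_one]
    · exact gen_comm i j h
    · exact comm_le i j h

/-- The weak order on permutations. -/
def germ (n : ℕ) : IntervalGerm (Perm (Fin n)) where
  len := count
  top := Fin.revPerm
  len_one := count_one
  eq_one_of_len := eq_one_of_count
  len_mul_le := count_mul_le
  len_conj := count_conj_revPerm
  exists_atom w _ hw := by
    obtain ⟨i, hi⟩ := exists_gen_le w hw
    exact ⟨_, count_gen i, hi⟩
  exists_join := exists_join_of_words count_mul_le count_one gen count_gen exists_gen_eq _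
    fun i j => by
      obtain ⟨l₁, l₂, -, h1, h2, h3⟩ := join i j
      exact ⟨l₁, l₂, h1, h2, fun w _ => h3 w⟩

theorem fundWord_map_val : (oldPresentation n).fundWord.map Fin.val
    = (List.range (n - 1)).reverse.flatMap fun k => List.range (k + 1) := by
  have h : ∀ k : Fin (n - 1), ((List.finRange (n - 1)).filter (· ≤ k)).map Fin.val
      = List.range (k + 1) := by
    intro k
    have h1 : (List.finRange (n - 1)).filter (· ≤ k)
        = (List.finRange (n - 1)).filter ((fun x : ℕ => decide (x ≤ k)) ∘ Fin.val) := rfl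
    rw [h1, ← List.filter_map, List.map_coe_finRange_eq_range]
    have h2 := k.2
    generalize (k : ℕ) = k at h2
    generalize n - 1 = m at h2
    induction m with
    | zero => omega
    | succ m ih =>
      rw [List.range_succ, List.filter_append]
      rcases (Nat.lt_succ_iff_lt_or_eq.1 h2) with h3 | rfl
      · simp [ih h3, h3]
      · rw [List.range_succ, List.filter_eq_self.2 (by simp; omega)]
        simp
  rw [← List.map_coe_finRange_eq_range, ← List.map_reverse, List.flatMap_map]
  change List.map _ (List.flatMap _ _) = _
  rw [List.map_flatMap]
  exact List.flatMap_congr fun k _ => h k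

theorem fundWord_length (n : ℕ) :
    2 * (oldPresentation n).fundWord.length = n * n - n := by
  have h : ∀ m, 2 * ((List.range m).reverse.flatMap fun k => List.range (k + 1)).length
      = (m + 1) * m := by
    intro m
    induction m with
    | zero => rfl
    | succ m ih =>
      rw [List.range_succ, List.reverse_append, List.flatMap_append, List.length_append, mul_add,
        ih]
      simp
      ring
  have h1 : (oldPresentation n).fundWord.length
      = ((oldPresentation n).fundWord.map (Fin.val : Fin (n - 1) → ℕ)).length :=
    List.length_map _ |>.symm
  rw [h1, fundWord_map_val, h]
  cases n with
  | zero => rfl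
  | succ n => rw [Nat.add_sub_cancel, Nat.add_mul, Nat.add_mul]; simp [mul_add]

theorem prod_fundWord : ((oldPresentation n).fundWord.map gen).prod = Fin.revPerm := by
  let s : ℕ → Perm (Fin n) := fun i => if h : i < n - 1 then gen ⟨i, h⟩ else 1
  have hs : (gen : Fin (n - 1) → Perm (Fin n)) = s ∘ Fin.val := by
    funext i
    simp [s]
  have hs0 : ((oldPresentation n).fundWord.map gen)
      = ((oldPresentation n).fundWord.map (Fin.val : Fin (n - 1) → ℕ)).map s := by
    rw [hs]
    exact List.map_map.symm
  rw [hs0, fundWord_map_val]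
  have hs1 : ∀ k (x : Fin n), k + 1 < n → (s k x : ℕ) =
      if (x : ℕ) = k then k + 1 else if (x : ℕ) = k + 1 then k else x := by
    intro k x hk
    simp only [s, dif_pos (show k < n - 1 by omega), gen, swap_apply_def, Fin.ext_iff]
    split_ifs <;> rfl
  -- An ascending block acts as the cycle `0 ↦ 1 ↦ ⋯ ↦ k ↦ 0`. Multiplying the blocks, longest
  -- first, reverses the points `0, …, m`, as `h2` records.
  have h1 : ∀ k (x : Fin n), k < n → (((List.range k).map s).prod x : ℕ) =
      if (x : ℕ) < k then (x : ℕ) + 1 else if (x : ℕ) = k then 0 else x := by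
    intro k
    induction k with
    | zero => intro x _; simp
    | succ k ih =>
      intro x hk
      rw [List.range_succ, List.map_append, List.prod_append, Perm.mul_apply, ih _ (by omega)]
      simp only [List.map_cons, List.map_nil, List.prod_cons, List.prod_nil, mul_one]
      rw [hs1 k x hk]
      grind
  have h2 : ∀ m (x : Fin n), m < n →
      (((((List.range m).reverse.flatMap fun k => List.range (k + 1)).map s).prod x : Fin n) : ℕ) =
        if (x : ℕ) ≤ m then m - (x : ℕ) else x := by
    intro m
    induction m with
    | zero => intro x _; simp
    | succ m ih =>
      intro x hm
      rw [List.range_succ, List.reverse_append, List.flatMap_append, List.map_append,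
        List.prod_append, Perm.mul_apply]
      simp only [List.reverse_cons, List.reverse_nil, List.nil_append, List.flatMap_cons,
        List.flatMap_nil, List.append_nil]
      rw [h1 _ _ hm, ih x (by omega)]
      grind
  ext x
  have := x.2
  rw [h2 _ _ (by omega), Fin.revPerm_apply, Fin.val_rev]
  grind

/-- The model of the Artin presentation. -/
def model (n : ℕ) (hn : 2 ≤ n) : (oldPresentation n).IntervalModel (germ n) where
  gen := gen
  len_gen := count_gen
  gen_le _ := le_revPerm _
  exists_gen h hh _ := exists_gen_eq h hh
  rel := by
    rintro _ (⟨i, j, h⟩ | ⟨i, j, h⟩)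
    · have h1 := comm_le i j h _ (le_revPerm _) (le_revPerm _)
      exact ⟨[i, j], [j, i], comm_relator i j, gen_comm i j h, h1.1, rfl, le_revPerm _⟩
    · have key : ∀ i j : Fin (n - 1), (j : ℕ) = i + 1 → _ := fun i j h =>
        braid_le i j h _ (le_revPerm _) (le_revPerm _)
      refine ⟨[i, j, i], [j, i, j], braid_relator i j, ?_, ?_, rfl, le_revPerm _⟩
      · rcases (abs_eq one_pos.le).1 h with h | h
        · exact (key j i (by omega)).2.symm
        · exact (key i j (by omega)).2
      · rcases (abs_eq one_pos.le).1 h with h | h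
        · have := key j i (by omega)
          rw [this.2] at this
          exact this.1.1
        · exact (key i j (by omega)).1.1
  join i j := by
    obtain ⟨l₁, l₂, h1, h2, h3, h4⟩ := join i j
    exact ⟨l₁, l₂, h1, h2, h3, fun w _ => h4 w⟩
  prod_fundWord := prod_fundWord
  len_top := by
    have h1 := fundWord_length n
    have h2 := two_mul_count_revPerm (n := n)
    change count Fin.revPerm = _
    omega
  fundWord_ne_nil h := by
    have h1 := fundWord_length n
    rw [h] at h1
    have : n * 2 ≤ n * n := Nat.mul_le_mul_left n hn
    simp at h1
    omega
  shift := fun (i : Fin (n - 1)) => by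
    refine ⟨Fin.rev i, PresentedGroup.autOfEquiv_of _ _ _ i, ?_⟩
    have hrev : (Fin.revPerm : Perm (Fin n))⁻¹ = Fin.revPerm := rfl
    change gen (Fin.rev i) = Fin.revPerm⁻¹ * gen i * Fin.revPerm
    unfold gen
    rw [mul_assoc, Equiv.swap_mul_eq_mul_swap, ← mul_assoc, inv_mul_cancel, one_mul, hrev,
      swap_comm]
    congr 1 <;> ext <;> simp only [Fin.revPerm_apply, Fin.val_rev] <;> omega

end OldPresentation

/-! ### The absolute order on permutations -/

namespace Equiv.Perm

open Module

variable {α : Type*}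

/-- The functions which are constant on the cycles of a permutation. -/
def invariants (w : Perm α) : Submodule ℚ (α → ℚ) where
  carrier := {f | ∀ x, f (w x) = f x}
  add_mem' hf hg x := by simp [hf x, hg x]
  zero_mem' _ := rfl
  smul_mem' c f hf x := by simp [hf x]

theorem mem_invariants (w : Perm α) (f : α → ℚ) : f ∈ invariants w ↔ ∀ x, f (w x) = f x := Iff.rfl

theorem invariants_mul (u v : Perm α) : invariants u ⊓ invariants v ≤ invariants (u * v) := by
  rintro f ⟨h1, h2⟩ x
  rw [mul_apply, h1, h2]

/-- The indicator function of a cycle is invariant and separates it from the others. -/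
theorem sameCycle_iff_invariants (w : Perm α) (x y : α) :
    SameCycle w x y ↔ ∀ f ∈ invariants w, f x = f y := by
  classical
  constructor
  · rintro ⟨i, rfl⟩ f hf
    induction i with
    | zero => rfl
    | succ i ih => rw [add_comm, zpow_one_add, mul_apply, hf, ← ih]
    | pred i ih => rw [ih, ← hf ((w ^ (-(i : ℤ) - 1)) x), ← mul_apply, ← zpow_one_add]; ring_nf
  · intro h
    have := h (fun z => if SameCycle w x z then 1 else 0) fun z => by simp [sameCycle_apply_right]
    simpa [SameCycle.refl] using this

section Swap

variable [DecidableEq α]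

theorem mem_invariants_swap (i j : α) (f : α → ℚ) : f ∈ invariants (swap i j) ↔ f i = f j := by
  constructor
  · intro h
    simpa using (h j)
  · intro h x
    rw [swap_apply_def]
    split_ifs with h1 h2
    · rw [h1, h]
    · rw [h2, h]
    · rfl

theorem invariants_swap_mul (w : Perm α) (i j : α) :
    invariants (swap i j * w) ⊓ invariants (swap i j)
      = invariants w ⊓ invariants (swap i j) := by
  apply le_antisymm
  · refine le_inf ?_ inf_le_right
    have := invariants_mul (swap i j) (swap i j * w)
    rw [swap_mul_self_mul, inf_comm] at this
    exact this
  · refine le_inf ?_ inf_le_right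
    rw [inf_comm]
    exact invariants_mul _ _

/-- If multiplication by a transposition splits a cycle, the two moved points lie in the two
parts. -/
theorem SameCycle.of_swap_mul {w : Perm α} {i j x y : α} (h : SameCycle (swap i j * w) x y) :
    SameCycle w x y ∨ (SameCycle w x i ∧ SameCycle w y j) ∨ (SameCycle w x j ∧ SameCycle w y i) := by
  classical
  have key : ∀ x y, SameCycle (swap i j * w) x y → ¬SameCycle w x y →
      ((SameCycle w x i ∧ ¬SameCycle w x j) ∨ (SameCycle w x j ∧ ¬SameCycle w x i)) := by
    intro x y h hxy
    by_contra hc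
    -- If the cycle of `x` contains both or neither of `i` and `j`, its indicator is invariant under
    -- the transposition too, hence under the product.
    let f : α → ℚ := fun z => if SameCycle w x z then 1 else 0
    have hf : f ∈ invariants w := fun z => by simp [f, sameCycle_apply_right]
    have hf' : f ∈ invariants (swap i j) := by
      rw [mem_invariants_swap]
      simp only [f]
      split_ifs <;> tauto
    have h1 := ((invariants_swap_mul w i j).ge ⟨hf, hf'⟩).1
    have h2 := (sameCycle_iff_invariants _ _ _).1 h f h1
    simp [f, hxy, SameCycle.refl] at h2
  by_cases hxy : SameCycle w x y
  · exact Or.inl hxy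
  · right
    rcases key x y h hxy with ⟨h1, h2⟩ | ⟨h1, h2⟩ <;>
      rcases key y x h.symm (fun h => hxy h.symm) with ⟨h3, h4⟩ | ⟨h3, h4⟩
    · exact absurd (h1.trans h3.symm) hxy
    · exact Or.inl ⟨h1, h3⟩
    · exact Or.inr ⟨h1, h3⟩
    · exact absurd (h1.trans h3.symm) hxy

variable [Finite α]

/-- The orbit of `i` follows `w` until `w` would first return to `i`; there the transposition sends
it to `j`. -/
theorem sameCycle_swap_mul {w : Perm α} {i j : α} (h : ¬SameCycle w i j) :
    SameCycle (swap i j * w) i j := by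
  classical
  have hex : ∃ k, 0 < k ∧ (w ^ k) i = i :=
    ⟨orderOf w, orderOf_pos w, by rw [pow_orderOf_eq_one, one_apply]⟩
  obtain ⟨hk, hki⟩ := Nat.find_spec hex
  have hmin : ∀ m, 0 < m → m < Nat.find hex → (w ^ m) i ≠ i := fun m h1 h2 h3 =>
    Nat.find_min hex h2 ⟨h1, h3⟩
  generalize Nat.find hex = k at *
  have hj : ∀ m : ℕ, (w ^ m) i ≠ j := fun m hm => h ⟨m, by simpa using hm⟩
  have key : ∀ m, m < k → ((swap i j * w) ^ m) i = (w ^ m) i := by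
    intro m
    induction m with
    | zero => intro _; rfl
    | succ m ih =>
      intro hm
      rw [pow_succ', mul_apply, ih (by omega), mul_apply, ← mul_apply w, ← pow_succ',
        swap_apply_of_ne_of_ne (hmin _ (by omega) hm) (hj _)]
  obtain ⟨m, rfl⟩ := Nat.exists_eq_succ_of_ne_zero hk.ne'
  refine ⟨(m + 1 : ℕ), ?_⟩
  rw [zpow_natCast, pow_succ', mul_apply, key m (by omega), mul_apply, ← mul_apply w, ← pow_succ',
    hki, swap_apply_left]

/-- The orbit of `i` follows `w` until `w` would first reach `j`; there the transposition sends it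
back to `i`. -/
theorem not_sameCycle_swap_mul {w : Perm α} {i j : α} (hij : i ≠ j) (h : SameCycle w i j) :
    ¬SameCycle (swap i j * w) i j := by
  classical
  have hex : ∃ k, (w ^ k) i = j := by
    obtain ⟨k, -, hk⟩ := h.exists_pow_eq'
    exact ⟨k, hk⟩
  have hki := Nat.find_spec hex
  have hmin : ∀ m, m < Nat.find hex → (w ^ m) i ≠ j := fun m h2 h3 => Nat.find_min hex h2 h3
  generalize Nat.find hex = k at *
  have hk : k ≠ 0 := fun h0 => hij (by simpa [h0] using hki)
  have key : ∀ m : ℕ, ∃ l < k, ((swap i j * w) ^ m) i = (w ^ l) i := by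
    intro m
    induction m with
    | zero => exact ⟨0, by omega, rfl⟩
    | succ m ih =>
      obtain ⟨l, hl, he⟩ := ih
      rw [pow_succ', mul_apply, he, mul_apply, ← mul_apply w, ← pow_succ']
      rcases (Nat.succ_le_of_lt hl).eq_or_lt with h1 | h1
      · refine ⟨0, by omega, ?_⟩
        rw [show l + 1 = k from h1, hki, swap_apply_right]
        rfl
      · refine ⟨l + 1, h1, swap_apply_of_ne_of_ne (fun h2 => hmin (k - (l + 1)) (by omega) ?_)
          (hmin _ h1)⟩
        conv_lhs => rw [← h2]
        rw [← mul_apply, ← pow_add, Nat.sub_add_cancel h1.le, hki]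
  intro hc
  obtain ⟨m, -, hm⟩ := hc.exists_pow_eq'
  obtain ⟨l, hl, he⟩ := key m
  exact hmin l hl (he ▸ hm)

end Swap

variable [Fintype α]

/-- The codimension of the space of invariants. -/
noncomputable def absLen (w : Perm α) : ℕ := Fintype.card α - finrank ℚ (invariants w)

theorem absLen_add_finrank (w : Perm α) :
    absLen w + finrank ℚ (invariants w) = Fintype.card α := by
  have := Submodule.finrank_le (invariants w)
  rw [finrank_fintype_fun_eq_card] at this
  exact Nat.sub_add_cancel this

theorem card_le_finrank_inf (u v : Perm α) :
    Fintype.card α ≤ absLen u + absLen v +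
      finrank ℚ (invariants u ⊓ invariants v : Submodule ℚ (α → ℚ)) := by
  have h1 := Submodule.finrank_sup_add_finrank_inf_eq (invariants u) (invariants v)
  have h2 := Submodule.finrank_le (invariants u ⊔ invariants v)
  rw [finrank_fintype_fun_eq_card] at h2
  have h3 := absLen_add_finrank u
  have h4 := absLen_add_finrank v
  omega

theorem absLen_mul_le (u v : Perm α) : absLen (u * v) ≤ absLen u + absLen v := by
  have h1 := card_le_finrank_inf u v
  have h2 := Submodule.finrank_mono (invariants_mul u v)
  have h3 := absLen_add_finrank (u * v)
  omega

theorem absLen_one : absLen (1 : Perm α) = 0 := by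
  have h : invariants (1 : Perm α) = ⊤ := by
    ext f
    simp [mem_invariants]
  rw [absLen, h, finrank_top, finrank_fintype_fun_eq_card, Nat.sub_self]

theorem eq_one_of_absLen (w : Perm α) (h : absLen w = 0) : w = 1 := by
  classical
  have h1 := absLen_add_finrank w
  rw [h, zero_add, ← finrank_fintype_fun_eq_card ℚ] at h1
  have h2 := Submodule.eq_top_of_finrank_eq h1
  ext x
  have h3 : (fun z => if z = x then 1 else 0) ∈ invariants w := h2 ▸ Submodule.mem_top
  have h4 := h3 x
  simpa using h4

theorem absLen_conj (c w : Perm α) : absLen (c⁻¹ * w * c) = absLen w := by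
  have h : invariants (c⁻¹ * w * c)
      = (invariants w).map (LinearEquiv.funCongrLeft ℚ ℚ c : (α → ℚ) →ₗ[ℚ] (α → ℚ)) := by
    rw [Submodule.map_equiv_eq_comap_symm]
    ext f
    rw [Submodule.mem_comap]
    constructor
    · intro hf x
      simpa using hf (c⁻¹ x)
    · intro hf x
      simpa using hf (c x)
  rw [absLen, absLen, h, LinearEquiv.finrank_map_eq]

/-- Additivity is the equality case of the codimension bound, so the invariants of `w` are the
intersection of those of the two factors. -/
theorem invariants_le_of_prefix {u w : Perm α} (h : absLen u + absLen (u⁻¹ * w) = absLen w) :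
    invariants w ≤ invariants u ∧ invariants w ≤ invariants (u⁻¹ * w) := by
  have h1 := card_le_finrank_inf u (u⁻¹ * w)
  have h2 := invariants_mul u (u⁻¹ * w)
  rw [mul_inv_cancel_left] at h2
  have h3 := absLen_add_finrank w
  rw [← Submodule.eq_of_le_of_finrank_le h2 (by omega)]
  exact ⟨inf_le_left, inf_le_right⟩

variable [DecidableEq α]

theorem absLen_swap {i j : α} (hij : i ≠ j) : absLen (swap i j) = 1 := by
  let φ : (α → ℚ) →ₗ[ℚ] ℚ := LinearMap.proj (R := ℚ) (φ := fun _ => ℚ) i - LinearMap.proj j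
  have h1 : invariants (swap i j) = LinearMap.ker φ := by
    ext f
    rw [mem_invariants_swap, LinearMap.mem_ker]
    simp [φ, sub_eq_zero]
  have h2 : LinearMap.range φ = ⊤ := by
    rw [LinearMap.range_eq_top]
    intro q
    exact ⟨Pi.single i q, by simp [φ, hij.symm]⟩
  have h3 := LinearMap.finrank_range_add_finrank_ker φ
  rw [h2, finrank_top, finrank_self, finrank_fintype_fun_eq_card, ← h1] at h3
  have := absLen_add_finrank (swap i j)
  omega

/-- Merging two cycles shrinks the space of invariants strictly, and intersecting with one
hyperplane costs at most one dimension. -/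
theorem absLen_swap_mul {w : Perm α} {i j : α} (hij : i ≠ j) (h : ¬SameCycle w i j) :
    absLen (swap i j * w) = absLen w + 1 := by
  have h1 := card_le_finrank_inf w (swap i j)
  have h2 : invariants (swap i j * w) ≤ invariants (swap i j) := fun f hf => by
    rw [mem_invariants_swap]
    exact (sameCycle_iff_invariants _ _ _).1 (sameCycle_swap_mul h) f hf
  have h3 := invariants_swap_mul w i j
  rw [inf_eq_left.2 h2] at h3
  have h4 : invariants (swap i j * w) < invariants w := by
    refine lt_of_le_of_ne (h3 ▸ inf_le_left) fun he => h ?_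
    rw [sameCycle_iff_invariants, ← he]
    exact (sameCycle_iff_invariants _ _ _).1 (sameCycle_swap_mul h)
  have h5 := Submodule.finrank_lt_finrank_of_lt h4
  rw [← h3, absLen_swap hij] at h1
  have h6 := absLen_add_finrank w
  have h7 := absLen_add_finrank (swap i j * w)
  omega

theorem swap_prefix_iff {w : Perm α} {i j : α} (hij : i ≠ j) :
    absLen (swap i j) + absLen ((swap i j)⁻¹ * w) = absLen w ↔ SameCycle w i j := by
  rw [absLen_swap hij, swap_inv]
  constructor
  · intro h
    by_contra hc
    have := absLen_swap_mul hij hc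
    omega
  · intro h
    have := absLen_swap_mul hij (not_sameCycle_swap_mul hij h)
    rw [swap_mul_self_mul] at this
    omega

theorem exists_swap_prefix {w : Perm α} (hw : w ≠ 1) : ∃ i j, i ≠ j ∧
    absLen (swap i j) + absLen ((swap i j)⁻¹ * w) = absLen w := by
  obtain ⟨i, hi⟩ : ∃ i, w i ≠ i := by
    by_contra! h
    exact hw (Equiv.ext h)
  exact ⟨i, w i, hi.symm, (swap_prefix_iff hi.symm).2 (sameCycle_apply_right.2 (SameCycle.refl _ _))⟩

/-- Below a given permutation, the absolute order is the refinement order on cycles. -/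
theorem prefix_of_invariants_le {u v c : Perm α} (hu : absLen u + absLen (u⁻¹ * c) = absLen c)
    (hv : absLen v + absLen (v⁻¹ * c) = absLen c) (h : invariants v ≤ invariants u) :
    absLen u + absLen (u⁻¹ * v) = absLen v := by
  induction hn : absLen u generalizing u v c with
  | zero => rw [eq_one_of_absLen u hn, inv_one, one_mul, zero_add]
  | succ n ih =>
    -- A transposition below `u` joins two points of one cycle of `u`, hence of `v`. It is removed
    -- from `u`, `v` and `c` together, so the bound changes along the induction.
    obtain ⟨i, j, hij, hiu⟩ := exists_swap_prefix (w := u) fun h => by simp [h, absLen_one] at hn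
    have hiv := (swap_prefix_iff (w := v) hij).2 ((sameCycle_iff_invariants _ _ _).2 fun f hf =>
      (sameCycle_iff_invariants _ _ _).1 ((swap_prefix_iff hij).1 hiu) f (h hf))
    obtain ⟨hic, hu'⟩ := prefix_trans absLen_mul_le hiu hu
    obtain ⟨-, hv'⟩ := prefix_trans absLen_mul_le hiv hv
    have hlen := absLen_swap hij
    have key := ih hu' hv' (fun f hf x => ?_) (by omega)
    · have h1 := (prefix_mul absLen_mul_le hiv (p := (swap i j)⁻¹ * u) (by omega)).2
      rw [mul_inv_cancel_left] at h1
      omega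
    · have hle : ∀ {u v : Perm α} {x y : α}, invariants v ≤ invariants u → SameCycle u x y →
          SameCycle v x y := fun h h1 => (sameCycle_iff_invariants _ _ _).2 fun f hf =>
        (sameCycle_iff_invariants _ _ _).1 h1 f (h hf)
      have hx : SameCycle ((swap i j)⁻¹ * u) (((swap i j)⁻¹ * u) x) x :=
        sameCycle_apply_left.2 (SameCycle.refl _ _)
      have hxv := hle h (hle (invariants_le_of_prefix hiu).2 hx)
      have hxc := hle (invariants_le_of_prefix hu').1 hx
      have hcv := (invariants_le_of_prefix hv').1
      have hijc := not_sameCycle_swap_mul hij ((swap_prefix_iff hij).1 hic)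
      rw [swap_inv] at *
      -- If removing the transposition separated `x` from its image in `v`, one part would contain
      -- `i` and the other `j`. Both parts lie in one cycle of the reduced `c`, where `i` and `j`
      -- are separated by `hijc`.
      rw [← swap_mul_self_mul i j v] at hxv
      rcases hxv.of_swap_mul with h1 | ⟨h1, h2⟩ | ⟨h1, h2⟩
      · exact (sameCycle_iff_invariants _ _ _).1 h1 f hf
      · exact absurd ((hle hcv h1).symm.trans (hxc.trans (hle hcv h2))) hijc
      · exact absurd ((hle hcv h2).symm.trans (hxc.symm.trans (hle hcv h1))) hijc

end Equiv.Perm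

/-! ### The Birman–Ko–Lee presentation -/

namespace NewPresentation

open Equiv Equiv.Perm

variable {n : ℕ}

/-- The transposition attached to a band generator. -/
def gen (a : BandGen n) : Perm (Fin n) := swap a.t a.s

/-- The descending cycle. -/
def cycle (n : ℕ) : Perm (Fin n) := (finRotate n)⁻¹

theorem absLen_gen (a : BandGen n) : absLen (gen a) = 1 := absLen_swap a.lt.ne'

theorem gen_inv (a : BandGen n) : (gen a)⁻¹ = gen a := swap_inv _ _

theorem gen_apply_of_ne (a : BandGen n) {y : Fin n} (ht : y ≠ a.t) (hs : y ≠ a.s) :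
    gen a y = y := swap_apply_of_ne_of_ne ht hs

theorem gen_bandOf (i j : Fin n) (h : i ≠ j) : gen (bandOf i j h) = swap i j := by
  rcases bandOf_t_s i j h with ⟨h1, h2⟩ | ⟨h1, h2⟩
  · rw [gen, h1, h2]
  · rw [gen, h1, h2, swap_comm]

theorem gen_prefix_iff (a : BandGen n) (w : Perm (Fin n)) :
    absLen (gen a) + absLen ((gen a)⁻¹ * w) = absLen w ↔ SameCycle w a.t a.s :=
  swap_prefix_iff a.lt.ne'

theorem exists_gen_eq (w : Perm (Fin n)) (hw : absLen w = 1) : ∃ a, gen a = w := by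
  obtain ⟨i, j, hij, h⟩ := exists_swap_prefix (w := w) fun h => by simp [h, absLen_one] at hw
  refine ⟨bandOf i j hij, ?_⟩
  rw [gen_bandOf, ← inv_mul_eq_one]
  apply eq_one_of_absLen
  have := absLen_swap hij
  omega

theorem cycle_apply {x y : Fin n} (h : (x : ℕ) = y + 1) : cycle n x = y := by
  rw [cycle, Perm.inv_eq_iff_eq]
  ext
  rw [finRotate_val]
  split_ifs <;> omega

/-- As `cycle n` lowers each positive index by one, `u * cycle n` still steps down through the range
from `r` to `q`. -/
theorem eq_of_mem_invariants {u : Perm (Fin n)} {f : Fin n → ℚ} (hf : f ∈ invariants (u * cycle n))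
    {q r : Fin n} (hqr : q ≤ r) (hu : ∀ y, q ≤ y → y < r → u y = y) : f r = f q := by
  obtain ⟨r, hr⟩ := r
  obtain ⟨q, hq⟩ := q
  have hqr' : q ≤ r := hqr
  clear hqr
  induction r, hqr' using Nat.le_induction with
  | base => rfl
  | succ r hqr ih =>
    rw [← ih (by omega) fun y h1 h2 => hu y h1 (h2.trans (Fin.mk_lt_mk.2 (Nat.lt_succ_self r))),
      ← hf ⟨r + 1, hr⟩, Perm.mul_apply, cycle_apply (y := ⟨r, by omega⟩) rfl,
      hu _ (Fin.mk_le_mk.2 hqr) (Fin.mk_lt_mk.2 (Nat.lt_succ_self r))]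

theorem gen_prefix_mul_cycle (a : BandGen n) (u : Perm (Fin n))
    (hu : ∀ y, a.s ≤ y → y < a.t → u y = y) :
    absLen (gen a) + absLen ((gen a)⁻¹ * (u * cycle n)) = absLen (u * cycle n) := by
  rw [gen_prefix_iff, sameCycle_iff_invariants]
  exact fun f hf => eq_of_mem_invariants hf a.lt.le hu

theorem gen_prefix_cycle (a : BandGen n) :
    absLen (gen a) + absLen ((gen a)⁻¹ * cycle n) = absLen (cycle n) := by
  simpa using gen_prefix_mul_cycle a 1 fun _ _ _ => rfl

/-- Removing `a` from the cycle does not disturb the descent from `b.t` to `b.s`, so the ends of `b`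
remain in one cycle. -/
theorem gen_mul_gen_prefix {a b : BandGen n} (h : ∀ y, b.s ≤ y → y < b.t → y ≠ a.t ∧ y ≠ a.s) :
    absLen (gen a * gen b) = 2 ∧
      absLen (gen a * gen b) + absLen ((gen a * gen b)⁻¹ * cycle n) = absLen (cycle n) := by
  have h1 := prefix_mul absLen_mul_le (gen_prefix_cycle a) (gen_prefix_mul_cycle b (gen a)⁻¹
    fun y hy hy' => by rw [gen_inv]; exact gen_apply_of_ne a (h y hy hy').1 (h y hy hy').2)
  rwa [absLen_gen, absLen_gen] at h1

theorem gen_mul_gen_mul_gen_prefix {a b c : BandGen n}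
    (hb : ∀ y, b.s ≤ y → y < b.t → y ≠ a.t ∧ y ≠ a.s)
    (hc : ∀ y, c.s ≤ y → y < c.t → (y ≠ a.t ∧ y ≠ a.s) ∧ (y ≠ b.t ∧ y ≠ b.s)) :
    absLen (gen a * (gen b * gen c)) = 3 ∧ absLen (gen a * (gen b * gen c)) +
      absLen ((gen a * (gen b * gen c))⁻¹ * cycle n) = absLen (cycle n) := by
  have h1 := prefix_mul absLen_mul_le (gen_prefix_mul_cycle b (gen a)⁻¹
    fun y hy hy' => by rw [gen_inv]; exact gen_apply_of_ne a (hb y hy hy').1 (hb y hy hy').2)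
    (p := gen c) (by
      have := gen_prefix_mul_cycle c ((gen b)⁻¹ * (gen a)⁻¹) fun y hy hy' => by
        obtain ⟨⟨h1, h2⟩, h3, h4⟩ := hc y hy hy'
        rw [gen_inv, gen_inv, Perm.mul_apply, gen_apply_of_ne a h1 h2, gen_apply_of_ne b h3 h4]
      rwa [mul_assoc] at this)
  have h2 := prefix_mul absLen_mul_le (gen_prefix_cycle a) h1.2
  rwa [h1.1, absLen_gen, absLen_gen, absLen_gen] at h2

theorem gen_comm {a b : BandGen n} (h1 : a.t ≠ b.t) (h2 : a.t ≠ b.s) (h3 : a.s ≠ b.t)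
    (h4 : a.s ≠ b.s) : gen a * gen b = gen b * gen a := by
  rw [gen, gen, mul_swap_eq_swap_mul, swap_apply_of_ne_of_ne h1.symm h3.symm,
    swap_apply_of_ne_of_ne h2.symm h4.symm]

theorem gen_left {t s r : Fin n} (hts : s < t) (hsr : r < s) :
    gen ⟨t, s, hts⟩ * gen ⟨s, r, hsr⟩ = gen ⟨t, r, hsr.trans hts⟩ * gen ⟨t, s, hts⟩ := by
  simp only [gen]
  rw [mul_swap_eq_swap_mul, swap_apply_right,
    swap_apply_of_ne_of_ne (hsr.trans hts).ne hsr.ne]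

theorem gen_right {t s r : Fin n} (hts : s < t) (hsr : r < s) :
    gen ⟨t, r, hsr.trans hts⟩ * gen ⟨t, s, hts⟩ = gen ⟨s, r, hsr⟩ * gen ⟨t, r, hsr.trans hts⟩ := by
  simp only [gen]
  rw [mul_swap_eq_swap_mul, swap_apply_left, swap_apply_of_ne_of_ne hts.ne hsr.ne', swap_comm r s]

theorem noncrossing_int_iff {t s r q : ℤ} (hts : s < t) (hrq : q < r) :
    0 < (t - r) * (t - q) * (s - r) * (s - q) ↔
      r < s ∨ t < q ∨ (r < t ∧ s < q) ∨ (t < r ∧ q < s) := by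
  have e : (t - r) * (t - q) * (s - r) * (s - q) = ((t - r) * (s - q)) * ((t - q) * (s - r)) := by
    ring
  rw [e]
  constructor
  · intro h
    by_contra! hc
    obtain ⟨h1, h2, h3, h4⟩ := hc
    have h5 : (t - q) * (s - r) ≤ 0 := mul_nonpos_of_nonneg_of_nonpos (by omega) (by omega)
    have h6 : 0 ≤ (t - r) * (s - q) := by
      rcases lt_trichotomy r t with h | rfl | h
      · exact mul_nonneg (by omega) (by have := h3 h; omega)
      · simp
      · exact mul_nonneg_of_nonpos_of_nonpos (by omega) (by have := h4 h; omega)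
    exact absurd (mul_nonpos_of_nonneg_of_nonpos h6 h5) (not_le.2 h)
  · rintro (h | h | h | h)
    · exact mul_pos (mul_pos (by omega) (by omega)) (mul_pos (by omega) (by omega))
    · exact mul_pos (mul_pos_of_neg_of_neg (by omega) (by omega))
        (mul_pos_of_neg_of_neg (by omega) (by omega))
    · exact mul_pos_of_neg_of_neg (mul_neg_of_pos_of_neg (by omega) (by omega))
        (mul_neg_of_pos_of_neg (by omega) (by omega))
    · exact mul_pos_of_neg_of_neg (mul_neg_of_neg_of_pos (by omega) (by omega))
        (mul_neg_of_pos_of_neg (by omega) (by omega))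

/-- The non-crossing pairs of bands with four distinct ends. -/
theorem noncrossing_iff (a b : BandGen n) :
    0 < ((a.t : ℤ) - b.t) * ((a.t : ℤ) - b.s) * ((a.s : ℤ) - b.t) * ((a.s : ℤ) - b.s) ↔
      b.t < a.s ∨ a.t < b.s ∨ (b.t < a.t ∧ a.s < b.s) ∨ (a.t < b.t ∧ b.s < a.s) := by
  have ha := a.lt
  have hb := b.lt
  rw [noncrossing_int_iff (by omega) (by omega)]
  omega

theorem noncrossing_prefix {a b : BandGen n}
    (h : b.t < a.s ∨ a.t < b.s ∨ (b.t < a.t ∧ a.s < b.s) ∨ (a.t < b.t ∧ b.s < a.s)) :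
    gen a * gen b = gen b * gen a ∧ absLen (gen a * gen b) = 2 ∧
      absLen (gen a * gen b) + absLen ((gen a * gen b)⁻¹ * cycle n) = absLen (cycle n) := by
  have ha := a.lt
  have hb := b.lt
  have hcomm : gen a * gen b = gen b * gen a :=
    gen_comm (by omega) (by omega) (by omega) (by omega)
  refine ⟨hcomm, ?_⟩
  rcases h with h | h | h | h
  · exact gen_mul_gen_prefix fun y _ _ => by omega
  · rw [hcomm]
    exact gen_mul_gen_prefix fun y _ _ => by omega
  · exact gen_mul_gen_prefix fun y _ _ => by omega
  · rw [hcomm]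
    exact gen_mul_gen_prefix fun y _ _ => by omega

theorem triangle_relator (a b c d : BandGen n) :
    FreeGroup.of a * FreeGroup.of b * (FreeGroup.of c * FreeGroup.of d)⁻¹
      = ([a, b].map FreeGroup.of).prod * (([c, d].map FreeGroup.of).prod)⁻¹ := by simp

theorem of_comm {a b : BandGen n}
    (h : b.t < a.s ∨ a.t < b.s ∨ (b.t < a.t ∧ a.s < b.s) ∨ (a.t < b.t ∧ b.s < a.s)) :
    (newPresentation n).ofWord [a, b] = (newPresentation n).ofWord [b, a] :=
  (newPresentation n).ofWord_eq_of_mem_rels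
    (Eq.subst (motive := NewRel n) (triangle_relator a b b a)
      (NewRel.comm a b ((noncrossing_iff a b).2 h)))

theorem of_left {t s r : Fin n} (hts : s < t) (hsr : r < s) :
    (newPresentation n).ofWord [⟨t, s, hts⟩, ⟨s, r, hsr⟩]
      = (newPresentation n).ofWord [⟨t, r, hsr.trans hts⟩, ⟨t, s, hts⟩] :=
  (newPresentation n).ofWord_eq_of_mem_rels
    (Eq.subst (motive := NewRel n) (triangle_relator _ _ _ _) (NewRel.left t s r hts hsr))

theorem of_right {t s r : Fin n} (hts : s < t) (hsr : r < s) :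
    (newPresentation n).ofWord [⟨t, r, hsr.trans hts⟩, ⟨t, s, hts⟩]
      = (newPresentation n).ofWord [⟨s, r, hsr⟩, ⟨t, r, hsr.trans hts⟩] :=
  (newPresentation n).ofWord_eq_of_mem_rels
    (Eq.subst (motive := NewRel n) (triangle_relator _ _ _ _) (NewRel.right t s r hts hsr))

theorem triangle_prefix {t s r : Fin n} (hts : s < t) (hsr : r < s) :
    absLen (gen ⟨t, s, hts⟩ * gen ⟨s, r, hsr⟩) = 2 ∧
      absLen (gen ⟨t, s, hts⟩ * gen ⟨s, r, hsr⟩) +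
        absLen ((gen ⟨t, s, hts⟩ * gen ⟨s, r, hsr⟩)⁻¹ * cycle n) = absLen (cycle n) :=
  gen_mul_gen_prefix fun y _ _ => by dsimp only at *; omega

/-- The local join of two band generators. -/
def HasJoin (a b : BandGen n) : Prop := ∃ l₁ l₂ : List (BandGen n),
  (newPresentation n).ofWord (a :: l₁) = (newPresentation n).ofWord (b :: l₂) ∧
  ((a :: l₁).map gen).prod = ((b :: l₂).map gen).prod ∧ l₂.length = l₁.length ∧
  ∀ w, absLen w + absLen (w⁻¹ * cycle n) = absLen (cycle n) →
    absLen (gen a) + absLen ((gen a)⁻¹ * w) = absLen w →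
    absLen (gen b) + absLen ((gen b)⁻¹ * w) = absLen w →
    absLen ((a :: l₁).map gen).prod = (a :: l₁).length ∧
      absLen ((a :: l₁).map gen).prod + absLen (((a :: l₁).map gen).prod⁻¹ * w) = absLen w

theorem HasJoin.symm {a b : BandGen n} (h : HasJoin a b) : HasJoin b a := by
  obtain ⟨l₁, l₂, h1, h2, h3, h4⟩ := h
  refine ⟨l₂, l₁, h1.symm, h2.symm, h3.symm, fun w hw ha hb => ?_⟩
  rw [← h2, List.length_cons, h3]
  exact h4 w hw hb ha

theorem invariants_le_of_forall_sameCycle {w : Perm (Fin n)} {l : List (BandGen n)}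
    (h : ∀ a ∈ l, SameCycle w a.t a.s) : invariants w ≤ invariants (l.map gen).prod := by
  induction l with
  | nil => exact fun f _ x => rfl
  | cons a l ih =>
    rw [List.map_cons, List.prod_cons]
    refine (le_inf ?_ (ih fun b hb => h b (by simp [hb]))).trans (invariants_mul _ _)
    intro f hf
    rw [gen, mem_invariants_swap]
    exact (sameCycle_iff_invariants _ _ _).1 (h a (by simp)) f hf

/-- The join and `w` are both below the `n`-cycle, so by `prefix_of_invariants_le` their comparison
can be checked on cycles, letter by letter. -/
theorem HasJoin.of_words {a b : BandGen n} (l₁ l₂ : List (BandGen n))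
    (h1 : (newPresentation n).ofWord (a :: l₁) = (newPresentation n).ofWord (b :: l₂))
    (h2 : ((a :: l₁).map gen).prod = ((b :: l₂).map gen).prod) (h3 : l₂.length = l₁.length)
    (h4 : absLen ((a :: l₁).map gen).prod = (a :: l₁).length)
    (h5 : absLen ((a :: l₁).map gen).prod + absLen (((a :: l₁).map gen).prod⁻¹ * cycle n)
      = absLen (cycle n))
    (h6 : ∀ w, absLen w + absLen (w⁻¹ * cycle n) = absLen (cycle n) → SameCycle w a.t a.s →
      SameCycle w b.t b.s → ∀ c ∈ l₁, SameCycle w c.t c.s) : HasJoin a b := by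
  refine ⟨l₁, l₂, h1, h2, h3, fun w hw ha hb => ⟨h4, prefix_of_invariants_le h5 hw ?_⟩⟩
  rw [gen_prefix_iff] at ha hb
  refine invariants_le_of_forall_sameCycle fun c hc => ?_
  rcases List.mem_cons.1 hc with rfl | hc
  · exact ha
  · exact h6 w hw ha hb c hc

theorem HasJoin.refl (a : BandGen n) : HasJoin a a := by
  refine HasJoin.of_words [] [] rfl rfl rfl ?_ ?_ fun _ _ _ _ _ h => absurd h (List.not_mem_nil)
  all_goals simp only [List.map_cons, List.map_nil, List.prod_cons, List.prod_nil, mul_one]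
  · exact absLen_gen a
  · exact gen_prefix_cycle a

theorem hasJoin_of_noncrossing {a b : BandGen n}
    (h : b.t < a.s ∨ a.t < b.s ∨ (b.t < a.t ∧ a.s < b.s) ∨ (a.t < b.t ∧ b.s < a.s)) :
    HasJoin a b := by
  obtain ⟨h1, h2, h3⟩ := noncrossing_prefix h
  refine HasJoin.of_words [b] [a] (of_comm h) ?_ rfl ?_ ?_ fun w hw ha hb c hc => ?_
  · simpa using h1
  · simpa using h2
  · simpa using h3
  · rw [List.mem_singleton.1 hc]
    exact hb

/-- Any two of the three bands have the same join, the 3-cycle on `t`, `s`, `r`; two sides of the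
triangle put all three points in one cycle. -/
theorem hasJoin_triangle {t s r : Fin n} (hts : s < t) (hsr : r < s) :
    HasJoin ⟨t, s, hts⟩ ⟨s, r, hsr⟩ ∧ HasJoin ⟨t, s, hts⟩ ⟨t, r, hsr.trans hts⟩ ∧
      HasJoin ⟨s, r, hsr⟩ ⟨t, r, hsr.trans hts⟩ := by
  obtain ⟨h2, h3⟩ := triangle_prefix hts hsr
  have e1 := gen_left hts hsr
  have e2 := gen_right hts hsr
  refine ⟨HasJoin.of_words [⟨s, r, hsr⟩] [⟨t, r, hsr.trans hts⟩]
      ((of_left hts hsr).trans (of_right hts hsr)) ?_ rfl ?_ ?_ fun w hw ha hb c hc => ?_,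
    HasJoin.of_words [⟨s, r, hsr⟩] [⟨t, s, hts⟩] (of_left hts hsr) ?_ rfl ?_ ?_
      fun w hw ha hb c hc => ?_,
    HasJoin.of_words [⟨t, r, hsr.trans hts⟩] [⟨t, s, hts⟩] (of_right hts hsr).symm ?_ rfl ?_ ?_
      fun w hw ha hb c hc => ?_⟩
  · simpa using e1.trans e2
  · simpa using h2
  · simpa using h3
  · rw [List.mem_singleton.1 hc]
    exact hb
  · simpa using e1
  · simpa using h2
  · simpa using h3
  · rw [List.mem_singleton.1 hc]
    exact ha.symm.trans hb
  · simpa using e2.symm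
  · rw [e1, e2] at h2
    simpa using h2
  · rw [e1, e2] at h3
    simpa using h3
  · rw [List.mem_singleton.1 hc]
    exact hb

/-- Two crossing bands below an element of the interval lie in one cycle. -/
theorem sameCycle_of_crossing {t s r q : Fin n} (hts : s < t) (hsr : r < s) (hrq : q < r)
    {w : Perm (Fin n)} (hw : absLen w + absLen (w⁻¹ * cycle n) = absLen (cycle n))
    (ha : SameCycle w t r) (hb : SameCycle w s q) : SameCycle w t s := by
  have htr : t ≠ r := (hsr.trans hts).ne'
  have ha' := (swap_prefix_iff htr).2 ha
  obtain ⟨-, h2⟩ := prefix_trans absLen_mul_le ha' hw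
  have hle := (invariants_le_of_prefix ha').2
  have hle' := (invariants_le_of_prefix h2).1
  have hb' : SameCycle (swap t r * ((swap t r)⁻¹ * w)) s q := by rwa [mul_inv_cancel_left]
  have up : ∀ {x y}, SameCycle ((swap t r)⁻¹ * w) x y → SameCycle w x y := fun h =>
    (sameCycle_iff_invariants _ _ _).2 fun f hf => (sameCycle_iff_invariants _ _ _).1 h f (hle hf)
  rcases hb'.of_swap_mul with h | ⟨h, -⟩ | ⟨h, -⟩
  · exfalso
    -- The half-open interval from `r` to `t` is a union of cycles of `(t r) c`, hence of `(t r) w`.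
    -- It contains `s` but not `q`, so these two can only be joined in `w` through `t` and `r`.
    let f : Fin n → ℚ := fun x => if r < x ∧ x ≤ t then 1 else 0
    have hf : f ∈ invariants ((swap t r)⁻¹ * cycle n) := by
      intro x
      obtain ⟨y, rfl⟩ := (finRotate n).surjective x
      have hy : cycle n (finRotate n y) = y := by rw [cycle, Perm.inv_eq_iff_eq]
      rw [Perm.mul_apply, hy, swap_inv, swap_apply_def]
      have h1 := finRotate_val y
      have h2 := y.2
      have h3 := t.2
      have h4 : r < t := hsr.trans hts
      simp only [f]
      congr 1
      apply propext
      simp only [Fin.lt_def, Fin.le_def, h1]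
      simp only [Fin.lt_def] at h4
      split_ifs with h5 h6 h7 h7 h8 <;> simp only [Fin.ext_iff] at * <;> omega
    have h1 := (sameCycle_iff_invariants _ _ _).1 h f (hle' hf)
    have hs : f s = 1 := if_pos ⟨hsr, hts.le⟩
    have hq : f q = 0 := if_neg fun h => absurd h.1 (not_lt.2 hrq.le)
    rw [hs, hq] at h1
    exact one_ne_zero h1
  · exact (up h).symm
  · exact ha.trans (up h).symm

/-- The join is the 4-cycle on the ends. Its two spellings are linked by triangle relations: `a_tr
a_ts a_rq = a_ts a_sr a_rq = a_ts a_sq a_sr = a_sq a_tq a_sr`. -/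
theorem hasJoin_of_crossing {t s r q : Fin n} (hts : s < t) (hsr : r < s) (hrq : q < r) :
    HasJoin ⟨t, r, hsr.trans hts⟩ ⟨s, q, hrq.trans hsr⟩ := by
  have htr := hsr.trans hts
  have hsq := hrq.trans hsr
  have htq := hrq.trans htr
  have e1 := gen_left hts hsr
  have e2 := gen_left hsr hrq
  have e3 := gen_right hsr hrq
  have e4 := gen_left hts hsq
  have e5 := gen_right hts hsq
  have hprefix := gen_mul_gen_mul_gen_prefix (a := (⟨t, s, hts⟩ : BandGen n)) (b := ⟨s, r, hsr⟩)
    (c := ⟨r, q, hrq⟩) (fun y _ _ => by dsimp only at *; omega)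
    (fun y _ _ => by dsimp only at *; omega)
  rw [← mul_assoc, e1, mul_assoc] at hprefix
  have hword : (newPresentation n).ofWord [⟨t, r, htr⟩, ⟨t, s, hts⟩, ⟨r, q, hrq⟩]
      = (newPresentation n).ofWord [⟨s, q, hsq⟩, ⟨t, q, htq⟩, ⟨s, r, hsr⟩] := by
    have w1 := of_left hts hsr
    have w2 := of_left hsr hrq
    have w4 := (of_left hts hsq).trans (of_right hts hsq)
    have c1 := (newPresentation n).ofWord_congr [] [⟨r, q, hrq⟩] w1.symm
    have c2 := (newPresentation n).ofWord_congr [⟨t, s, hts⟩] [] w2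
    have c3 := (newPresentation n).ofWord_congr [] [⟨s, r, hsr⟩] w4
    exact c1.trans (c2.trans c3)
  refine HasJoin.of_words [⟨t, s, hts⟩, ⟨r, q, hrq⟩] [⟨t, q, htq⟩, ⟨s, r, hsr⟩] hword ?_ rfl ?_ ?_
    fun w hw ha hb c hc => ?_
  · simp only [List.map_cons, List.map_nil, List.prod_cons, List.prod_nil, mul_one]
    rw [← mul_assoc, ← e1, mul_assoc, e2, ← mul_assoc, e4, e5, mul_assoc]
  · simpa using hprefix.1
  · simpa using hprefix.2
  · have h := sameCycle_of_crossing hts hsr hrq hw ha hb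
    simp only [List.mem_cons, List.not_mem_nil, or_false] at hc
    rcases hc with rfl | rfl
    · exact h
    · exact (h.symm.trans ha).symm.trans hb

theorem hasJoin (a b : BandGen n) : HasJoin a b := by
  obtain ⟨t, s, hts⟩ := a
  obtain ⟨r, q, hrq⟩ := b
  by_cases h : q.val > t ∨ s.val > r ∨ (r.val < t ∧ s.val < q) ∨ (t.val < r ∧ q.val < s)
  · refine hasJoin_of_noncrossing ?_
    simp only [Fin.lt_def]
    tauto
  rcases lt_trichotomy t r with h1 | rfl | h1
  · rcases lt_trichotomy s q with h2 | rfl | h2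
    · rcases (show q ≤ t by omega).eq_or_lt with rfl | h3
      · exact (hasJoin_triangle hrq hts).1.symm
      · exact (hasJoin_of_crossing h1 h3 h2).symm
    · exact (hasJoin_triangle h1 hts).2.2
    · omega
  · rcases lt_trichotomy s q with h2 | rfl | h2
    · exact (hasJoin_triangle hrq h2).2.1.symm
    · exact HasJoin.refl _
    · exact (hasJoin_triangle hts h2).2.1
  · rcases lt_trichotomy s q with h2 | rfl | h2
    · omega
    · exact (hasJoin_triangle h1 hrq).2.2.symm
    · rcases (show s ≤ r by omega).eq_or_lt with rfl | h3
      · exact (hasJoin_triangle hts hrq).1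
      · exact hasJoin_of_crossing h1 h3 h2

/-- The absolute order on permutations. -/
noncomputable def germ (n : ℕ) : IntervalGerm (Perm (Fin n)) where
  len := absLen
  top := cycle n
  len_one := absLen_one
  eq_one_of_len := eq_one_of_absLen
  len_mul_le := absLen_mul_le
  len_conj := absLen_conj _
  exists_atom w _ hw := by
    obtain ⟨i, j, hij, h⟩ := exists_swap_prefix hw
    exact ⟨_, absLen_swap hij, h⟩
  exists_join := exists_join_of_words absLen_mul_le absLen_one gen absLen_gen exists_gen_eq _
    fun a b => by
      obtain ⟨l₁, l₂, -, h1, h2, h3⟩ := hasJoin a b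
      exact ⟨l₁, l₂, h1, h2, h3⟩

theorem fundWord_length (n : ℕ) : (newPresentation n).fundWord.length = n - 1 := by
  refine (List.length_map _).trans ?_
  rw [List.length_reverse, List.length_finRange]

theorem prod_fundWord : ((newPresentation n).fundWord.map gen).prod = cycle n := by
  let s : ℕ → Perm (Fin n) := fun i =>
    if h : i < n - 1 then swap ⟨i + 1, by omega⟩ ⟨i, by omega⟩ else 1
  have hs0 : (newPresentation n).fundWord.map gen = (List.range (n - 1)).reverse.map s := by
    change List.map _ (List.map _ _) = _
    rw [List.map_map, ← List.map_coe_finRange_eq_range, ← List.map_reverse, List.map_map]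
    refine List.map_congr_left fun k _ => ?_
    simp [s, gen]
  have hs1 : ∀ k (x : Fin n), k + 1 < n → (s k x : ℕ) =
      if (x : ℕ) = k then k + 1 else if (x : ℕ) = k + 1 then k else x := by
    intro k x hk
    simp only [s, dif_pos (show k < n - 1 by omega), swap_apply_def, Fin.ext_iff]
    split_ifs <;> first | rfl | omega
  -- The last `m` letters form the descending cycle on `0, …, m`.
  have h1 : ∀ m (x : Fin n), m < n → (((List.range m).reverse.map s).prod x : ℕ) =
      if (x : ℕ) = 0 then m else if (x : ℕ) ≤ m then (x : ℕ) - 1 else x := by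
    intro m
    induction m with
    | zero => intro x _; simp; grind
    | succ m ih =>
      intro x hm
      rw [List.range_succ, List.reverse_append, List.map_append, List.prod_append, Perm.mul_apply]
      simp only [List.reverse_cons, List.reverse_nil, List.nil_append, List.map_cons, List.map_nil,
        List.prod_cons, List.prod_nil, mul_one]
      rw [hs1 _ _ hm, ih x (by omega)]
      grind
  rw [hs0, cycle, eq_inv_iff_mul_eq_one]
  ext x
  have := x.2
  rw [Perm.mul_apply, h1 _ _ (by omega), finRotate_val, Perm.one_apply]
  grind

/-- A single cycle through all points leaves only the constant functions invariant. -/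
theorem absLen_cycle (hn : 1 ≤ n) : absLen (cycle n) = n - 1 := by
  have h1 : invariants (cycle n) = Submodule.span ℚ {fun _ => 1} := by
    apply le_antisymm
    · intro f hf
      refine Submodule.mem_span_singleton.2 ⟨f ⟨0, hn⟩, ?_⟩
      funext x
      have : f ∈ invariants (1 * cycle n) := by rwa [one_mul]
      have := eq_of_mem_invariants this (q := ⟨0, hn⟩) (r := x) (Nat.zero_le _) fun _ _ _ => rfl
      simp [this]
    · rw [Submodule.span_singleton_le_iff_mem]
      exact fun _ => rfl
  have h2 := absLen_add_finrank (cycle n)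
  rw [h1, finrank_span_singleton, Fintype.card_fin] at h2
  · omega
  · exact fun h => one_ne_zero (congrFun h ⟨0, hn⟩)

/-- The model of the Birman–Ko–Lee presentation. -/
noncomputable def model (n : ℕ) (hn : 2 ≤ n) : (newPresentation n).IntervalModel (germ n) where
  gen := gen
  len_gen := absLen_gen
  gen_le := gen_prefix_cycle
  exists_gen h hh _ := exists_gen_eq h hh
  rel := by
    rintro _ (⟨a, b, h⟩ | ⟨t, s, r, hts, hsr⟩ | ⟨t, s, r, hts, hsr⟩)
    · obtain ⟨h1, h2, h3⟩ := noncrossing_prefix ((noncrossing_iff a b).1 h)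
      exact ⟨[a, b], [b, a], triangle_relator a b b a, h1, h2, rfl, h3⟩
    · obtain ⟨h1, h2⟩ := triangle_prefix hts hsr
      exact ⟨[⟨t, s, hts⟩, ⟨s, r, hsr⟩], [⟨t, r, hsr.trans hts⟩, ⟨t, s, hts⟩],
        triangle_relator _ _ _ _, gen_left hts hsr, h1, rfl, h2⟩
    · obtain ⟨h1, h2⟩ := triangle_prefix hts hsr
      rw [gen_left hts hsr] at h1 h2
      exact ⟨[⟨t, r, hsr.trans hts⟩, ⟨t, s, hts⟩], [⟨s, r, hsr⟩, ⟨t, r, hsr.trans hts⟩],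
        triangle_relator _ _ _ _, gen_right hts hsr, h1, rfl, h2⟩
  join := hasJoin
  prod_fundWord := prod_fundWord
  len_top := (absLen_cycle (by omega)).trans (fundWord_length n).symm
  fundWord_ne_nil h := by
    have h1 := fundWord_length n
    rw [h] at h1
    simp at h1
    omega
  shift := fun (a : BandGen n) => by
    refine ⟨bandPerm (finRotate n) a, PresentedGroup.autOfEquiv_of _ _ _ a, ?_⟩
    change gen (bandOf _ _ ((finRotate n).injective.ne a.lt.ne')) = (cycle n)⁻¹ * gen a * cycle n
    rw [gen_bandOf, gen, cycle, inv_inv, mul_swap_eq_swap_mul, mul_assoc, mul_inv_cancel, mul_one]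

end NewPresentation

/-! ### The theorem for both presentations -/

theorem theorem2p1 (n : ℕ) (hn : 2 ≤ n) :
    (∀ X : BraidPresentation, X = oldPresentation n ∨ X = newPresentation n →
      ∀ W : X.Braid,
        (∃! N : ℤ × List X.Braid, X.IsNormalForm W N) ∧
        ((∃ V : X.Braid, IsConj W V ∧ X.inf W < X.inf V) →
          X.inf W < X.inf (X.cycling^[X.fundLength - 1] W)) ∧
        ((∃ V : X.Braid, IsConj W V ∧ X.sup V < X.sup W) →
          X.sup (X.decycling^[X.fundLength - 1] W) < X.sup W)) ∧
    (oldPresentation n).fundLength - 1 = (n ^ 2 - n) / 2 - 1 ∧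
    (newPresentation n).fundLength - 1 = n - 2 := by
  refine ⟨?_, ?_, ?_⟩
  · rintro X (rfl | rfl)
    · exact (OldPresentation.model n hn).normalForm_cycling_decycling
    · exact (NewPresentation.model n hn).normalForm_cycling_decycling
  · have := OldPresentation.fundWord_length n
    rw [BraidPresentation.fundLength, sq]
    omega
  · rw [BraidPresentation.fundLength, NewPresentation.fundWord_length]
    omega
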